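/- **Proposition ($\mathbb R_i\simeq\mathbb R_c$).** Let $\Sigma=\{0,1,.\}$ and $\mathcal B=(\Sigma^*)^{\Sigma^*}$. For $\varphi\in\mathcal B$ let $|\varphi|(n)=\max\{|\varphi(\mathbf a)| : |\mathbf a|\le n\}$. *Parametrised spaces.* A preparametrised space is a triple $(X,\xi,\mu)$ of a set, a partial surjection $\xi\colon{\subseteq}\mathcal B\to X$ (if $\xi(\varphi)=x$, then $\varphi$ is a name of $x$) and a map $\mu$ from $\operatorname{dom}(\xi)$ to the non-decreasing functions $\mathbb N\to\mathbb N$. A function $f\colon(X,\xi_X,\mu_X)\to(Y,\xi_Y,\mu_Y)$ is polytime computable if there are an oracle Turing machine $M^?$ and second-order polynomials $P,Q$ such that for every $\varphi\in\operatorname{dom}(\xi_X)$: $M^\varphi$ is total and is a $\xi_Y$-name of $f(\xi_X(\varphi))$; on each input $\mathbf a$ the machine stops after at most $P(\mu_X(\varphi),|\mathbf a|)$ steps; and $\mu_Y(M^\varphi)(n)\le Q(\mu_X(\varphi),n)$ for all $n$. Here an oracle call is a single step that replaces the content of the answer tape and moves no head, and the second-order polynomials are the smallest class of functions $\mathbb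 N^{\mathbb N}\times\mathbb N\to\mathbb N$ that contains $(l,n)\mapsto p(n)$ for $p\in\mathbb N[X]$ and is closed under pointwise sums and products and under $P\mapsto\big((l,n)\mapsto l(P(l,n))\big)$. A preparametrised space is a parametrised space if its identity map is polytime computable. Two spaces are polytime isomorphic if there are mutually inverse polytime computable maps between them. A point $x$ is polytime computable if it has a name $\varphi$ that is computable by an ordinary Turing machine in polynomial time and for which $\mu(\varphi)$ is bounded by a polynomial. *Encodings.* A code of a nonzero integer is a sign digit ($1$ for negative) followed by the binary expansion of its absolute value without leading zeros; the binary strings of length at most one are the codes of $0$. A code of a dyadic rational is a code of an integer, the separator, and the binary digits after the point, the last of which (if there are any) is not $0$; the sign digit applies to the whole number. A finite interval $[r\pm\varepsilon]=[r-\varepsilon,r+\varepsilon]$ with $r,\varepsilon$ dyadic and $\varepsilon\ge 0$ is encoded by $\langle\mathbf a,\mathbf b\rangle$, where $\mathbf a$ and $\mathbf b$ are codes of $r$ and $\varepsilon$. Here $\langle\mathbf a,\mathbf b\rangle$ alternates between the letters of $\mathbf c$, $\mathbf a$ and $\mathbf b$, where $\mathbf a,\mathbf b$ are padded with zeros to the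 length of the longer one, and $\mathbf c$ consists of $\min\{|\mathbf a|,|\mathbf b|\}$ ones, a zero, a digit saying which of the two strings is longer, and zeros up to the length of the longer one (if $\mathbf c$ is longer than the padded strings, its remaining letters come last). The infinite interval $[-\infty,\infty]$ is encoded by the empty string. A string function $\psi$ encodes a sequence $(u_n)_{n\in\mathbb N}$ if it maps the code of the integer $2^n$ to a code of $u_n$, for all $n$. *The two spaces.* The Cauchy reals $\mathbb R_c$: a name of $x\in\mathbb R$ is any $\psi\in\mathcal B$ that encodes dyadic numbers $q_n$ with $|q_n-x|\le 2^{-n}$ for all $n$; the parameter of $\psi$ is its size $|\psi|$. The interval reals $\mathbb R_i$: a name of $x$ is any $\psi\in\mathcal B$ that encodes a nested sequence of dyadic intervals $J_0\supseteq J_1\supseteq\cdots$ (finite or infinite ones) with $\bigcap_n J_n=\{x\}$; its parameter is $$\mu(\psi)(n)=\min\{N : \operatorname{diam}(J_N)\le 2^{-n}\}+\lceil\log_2(|x|+1)\rceil,\qquad \operatorname{diam}([r\pm\varepsilon])=2\varepsilon .$$ *Claim.* $\mathbb R_i$ and $\mathbb R_c$ are parametrised spaces, and they are polytime isomorphic;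 in fact the identity map of $\mathbb R$ is polytime computable both as a map $\mathbb R_i\to\mathbb R_c$ and as a map $\mathbb R_c\to\mathbb R_i$. Consequently a real number is polytime computable as a point of $\mathbb R_i$ if and only if it is polytime computable as a point of $\mathbb R_c$. -/

import Mathlib

namespace ParamSpace

/-! ## Strings and Baire space -/

/-- The alphabet: the two binary digits and a separator (the binary point). -/
inductive Letter
  | zero
  | one
  | sep
  deriving DecidableEq

instance : Finite Letter :=
  Finite.of_surjective (fun i : Fin 3 => ![Letter.zero, Letter.one, Letter.sep] i) (by
    intro s
    cases s
    · exact ⟨0, rfl⟩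
    · exact ⟨1, rfl⟩
    · exact ⟨2, rfl⟩)

/-- Finite strings over the alphabet. -/
abbrev Str := List Letter

/-- Baire space: all string functions. -/
abbrev Baire := Str → Str

/-- The size `|φ|(n) = max {|φ(a)| : |a| ≤ n}` of a string function. -/
noncomputable def size (φ : Baire) (n : ℕ) : ℕ :=
  sSup {k | ∃ a : Str, a.length ≤ n ∧ k = (φ a).length}

theorem size_bddAbove (φ : Baire) (n : ℕ) :
    BddAbove {k | ∃ a : Str, a.length ≤ n ∧ k = (φ a).length} := by
  have h : {k | ∃ a : Str, a.length ≤ n ∧ k = (φ a).length}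
      = (fun a => (φ a).length) '' {a : Str | a.length ≤ n} := by
    ext k
    constructor
    · rintro ⟨a, h, rfl⟩
      exact ⟨a, h, rfl⟩
    · rintro ⟨a, h, rfl⟩
      exact ⟨a, h, rfl⟩
  rw [h]
  exact ((List.finite_length_le Letter n).image _).bddAbove

theorem size_monotone (φ : Baire) : Monotone (size φ) := by
  intro m n h
  refine csSup_le_csSup (size_bddAbove φ n) ⟨(φ []).length, [], Nat.zero_le m, rfl⟩ ?_
  rintro k ⟨a, ha, rfl⟩
  exact ⟨a, ha.trans h, rfl⟩

/-! ## Oracle Turing machines -/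

/-- Contents of a tape cell: blank, a letter, or an auxiliary symbol of the machine. -/
inductive Cell (Aux : Type)
  | blank
  | letter (s : Letter)
  | aux (x : Aux)

/-- The letter in a cell, if there is one. -/
def Cell.letter? {Aux : Type} : Cell Aux → Option Letter
  | .letter s => some s
  | _ => none

inductive Move
  | left
  | stay
  | right

def Move.shift : Move → ℤ
  | .left => -1
  | .stay => 0
  | .right => 1

/-- A two-way infinite tape with a head. -/
structure Tape (Aux : Type) where
  cells : ℤ → Cell Aux
  head : ℤ

namespace Tape

variable {Aux : Type}

/-- The cells of a tape that carries the string `s` in the cells `0, …, |s| - 1` and is blank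
elsewhere. -/
def cellsOf (s : Str) : ℤ → Cell Aux
  | .ofNat i => (s[i]?).elim Cell.blank Cell.letter
  | .negSucc _ => Cell.blank

def read (T : Tape Aux) : Cell Aux := T.cells T.head

/-- Write into the scanned cell, then move the head. -/
def act (T : Tape Aux) (c : Cell Aux) (m : Move) : Tape Aux where
  cells := Function.update T.cells T.head c
  head := T.head + m.shift

/-- The string on a tape: the letters from cell `0` up to (excluding) the first cell that
carries no letter. (On a tape that occurs in a computation, almost all cells are blank.) -/
noncomputable def content (T : Tape Aux) : Str :=
  (List.range (sInf {n : ℕ | (T.cells n).letter? = none})).filterMap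
    fun i : ℕ => (T.cells i).letter?

end Tape

/-- The tapes of an oracle machine: the four designated tapes and its work tapes. -/
inductive TapeName (Work : Type)
  | input
  | output
  | query
  | answer
  | work (w : Work)
  deriving DecidableEq

/-- A deterministic multi-tape oracle Turing machine with finitely many states, auxiliary tape
symbols and work tapes. In the state `oracle` the oracle is consulted, after which the machine
continues in the state `resume`. -/
structure OracleMachine where
  State : Type
  Aux : Type
  Work : Type
  finiteState : Finite State
  finiteAux : Finite Aux
  finiteWork : Finite Work
  start : State
  halt : State
  oracle : State
  resume : State
  /-- Next state, and for every tape the symbol to be written and the head movement. -/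
  trans : State → (TapeName Work → Cell Aux) → State × (TapeName Work → Cell Aux × Move)

namespace OracleMachine

/-- A configuration of the machine. -/
structure Cfg (M : OracleMachine) where
  state : M.State
  tapes : TapeName M.Work → Tape M.Aux

/-- The initial configuration: the input is on the input tape, all other tapes are blank,
and all heads are at cell `0`. -/
def init (M : OracleMachine) (a : Str) : M.Cfg where
  state := M.start
  tapes
    | .input => ⟨Tape.cellsOf a, 0⟩
    | _ => ⟨Tape.cellsOf [], 0⟩

open Classical in
/-- One step with oracle `φ`. In the oracle state the whole content of the answer tape is
replaced by the value of `φ` on the content of the query tape; no head moves. -/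
noncomputable def step (M : OracleMachine) (φ : Baire) (c : M.Cfg) : M.Cfg :=
  if c.state = M.halt then c
  else if c.state = M.oracle then
    { state := M.resume
      tapes := fun k => match k with
        | .answer => ⟨Tape.cellsOf (φ (c.tapes .query).content), (c.tapes .answer).head⟩
        | k => c.tapes k }
  else
    let r := M.trans c.state fun k => (c.tapes k).read
    { state := r.1
      tapes := fun k => (c.tapes k).act (r.2 k).1 (r.2 k).2 }

/-- The configuration after `t` steps. -/
noncomputable def run (M : OracleMachine) (φ : Baire) (a : Str) (t : ℕ) : M.Cfg :=
  (M.step φ)^[t] (M.init a)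

/-- The set of all `t` such that the machine has halted after `t` steps. -/
def haltTimes (M : OracleMachine) (φ : Baire) (a : Str) : Set ℕ :=
  {t | (M.run φ a t).state = M.halt}

/-- The number of steps until termination (`⊤` if the machine does not terminate). -/
noncomputable def time (M : OracleMachine) (φ : Baire) (a : Str) : ℕ∞ :=
  ⨅ t ∈ M.haltTimes φ a, (t : ℕ∞)

/-- The partial string function `M^φ`. -/
noncomputable def eval (M : OracleMachine) (φ : Baire) : Str →. Str := fun a =>
  { Dom := (M.haltTimes φ a).Nonempty
    get := fun _ => ((M.run φ a (sInf (M.haltTimes φ a))).tapes .output).content }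

/-- The partial operator on Baire space computed by the machine; it is defined at `φ`
if and only if `M^φ` is total. -/
noncomputable def operator (M : OracleMachine) : Baire →. Baire := fun φ =>
  { Dom := ∀ a, (M.eval φ a).Dom
    get := fun h a => (M.eval φ a).get (h a) }

/-- The machine is an ordinary Turing machine: it cannot enter the oracle state. -/
def OracleFree (M : OracleMachine) : Prop :=
  M.start ≠ M.oracle ∧ ∀ q r, (M.trans q r).1 ≠ M.oracle

end OracleMachine

/-- A string function is polytime computable if an ordinary Turing machine computes it in
polynomial time. (The oracle `θ` is irrelevant for such a machine.) -/
def PolytimeStringFunction (φ : Baire) : Prop :=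
  ∃ (M : OracleMachine) (p : Polynomial ℕ), M.OracleFree ∧
    ∀ (θ : Baire) (a : Str), φ a ∈ M.eval θ a ∧ M.time θ a ≤ (p.eval a.length : ℕ)

/-- Second-order polynomials. -/
inductive SOP : ((ℕ → ℕ) → ℕ → ℕ) → Prop
  | poly (p : Polynomial ℕ) : SOP fun _ n => p.eval n
  | app {P} : SOP P → SOP fun l n => l (P l n)
  | add {P Q} : SOP P → SOP Q → SOP fun l n => P l n + Q l n
  | mul {P Q} : SOP P → SOP Q → SOP fun l n => P l n * Q l n

/-! ## Parametrised spaces -/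

/-- A preparametrised space with underlying set `X`: a representation (a partial surjection from
Baire space) and a parameter, which assigns a non-decreasing function to every name. -/
structure PreparametrisedSpace (X : Type) where
  rep : Baire →. X
  rep_surjective : ∀ x, ∃ φ, x ∈ rep φ
  param : rep.Dom → ℕ → ℕ
  param_monotone : ∀ φ, Monotone (param φ)

/-- `F` translates names of `x` to names of `f x`. -/
def IsRealiser {X Y : Type} (A : PreparametrisedSpace X) (B : PreparametrisedSpace Y)
    (F : Baire →. Baire) (f : X → Y) : Prop :=
  ∀ φ, ∀ x ∈ A.rep φ, ∃ ψ ∈ F φ, f x ∈ B.rep ψ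

/-- Polytime computability of functions between preparametrised spaces: some machine computes a
realiser, with running time and parameter blowup bounded by second-order polynomials in the
parameter of the input name. -/
def PolytimeComputable {X Y : Type} (A : PreparametrisedSpace X) (B : PreparametrisedSpace Y)
    (f : X → Y) : Prop :=
  ∃ (M : OracleMachine) (P Q : (ℕ → ℕ) → ℕ → ℕ), SOP P ∧ SOP Q ∧
    IsRealiser A B M.operator f ∧
    (∀ (φ : A.rep.Dom) (a : Str), M.time φ a ≤ (P (A.param φ) a.length : ℕ)) ∧
    ∀ (φ : A.rep.Dom) (ψ : B.rep.Dom), (ψ : Baire) ∈ M.operator φ →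
      ∀ n, B.param ψ n ≤ Q (A.param φ) n

/-- A parametrised space is a preparametrised space whose identity is polytime computable. -/
def IsParametrisedSpace {X : Type} (A : PreparametrisedSpace X) : Prop :=
  PolytimeComputable A A id

/-- Polytime isomorphy: there are mutually inverse polytime computable maps. -/
def PolytimeIsomorphic {X Y : Type} (A : PreparametrisedSpace X) (B : PreparametrisedSpace Y) :
    Prop :=
  ∃ (α : X → Y) (β : Y → X), PolytimeComputable A B α ∧ PolytimeComputable B A β ∧
    α ∘ β = id ∧ β ∘ α = id

/-- Polytime equivalence of two structures on the same set: the identity is polytime computable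
in both directions. -/
def PolytimeEquivalent {X : Type} (A B : PreparametrisedSpace X) : Prop :=
  PolytimeComputable A B id ∧ PolytimeComputable B A id

/-- `x` is computable in polynomial time: it has a polytime computable name whose parameter is
bounded by a polynomial. -/
def PolytimePoint {X : Type} (A : PreparametrisedSpace X) (x : X) : Prop :=
  ∃ φ : A.rep.Dom, x ∈ A.rep φ ∧ PolytimeStringFunction φ ∧
    ∃ p : Polynomial ℕ, ∀ n, A.param φ n ≤ p.eval n

/-- The partial function with a given graph. -/
noncomputable def ofGraph {X : Type} (N : Baire → X → Prop) : Baire →. X := fun φ =>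
  { Dom := ∃ x, N φ x
    get := fun h => h.choose }

theorem mem_ofGraph {X : Type} {N : Baire → X → Prop}
    (hN : ∀ φ x y, N φ x → N φ y → x = y) (φ : Baire) (x : X) : x ∈ ofGraph N φ ↔ N φ x := by
  constructor
  · rintro ⟨h, rfl⟩
    exact h.choose_spec
  · intro h
    have h' : ∃ x, N φ x := ⟨x, h⟩
    exact ⟨h', hN _ _ _ h'.choose_spec h⟩

/-! ## Notations for integers, dyadic numbers and dyadic intervals -/

/-- Read a string of binary digits. -/
def toBits : Str → Option (List Bool)
  | [] => some []
  | .zero :: s => (toBits s).map (List.cons false)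
  | .one :: s => (toBits s).map (List.cons true)
  | .sep :: _ => none

/-- The natural number with the given binary digits, most significant digit first. -/
def binVal (l : List Bool) : ℕ := l.foldl (fun n b => 2 * n + b.toNat) 0

/-- The notation of the integers: a sign digit (`1` means negative) followed by the binary
expansion of the absolute value without leading zeros. All strings of at most one digit are
codes of zero. -/
def notationInt (s : Str) : Option ℤ :=
  match toBits s with
  | none => none
  | some [] => some 0
  | some [_] => some 0
  | some (b :: true :: t) => some ((if b then -1 else 1) * (binVal (true :: t) : ℤ))
  | some (_ :: false :: _) => none

/-- The notation of the dyadic rationals: a code of an integer, the separator, and the binary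
digits after the binary point, the last of which is not zero. A leading digit `1` of the integer
code makes the whole number negative (so it matters also if the integer part is zero). -/
def notationDyadic (s : Str) : Option ℚ :=
  match s.dropWhile (· ≠ Letter.sep) with
  | [] => none
  | _ :: v =>
    match notationInt (s.takeWhile (· ≠ Letter.sep)), toBits v with
    | some z, some d =>
      if d.getLast? = some false then none
      else some ((if s.head? = some Letter.one then -1 else 1) *
        (|(z : ℚ)| + (binVal d : ℚ) / 2 ^ d.length))
    | _, _ => none

/-- The control string of the pairing of `a` and `b`: as many ones as the shorter of the two
strings has letters, a zero, a digit that says which string is longer (`1` for the first one),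
and zeros up to the length of the longer string. -/
def control (a b : Str) : Str :=
  List.replicate (min a.length b.length) .one ++
    (.zero :: (if b.length < a.length then Letter.one else Letter.zero) ::
      List.replicate (max a.length b.length - (min a.length b.length + 2)) .zero)

/-- Pad a string with zeros to the length `n`. -/
def pad (n : ℕ) (a : Str) : Str := a ++ List.replicate (n - a.length) .zero

/-- Alternate between the letters of three strings; the first one may be longer. -/
def alternate : Str → Str → Str → Str
  | x :: c, y :: a, z :: b => x :: y :: z :: alternate c a b
  | c, _, _ => c

/-- The pairing of strings. -/
def pairStr (p : Str × Str) : Str :=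
  let m := max p.1.length p.2.length
  alternate (control p.1 p.2) (pad m p.1) (pad m p.2)

/-- Intervals with dyadic endpoints: `[r ± ε]`, and the infinite interval. (Only those with
dyadic `r` and `ε ≥ 0` have a code.) -/
inductive Interval
  | infinite
  | finite (r ε : ℚ)

namespace Interval

/-- The real points of the interval. -/
def toSet : Interval → Set ℝ
  | infinite => Set.univ
  | finite r ε => Set.Icc ((r : ℝ) - ε) ((r : ℝ) + ε)

/-- The length of the interval. -/
def diam : Interval → WithTop ℚ
  | infinite => ⊤
  | finite _ ε => ((2 * ε : ℚ) : WithTop ℚ)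

end Interval

open Classical in
/-- The notation of the dyadic intervals: the interval `[r ± ε]` is encoded by the pair of a code
of `r` and a code of `ε`, and the infinite interval by the empty string, which is not a pair. -/
noncomputable def notationInterval (s : Str) : Option Interval :=
  if s = [] then some .infinite
  else
    match Function.partialInv pairStr s with
    | none => none
    | some (u, v) =>
      match notationDyadic u, notationDyadic v with
      | some r, some ε => if 0 ≤ ε then some (.finite r ε) else none
      | _, _ => none

/-- The string function `ψ` encodes the sequence `u` of elements of a set with notation `ν`:
on every code of the integer `2 ^ n`, it returns a code of `u n`. -/
def Encodes {D : Type} (ν : Str → Option D) (ψ : Baire) (u : ℕ → D) : Prop :=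
  ∀ (n : ℕ) (a : Str), notationInt a = some (2 ^ n) → ν (ψ a) = some (u n)

/-! ### The pairing is injective -/

theorem alternate_length : ∀ (c a b : Str), a.length = b.length → a.length ≤ c.length →
    (alternate c a b).length = c.length + 2 * a.length
  | [], [], [], _, _ => rfl
  | _ :: _, [], [], _, _ => by simp [alternate]
  | x :: c, y :: a, z :: b, h, h' => by
    simp only [List.length_cons] at h h'
    simp only [alternate, List.length_cons]
    rw [alternate_length c a b (by omega) (by omega)]
    omega
  | [], _ :: _, _, _, h' => by simp at h'
  | _, [], _ :: _, h, _ => by simp at h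
  | _, _ :: _, [], h, _ => by simp at h

theorem alternate_inj : ∀ (a b a' b' c c' : Str), a.length = b.length → a'.length = b'.length →
    a.length = a'.length → a.length ≤ c.length → a'.length ≤ c'.length →
    alternate c a b = alternate c' a' b' → c = c' ∧ a = a' ∧ b = b'
  | [], [], [], [], c, c', _, _, _, _, _, h => by
    refine ⟨?_, rfl, rfl⟩
    cases c <;> cases c' <;> simp_all [alternate]
  | y :: a, z :: b, y' :: a', z' :: b', x :: c, x' :: c', h1, h2, h3, h4, h5, h => by
    simp only [List.length_cons] at h1 h2 h3 h4 h5
    simp only [alternate, List.cons.injEq] at h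
    obtain ⟨rfl, rfl, rfl, h⟩ := h
    obtain ⟨rfl, rfl, rfl⟩ := alternate_inj a b a' b' c c' (by omega) (by omega) (by omega)
      (by omega) (by omega) h
    exact ⟨rfl, rfl, rfl⟩
  | [], _ :: _, _, _, _, _, h, _, _, _, _, _ => by simp at h
  | _ :: _, [], _, _, _, _, h, _, _, _, _, _ => by simp at h
  | _, _, [], _ :: _, _, _, _, h, _, _, _, _ => by simp at h
  | _, _, _ :: _, [], _, _, _, h, _, _, _, _ => by simp at h
  | [], _, _ :: _, _, _, _, _, _, h, _, _, _ => by simp at h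
  | _ :: _, _, [], _, _, _, _, _, h, _, _, _ => by simp at h
  | _ :: _, _, _, _, [], _, _, _, _, h, _, _ => by simp at h
  | _, _, _ :: _, _, _, [], _, _, _, _, h, _ => by simp at h

theorem control_length (a b : Str) :
    (control a b).length = max (max a.length b.length) (min a.length b.length + 2) := by
  simp only [control, List.length_append, List.length_replicate, List.length_cons]
  omega

theorem pad_length (n : ℕ) (a : Str) (h : a.length ≤ n) : (pad n a).length = n := by
  simp [pad]
  omega

theorem ones_inj : ∀ (m m' : ℕ) (s s' : Str),
    List.replicate m Letter.one ++ Letter.zero :: s =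
      List.replicate m' Letter.one ++ Letter.zero :: s' → m = m' ∧ s = s'
  | 0, 0, _, _, h => by simpa using h
  | m + 1, m' + 1, s, s', h => by
    simp only [List.replicate_succ, List.cons_append, List.cons.injEq, true_and] at h
    obtain ⟨h1, h2⟩ := ones_inj m m' s s' h
    exact ⟨by omega, h2⟩
  | 0, m' + 1, _, _, h => by simp [List.replicate_succ] at h
  | m + 1, 0, _, _, h => by simp [List.replicate_succ] at h

theorem pad_inj (n : ℕ) (a b : Str) (hl : a.length = b.length) (h : pad n a = pad n b) :
    a = b :=
  (List.append_inj h hl).1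

theorem pairStr_injective : Function.Injective pairStr := by
  rintro ⟨a, b⟩ ⟨a', b'⟩ h
  have e : (pairStr (a, b)).length = (pairStr (a', b')).length := by rw [h]
  have key : ∀ a b : Str, (pairStr (a, b)).length =
      max (max a.length b.length) (min a.length b.length + 2) +
        2 * max a.length b.length := by
    intro a b
    rw [pairStr, alternate_length, control_length, pad_length]
    · exact le_max_left _ _
    · rw [pad_length _ _ (le_max_left _ _), pad_length _ _ (le_max_right _ _)]
    · rw [pad_length _ _ (le_max_left _ _), control_length]
      exact le_max_left _ _
  rw [key, key] at e
  have hmax : max a.length b.length = max a'.length b'.length := by omega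
  simp only [pairStr] at h
  have h1 := pad_length (max a.length b.length) a (le_max_left _ _)
  have h2 := pad_length (max a.length b.length) b (le_max_right _ _)
  have h3 := pad_length (max a'.length b'.length) a' (le_max_left _ _)
  have h4 := pad_length (max a'.length b'.length) b' (le_max_right _ _)
  have h5 := control_length a b
  have h6 := control_length a' b'
  obtain ⟨hc, ha, hb⟩ := alternate_inj _ _ _ _ _ _ (by omega) (by omega) (by omega) (by omega)
    (by omega) h
  obtain ⟨hm, hs⟩ := ones_inj _ _ _ _ hc
  have hbit : b.length < a.length ↔ b'.length < a'.length := by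
    have := (List.cons.inj hs).1
    split_ifs at this <;> tauto
  rw [← hmax] at ha hb
  rw [pad_inj _ _ _ (by omega) ha, pad_inj _ _ _ (by omega) hb]

theorem pairStr_ne_nil (p : Str × Str) : pairStr p ≠ [] := by
  intro h
  have e := congrArg List.length h
  simp only [pairStr] at e
  rw [alternate_length, control_length] at e
  · simp at e
  · rw [pad_length _ _ (le_max_left _ _), pad_length _ _ (le_max_right _ _)]
  · rw [pad_length _ _ (le_max_left _ _), control_length]
    exact le_max_left _ _

/-! ### Existence of codes -/

/-- The code of the integer `2 ^ n`. -/
def codeTwoPow (n : ℕ) : Str := .zero :: .one :: List.replicate n .zero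

theorem toBits_replicate_zero (n : ℕ) :
    toBits (List.replicate n .zero) = some (List.replicate n false) := by
  induction n with
  | zero => rfl
  | succ n ih => simp [List.replicate_succ, toBits, ih]

theorem binVal_append (l : List Bool) (b : Bool) :
    binVal (l ++ [b]) = 2 * binVal l + b.toNat := by
  simp [binVal]

theorem notationInt_codeTwoPow (n : ℕ) : notationInt (codeTwoPow n) = some (2 ^ n) := by
  have h : binVal (true :: List.replicate n false) = 2 ^ n := by
    induction n with
    | zero => rfl
    | succ n ih =>
      rw [List.replicate_succ', ← List.cons_append, binVal_append, ih]
      simp [pow_succ]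
      ring
  simp [notationInt, codeTwoPow, toBits, toBits_replicate_zero, h]

theorem Encodes.unique {D : Type} {ν : Str → Option D} {ψ : Baire} {u v : ℕ → D}
    (hu : Encodes ν ψ u) (hv : Encodes ν ψ v) : u = v := by
  funext n
  have h1 := hu n _ (notationInt_codeTwoPow n)
  have h2 := hv n _ (notationInt_codeTwoPow n)
  rw [h1] at h2
  exact Option.some.inj h2

/-- The string of given binary digits. -/
def ofBits (l : List Bool) : Str := l.map fun b => if b then .one else .zero

theorem toBits_ofBits (l : List Bool) : toBits (ofBits l) = some l := by
  induction l with
  | nil => rfl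
  | cons b l ih =>
    rw [ofBits] at ih
    cases b <;> simp [ofBits, toBits, ih]

theorem sep_not_mem_ofBits (l : List Bool) : Letter.sep ∉ ofBits l := by
  simp only [ofBits, List.mem_map, not_exists, not_and]
  intro b _
  cases b <;> simp

theorem notationDyadic_code (u v : List Bool) (z : ℤ) (hz : notationInt (ofBits u) = some z)
    (hv : v.getLast? ≠ some false) :
    notationDyadic (ofBits u ++ Letter.sep :: ofBits v) =
      some ((if (ofBits u ++ [Letter.sep]).head? = some Letter.one then -1 else 1) *
        (|(z : ℚ)| + (binVal v : ℚ) / 2 ^ v.length)) := by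
  have hu : ∀ x ∈ ofBits u, (decide (x ≠ Letter.sep)) = true := by
    intro x hx
    have : x ≠ Letter.sep := fun h => sep_not_mem_ofBits u (h ▸ hx)
    simpa using this
  have h1 : (ofBits u ++ Letter.sep :: ofBits v).dropWhile (· ≠ Letter.sep)
      = Letter.sep :: ofBits v := by
    rw [List.dropWhile_append_of_pos hu]
    simp
  have h2 : (ofBits u ++ Letter.sep :: ofBits v).takeWhile (· ≠ Letter.sep) = ofBits u := by
    rw [List.takeWhile_append_of_pos hu]
    simp
  have h3 : (ofBits u ++ Letter.sep :: ofBits v).head? = (ofBits u ++ [Letter.sep]).head? := by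
    cases u <;> simp [ofBits]
  rw [notationDyadic, h1]
  simp only [h2, hz, toBits_ofBits, if_neg hv, h3]

/-- Every positive natural number has a binary expansion that starts with the digit one. -/
theorem exists_binVal_pos (k : ℕ) (hk : 0 < k) : ∃ t, binVal (true :: t) = k := by
  induction k using Nat.strong_induction_on with
  | _ k ih =>
    by_cases h1 : k = 1
    · exact ⟨[], h1 ▸ rfl⟩
    · obtain ⟨t, ht⟩ := ih (k / 2) (by omega) (by omega)
      refine ⟨t ++ [decide (k % 2 = 1)], ?_⟩
      rw [← List.cons_append, binVal_append, ht]
      rcases Nat.mod_two_eq_zero_or_one k with h | h <;> simp [h] <;> omega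

/-- Binary expansions of a given length. -/
theorem exists_binVal_length (m : ℕ) : ∀ k < 2 ^ m, ∃ l, l.length = m ∧ binVal l = k := by
  induction m with
  | zero =>
    intro k hk
    exact ⟨[], rfl, by simp [binVal]; omega⟩
  | succ m ih =>
    intro k hk
    rw [pow_succ] at hk
    obtain ⟨l, hl, hv⟩ := ih (k / 2) (by omega)
    refine ⟨l ++ [decide (k % 2 = 1)], by simp [hl], ?_⟩
    rw [binVal_append, hv]
    rcases Nat.mod_two_eq_zero_or_one k with h | h <;> simp [h] <;> omega

theorem exists_notationInt (neg : Bool) (k : ℕ) : ∃ u z, notationInt (ofBits (neg :: u)) = some z ∧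
    |(z : ℚ)| = k := by
  rcases Nat.eq_zero_or_pos k with rfl | hk
  · exact ⟨[], 0, by rw [notationInt, toBits_ofBits], by simp⟩
  · obtain ⟨t, ht⟩ := exists_binVal_pos k hk
    refine ⟨true :: t, (if neg then -1 else 1) * k, by simp only [notationInt, toBits_ofBits, ht],
      ?_⟩
    cases neg <;> simp

theorem exists_notationDyadic_aux (neg : Bool) (m : ℕ) : ∀ k : ℕ, ∃ s, notationDyadic s =
    some ((if neg then -1 else 1) * ((k : ℚ) / 2 ^ m)) := by
  have hhead : ∀ u, (if (ofBits (neg :: u) ++ [Letter.sep]).head? = some Letter.one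
      then (-1 : ℚ) else 1) = if neg then -1 else 1 := by
    intro u
    cases neg <;> simp [ofBits]
  induction m with
  | zero =>
    intro k
    obtain ⟨u, z, hu, hz⟩ := exists_notationInt neg k
    refine ⟨_, (notationDyadic_code (neg :: u) [] z hu (by simp)).trans ?_⟩
    rw [hhead, hz]
    simp [binVal]
  | succ m ih =>
    intro k
    rcases Nat.even_or_odd' k with ⟨j, rfl | rfl⟩
    · obtain ⟨s, hs⟩ := ih j
      refine ⟨s, hs.trans ?_⟩
      congr 2
      push_cast
      rw [pow_succ]
      field_simp
    · obtain ⟨u, z, hu, hz⟩ := exists_notationInt neg (j / 2 ^ m)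
      obtain ⟨l, hl, hv⟩ := exists_binVal_length m (j % 2 ^ m) (Nat.mod_lt _ (by positivity))
      refine ⟨_, (notationDyadic_code (neg :: u) (l ++ [true]) z hu (by simp)).trans ?_⟩
      rw [hhead, hz, binVal_append, hv, List.length_append, hl]
      congr 2
      have h : ((2 ^ m * (j / 2 ^ m) + j % 2 ^ m : ℕ) : ℚ) = j := by rw [Nat.div_add_mod]
      push_cast at h ⊢
      rw [← h]
      simp only [List.length_cons, List.length_nil, Bool.toNat_true, Nat.cast_one, zero_add]
      rw [pow_succ]
      field_simp
      ring

/-- Every dyadic rational has a code. -/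
theorem exists_notationDyadic (k : ℤ) (m : ℕ) : ∃ s, notationDyadic s = some ((k : ℚ) / 2 ^ m) := by
  rcases Int.natAbs_eq k with h | h
  · obtain ⟨s, hs⟩ := exists_notationDyadic_aux false m k.natAbs
    refine ⟨s, hs.trans ?_⟩
    rw [h]
    simp
  · obtain ⟨s, hs⟩ := exists_notationDyadic_aux true m k.natAbs
    refine ⟨s, hs.trans ?_⟩
    rw [h]
    simp [neg_div]

theorem notationInterval_pairStr (u v : Str) (r ε : ℚ) (hu : notationDyadic u = some r)
    (hv : notationDyadic v = some ε) (h : 0 ≤ ε) :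
    notationInterval (pairStr (u, v)) = some (.finite r ε) := by
  have e : Function.partialInv pairStr (pairStr (u, v)) = some (u, v) :=
    Function.partialInv_left pairStr_injective _
  simp [notationInterval, pairStr_ne_nil, e, hu, hv, h]

/-- A sequence of elements with codes is encoded by some string function. -/
theorem exists_encodes {D : Type} (ν : Str → Option D) (u : ℕ → D)
    (h : ∀ n, ∃ s, ν s = some (u n)) : ∃ ψ : Baire, Encodes ν ψ u := by
  choose c hc using h
  classical
  refine ⟨fun a => if h : ∃ n : ℕ, notationInt a = some (2 ^ n) then c h.choose else [], ?_⟩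
  intro n a ha
  have h : ∃ n : ℕ, notationInt a = some (2 ^ n) := ⟨n, ha⟩
  have e : h.choose = n := by
    have h1 : some ((2 : ℤ) ^ n) = some (2 ^ h.choose) := ha.symm.trans h.choose_spec
    exact (Int.pow_right_injective (by norm_num) (Option.some.inj h1)).symm
  simp only [dif_pos h, e, hc]

/-! ## The Cauchy reals -/

/-- `ψ` encodes dyadic numbers `q n` with `|q n - x| ≤ 2 ^ (-n)`. -/
def IsCauchyName (ψ : Baire) (x : ℝ) : Prop :=
  ∃ q : ℕ → ℚ, Encodes notationDyadic ψ q ∧ ∀ n, |(q n : ℝ) - x| ≤ (2 : ℝ)⁻¹ ^ n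

theorem IsCauchyName.unique (ψ : Baire) (x y : ℝ) (hx : IsCauchyName ψ x)
    (hy : IsCauchyName ψ y) : x = y := by
  obtain ⟨q, hq, h1⟩ := hx
  obtain ⟨q', hq', h2⟩ := hy
  obtain rfl := hq.unique hq'
  have hlim : ∀ z : ℝ, (∀ n, |(q n : ℝ) - z| ≤ (2 : ℝ)⁻¹ ^ n) →
      Filter.Tendsto (fun n => (q n : ℝ)) Filter.atTop (nhds z) := by
    intro z hz
    rw [tendsto_iff_dist_tendsto_zero]
    exact squeeze_zero (fun _ => dist_nonneg) (fun n => (Real.dist_eq _ _).trans_le (hz n))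
      (tendsto_pow_atTop_nhds_zero_of_lt_one (by norm_num) (by norm_num))
  exact tendsto_nhds_unique (hlim x h1) (hlim y h2)

theorem abs_floor_div_sub_le (x : ℝ) (n : ℕ) :
    |((⌊x * 2 ^ n⌋ : ℚ) / 2 ^ n : ℚ) - x| ≤ (2 : ℝ)⁻¹ ^ n := by
  have hp : (0 : ℝ) < 2 ^ n := by positivity
  have h1 := Int.floor_le (x * 2 ^ n)
  have h2 := Int.lt_floor_add_one (x * 2 ^ n)
  push_cast
  rw [inv_pow, abs_le]
  constructor
  · rw [neg_le_iff_add_nonneg, ← mul_nonneg_iff_of_pos_right hp]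
    field_simp
    linarith
  · rw [sub_le_iff_le_add, ← mul_le_mul_iff_left₀ hp]
    field_simp
    linarith

theorem exists_isCauchyName (x : ℝ) : ∃ ψ, IsCauchyName ψ x := by
  obtain ⟨ψ, h⟩ := exists_encodes notationDyadic
    (fun n => (⌊x * 2 ^ n⌋ : ℚ) / 2 ^ n) fun n => exists_notationDyadic _ _
  exact ⟨ψ, _, h, fun n => abs_floor_div_sub_le x n⟩

/-- The space of Cauchy reals, with the size function as parameter. -/
noncomputable def cauchyReals : PreparametrisedSpace ℝ where
  rep := ofGraph IsCauchyName
  rep_surjective x := by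
    obtain ⟨ψ, h⟩ := exists_isCauchyName x
    exact ⟨ψ, (mem_ofGraph IsCauchyName.unique ψ x).2 h⟩
  param φ := size φ
  param_monotone φ := size_monotone φ

/-! ## The interval reals -/

/-- `ψ` encodes a nested sequence of intervals whose intersection is `{x}`. -/
def IsIntervalName (ψ : Baire) (x : ℝ) : Prop :=
  ∃ J : ℕ → Interval, Encodes notationInterval ψ J ∧
    (∀ n, (J (n + 1)).toSet ⊆ (J n).toSet) ∧ ⋂ n, (J n).toSet = {x}

theorem IsIntervalName.unique (ψ : Baire) (x y : ℝ) (hx : IsIntervalName ψ x)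
    (hy : IsIntervalName ψ y) : x = y := by
  obtain ⟨J, hJ, -, h1⟩ := hx
  obtain ⟨J', hJ', -, h2⟩ := hy
  obtain rfl := hJ.unique hJ'
  exact Set.singleton_injective (h1.symm.trans h2)

theorem exists_isIntervalName (x : ℝ) : ∃ ψ, IsIntervalName ψ x := by
  let q : ℕ → ℚ := fun n => (⌊x * 2 ^ n⌋ : ℚ) / 2 ^ n
  let e : ℕ → ℚ := fun n => ((4 : ℤ) : ℚ) / 2 ^ n
  have hq : ∀ n, |(q n : ℝ) - x| ≤ (2 : ℝ)⁻¹ ^ n := abs_floor_div_sub_le x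
  have he : ∀ n, (e n : ℝ) = 4 * (2 : ℝ)⁻¹ ^ n := by
    intro n
    simp only [e]
    push_cast
    rw [inv_pow, div_eq_mul_inv]
  have hpos : ∀ n, (0 : ℝ) < (2 : ℝ)⁻¹ ^ n := fun n => by positivity
  obtain ⟨ψ, h⟩ := exists_encodes notationInterval (fun n => .finite (q n) (e n)) fun n => by
    obtain ⟨u, hu⟩ := exists_notationDyadic ⌊x * 2 ^ n⌋ n
    obtain ⟨v, hv⟩ := exists_notationDyadic 4 n
    exact ⟨_, notationInterval_pairStr u v _ _ hu hv (by positivity)⟩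
  refine ⟨ψ, _, h, ?_, ?_⟩
  · intro n
    have h1 := abs_le.1 (hq n)
    have h2 := abs_le.1 (hq (n + 1))
    have h3 := hpos n
    simp only [Interval.toSet]
    apply Set.Icc_subset_Icc <;> rw [he, he, pow_succ] <;> rw [pow_succ] at h2 <;> linarith
  · ext y
    simp only [Interval.toSet, Set.mem_iInter, Set.mem_Icc, Set.mem_singleton_iff]
    constructor
    · intro hy
      have hb : ∀ n, |y - x| ≤ 5 * (2 : ℝ)⁻¹ ^ n := by
        intro n
        have h1 := abs_le.1 (hq n)
        have h2 := hy n
        rw [he] at h2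
        rw [abs_le]
        constructor <;> linarith
      have hl : Filter.Tendsto (fun n : ℕ => 5 * (2 : ℝ)⁻¹ ^ n) Filter.atTop (nhds (5 * 0)) :=
        (tendsto_pow_atTop_nhds_zero_of_lt_one (by norm_num) (by norm_num)).const_mul 5
      have h0 := ge_of_tendsto' hl hb
      rw [mul_zero] at h0
      have := abs_nonpos_iff.1 h0
      linarith
    · rintro rfl n
      have h1 := abs_le.1 (hq n)
      have h2 := hpos n
      rw [he]
      constructor <;> linarith

/-- The least `N` such that the `N`-th interval of the sequence encoded by `ψ` has length at most
`2 ^ (-n)`. -/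
noncomputable def convergenceRate (ψ : Baire) (n : ℕ) : ℕ :=
  sInf {N | ∃ J : ℕ → Interval, Encodes notationInterval ψ J ∧
    (J N).diam ≤ (((2 : ℚ)⁻¹ ^ n : ℚ) : WithTop ℚ)}

/-- In a nested sequence of intervals with one common point, there are arbitrarily short
intervals. -/
theorem exists_diam_le (J : ℕ → Interval) (x : ℝ)
    (hnest : ∀ n, (J (n + 1)).toSet ⊆ (J n).toSet) (hx : ⋂ n, (J n).toSet = {x}) (n : ℕ) :
    ∃ N, (J N).diam ≤ (((2 : ℚ)⁻¹ ^ n : ℚ) : WithTop ℚ) := by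
  by_contra! hcon
  have hd : (0 : ℝ) < (2 : ℝ)⁻¹ ^ n / 4 := by positivity
  set d : ℝ := (2 : ℝ)⁻¹ ^ n / 4 with hddef
  have hxm : ∀ N, x ∈ (J N).toSet := fun N => Set.mem_iInter.1 (hx.symm ▸ Set.mem_singleton x : x ∈ ⋂ n, (J n).toSet) N
  have hanti : Antitone fun N => (J N).toSet := antitone_nat_of_succ_le hnest
  have hpm : ∀ N, x + d ∈ (J N).toSet ∨ x - d ∈ (J N).toSet := by
    intro N
    have h1 := hxm N
    have h2 := hcon N
    cases hJ : J N with
    | infinite => exact Or.inl trivial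
    | finite r ε =>
      rw [hJ] at h1 h2
      simp only [Interval.toSet, Set.mem_Icc] at h1 ⊢
      simp only [Interval.diam, WithTop.coe_lt_coe] at h2
      have h3 : (((2 : ℚ)⁻¹ ^ n : ℚ) : ℝ) < ((2 * ε : ℚ) : ℝ) := Rat.cast_lt.2 h2
      push_cast at h3
      by_contra! hc
      by_cases h4 : x ≤ r
      · have := hc.1 (by linarith)
        linarith
      · have := hc.2
        have h5 : ¬ ((r : ℝ) - ε ≤ x - d) := fun h => by
          have := this h
          linarith
        linarith
  have hall : (∀ N, x + d ∈ (J N).toSet) ∨ ∀ N, x - d ∈ (J N).toSet := by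
    by_contra! hc
    obtain ⟨⟨N, hN⟩, M, hM⟩ := hc
    rcases hpm (max N M) with h | h
    · exact hN (hanti (le_max_left _ _) h)
    · exact hM (hanti (le_max_right _ _) h)
  rcases hall with h | h
  · have : x + d ∈ ({x} : Set ℝ) := hx ▸ Set.mem_iInter.2 h
    have := Set.mem_singleton_iff.1 this
    linarith
  · have : x - d ∈ ({x} : Set ℝ) := hx ▸ Set.mem_iInter.2 h
    have := Set.mem_singleton_iff.1 this
    linarith

/-- The space of interval reals. The parameter of a name of `x` is the sum of the rate of
convergence and `⌈log₂ (|x| + 1)⌉`. -/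
noncomputable def intervalReals : PreparametrisedSpace ℝ where
  rep := ofGraph IsIntervalName
  rep_surjective x := by
    obtain ⟨ψ, h⟩ := exists_isIntervalName x
    exact ⟨ψ, (mem_ofGraph IsIntervalName.unique ψ x).2 h⟩
  param φ n := convergenceRate φ n +
    ⌈Real.logb 2 (|(ofGraph IsIntervalName).fn φ φ.2| + 1)⌉₊
  param_monotone φ := by
    intro m n hmn
    apply Nat.add_le_add_right
    obtain ⟨x, J, hJ, hnest, hx⟩ : ∃ x, IsIntervalName φ x := φ.2
    obtain ⟨N, hN⟩ := exists_diam_le J x hnest hx n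
    obtain ⟨J', hJ', h⟩ := Nat.sInf_mem (s := {N | ∃ J : ℕ → Interval,
      Encodes notationInterval φ J ∧ (J N).diam ≤ (((2 : ℚ)⁻¹ ^ n : ℚ) : WithTop ℚ)})
      ⟨N, J, hJ, hN⟩
    refine Nat.sInf_le ⟨J', hJ', h.trans ?_⟩
    exact WithTop.coe_le_coe.2 (pow_le_pow_of_le_one (by norm_num) (by norm_num) hmn)

end ParamSpace

open ParamSpace

/-! Everything rests on one family of machines, `Translate.machine inI outI`, which turn a name of a
real `x` into another name of the same `x`; the flags select the kinds of the two names. Equal flags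
show that the two spaces are parametrised, different flags give the isomorphism
(`polytimeComputable_id`).

Only the length of an input `a` matters, since the code of `2 ^ k` is unique and has length `k + 2`
(`eq_codeTwoPow`). With `n = |a| + 4`, the machine asks for the entries `n, n + 1, …` of the encoded
sequence. A Cauchy entry is accepted at once. An interval is accepted if its radius code shows the
integer part zero and `n` zeros after the point. As the intervals are nested, the rate of
convergence bounds the number of rejections (`exists_isAnswer_true`). From the accepted centre, the
integer part and `n` digits after the point are copied, and a digit one is appended. This digit
makes the word a legal code and puts it at the midpoint of the possible values, so the total error
is at most `2 * 2 ^ (-n)`. If an interval is wanted, the word is paired with the radius `2 ^ (-(|a|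
+ 1))`, which exceeds the error by so much that successive intervals are nested
(`Approximates.isIntervalName`).

The parameter of an interval name does not control the length of the answers, so an answer must not
be read to its end. The pairing is interleaved, hence the leading letters of centre and radius are
found near the beginning of the answer. Only the integer part of the centre may be long; it is
bounded by the logarithmic summand of the parameter, or by the size of a Cauchy name. Conversely,
the size of a Cauchy name bounds the logarithm of `|x|` (`ceil_logb_le_rate`). All this is collected
in `exists_translation`.

For polytime points, a name that is computable in polynomial time is substituted for the oracle.
`Substitution.machine` simulates the ordinary machine for the name on additional tapes and cleans
them after every call (`Substitution.goes_call`). The run of the translating machine is therefore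
recorded together with a discipline at oracle calls: short queries, short previous answers, known
head positions. Since a second-order polynomial in a polynomial is a polynomial, the composed
machine runs in polynomial time (`polytimeStringFunction_of_reaches`). -/

namespace ParamSpace

/-! ## Tapes and runs -/

namespace Tape

variable {Aux α : Type}

/-- The cells of a tape that carries the symbols `f x`, for `x` in a list, from cell `0` on. -/
def cellsBy (f : α → Cell Aux) (l : List α) : ℤ → Cell Aux
  | .ofNat i => (l[i]?).elim Cell.blank f
  | .negSucc _ => Cell.blank

theorem cellsOf_eq (s : Str) : (cellsOf s : ℤ → Cell Aux) = cellsBy Cell.letter s := by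
  funext i
  cases i <;> rfl

theorem cellsBy_natCast (f : α → Cell Aux) (l : List α) (n : ℕ) :
    cellsBy f l (n : ℤ) = (l[n]?).elim Cell.blank f := rfl

theorem cellsBy_neg (f : α → Cell Aux) (l : List α) {i : ℤ} (h : i < 0) :
    cellsBy f l i = Cell.blank := by
  cases i with
  | ofNat n => exact absurd h (by simp)
  | negSucc n => rfl

theorem cellsBy_ne_blank (f : α → Cell Aux) (hf : ∀ x, f x ≠ Cell.blank) (l : List α) (i : ℤ) :
    cellsBy f l i ≠ Cell.blank ↔ 0 ≤ i ∧ i < l.length := by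
  cases i with
  | ofNat n =>
    simp only [cellsBy]
    rcases lt_or_ge n l.length with h | h
    · simp [h, hf]
    · simp [h]
  | negSucc n =>
    simp [cellsBy]

theorem update_cellsBy (f : α → Cell Aux) (l : List α) (x : α) :
    Function.update (cellsBy f l) (l.length : ℤ) (f x) = cellsBy f (l ++ [x]) := by
  funext i
  cases i with
  | ofNat n =>
    by_cases h : n = l.length
    · subst h
      simp [cellsBy]
    · have h' : (Int.ofNat n) ≠ (l.length : ℤ) := by
        intro e
        exact h (by simpa using e)
      rw [Function.update_of_ne h']
      simp only [cellsBy]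
      rcases lt_or_ge n l.length with h1 | h1
      · rw [List.getElem?_append_left h1]
      · rw [List.getElem?_eq_none h1, List.getElem?_eq_none (by simp; omega)]
  | negSucc n =>
    rw [Function.update_of_ne (by simp)]
    rfl

theorem act_read (c : ℤ → Cell Aux) (h : ℤ) (m : Move) :
    (⟨c, h⟩ : Tape Aux).act (c h) m = ⟨c, h + m.shift⟩ := by
  simp [act]

theorem act_append (f : α → Cell Aux) (l : List α) (x : α) (m : Move) :
    (⟨cellsBy f l, l.length⟩ : Tape Aux).act (f x) m =
      ⟨cellsBy f (l ++ [x]), l.length + m.shift⟩ := by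
  simp [act, update_cellsBy]

/-- The content of a tape that carries the letters of `s` from cell `0` on, followed by a cell
without a letter. -/
theorem content_eq (T : Tape Aux) (s : Str)
    (h : ∀ n : ℕ, n < s.length → (T.cells n).letter? = s[n]?)
    (h' : (T.cells s.length).letter? = none) : T.content = s := by
  have hs : sInf {n : ℕ | (T.cells n).letter? = none} = s.length := by
    have hne : {n : ℕ | (T.cells n).letter? = none}.Nonempty := ⟨s.length, h'⟩
    refine le_antisymm (Nat.sInf_le h') (le_csInf hne ?_)
    intro n hn
    by_contra hlt
    push Not at hlt
    have h1 := h n hlt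
    rw [Set.mem_ofPred_eq] at hn
    rw [hn, List.getElem?_eq_getElem hlt] at h1
    simp at h1
  rw [content, hs]
  have : ∀ m ≤ s.length, (List.range m).filterMap (fun i : ℕ => (T.cells i).letter?)
      = s.take m := by
    intro m
    induction m with
    | zero => simp
    | succ m ih =>
      intro hm
      rw [List.range_succ, List.filterMap_append, ih (by omega), List.take_add_one]
      congr 1
      rw [← h m (by omega)]
      cases hc : (T.cells m).letter? <;> simp [hc]
  rw [this _ le_rfl, List.take_length]

theorem content_cellsOf (s : Str) (h : ℤ) : (⟨cellsOf s, h⟩ : Tape Aux).content = s := by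
  apply content_eq
  · intro n hn
    simp [cellsOf_eq, cellsBy_natCast, hn, Cell.letter?]
  · simp [cellsOf_eq, cellsBy_natCast, Cell.letter?]

end Tape

namespace OracleMachine

variable {M : OracleMachine} {φ : Baire} {D : M.Cfg → Prop}

/-- The configuration `c'` is reached from `c` in at most `t` steps, and all configurations before
it satisfy `D`. -/
inductive Reaches (M : OracleMachine) (φ : Baire) (D : M.Cfg → Prop) : ℕ → M.Cfg → M.Cfg → Prop
  | refl (t : ℕ) (c : M.Cfg) : Reaches M φ D t c c
  | head {t : ℕ} {c c' : M.Cfg} : D c → Reaches M φ D t (M.step φ c) c' →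
      Reaches M φ D (t + 1) c c'

namespace Reaches

theorem mono {t t' : ℕ} {c c' : M.Cfg} (h : Reaches M φ D t c c') (ht : t ≤ t') :
    Reaches M φ D t' c c' := by
  induction h generalizing t' with
  | refl t c => exact .refl _ _
  | head hc _ ih =>
    obtain ⟨u, rfl⟩ : ∃ u, t' = u + 1 := ⟨t' - 1, by omega⟩
    exact .head hc (ih (by omega))

theorem trans {t t' : ℕ} {c c' c'' : M.Cfg} (h : Reaches M φ D t c c')
    (h' : Reaches M φ D t' c' c'') : Reaches M φ D (t + t') c c'' := by
  induction h with
  | refl t c => exact h'.mono (by omega)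
  | head hc _ ih => exact (Reaches.head hc (ih h')).mono (by omega)

theorem single {c c' : M.Cfg} (hD : D c) (h : M.step φ c = c') : Reaches M φ D 1 c c' :=
  .head hD (h ▸ .refl 0 _)

theorem exists_iterate {t : ℕ} {c c' : M.Cfg} (h : Reaches M φ D t c c') :
    ∃ s ≤ t, (M.step φ)^[s] c = c' := by
  induction h with
  | refl t c => exact ⟨0, Nat.zero_le _, rfl⟩
  | head _ _ ih =>
    obtain ⟨s, hs, h⟩ := ih
    exact ⟨s + 1, by omega, h⟩

end Reaches

theorem step_of_halt {c : M.Cfg} (h : c.state = M.halt) : M.step φ c = c := by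
  simp [step, h]

theorem iterate_step_of_halt {c : M.Cfg} (h : c.state = M.halt) (t : ℕ) :
    (M.step φ)^[t] c = c :=
  Function.iterate_fixed (step_of_halt h) t

theorem step_eq {c : M.Cfg} (h : c.state ≠ M.halt) (h' : c.state ≠ M.oracle) :
    M.step φ c =
      { state := (M.trans c.state fun k => (c.tapes k).read).1
        tapes := fun k => (c.tapes k).act
          ((M.trans c.state fun k => (c.tapes k).read).2 k).1
          ((M.trans c.state fun k => (c.tapes k).read).2 k).2 } := by
  simp [step, h, h']

/-- A halting configuration is a fixed point of `step`, so it does not matter which halting time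
`eval` picks. -/
theorem run_eq_of_halt {a : Str} {s t : ℕ} (hs : s ∈ M.haltTimes φ a) (ht : t ∈ M.haltTimes φ a) :
    M.run φ a s = M.run φ a t := by
  wlog h : s ≤ t generalizing s t
  · exact (this ht hs (by omega)).symm
  obtain ⟨u, rfl⟩ := Nat.exists_eq_add_of_le h
  rw [run, run, add_comm, Function.iterate_add_apply]
  exact (iterate_step_of_halt hs u).symm

/-- The bridge from `Reaches`, in which runs are composed, to the notions `time` and `eval` of the
definition of computability. -/
theorem Reaches.halts {a : Str} {t : ℕ} {c : M.Cfg} (h : Reaches M φ D t (M.init a) c)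
    (hc : c.state = M.halt) :
    M.time φ a ≤ t ∧ (c.tapes .output).content ∈ M.eval φ a := by
  obtain ⟨s, hs, rfl⟩ := h.exists_iterate
  have hmem : s ∈ M.haltTimes φ a := hc
  refine ⟨(iInf₂_le s hmem).trans (by exact_mod_cast hs), ⟨s, hmem⟩, ?_⟩
  change ((M.run φ a (sInf (M.haltTimes φ a))).tapes .output).content = _
  rw [run_eq_of_halt (Nat.sInf_mem ⟨s, hmem⟩) hmem]
  rfl

/-- A machine that halts with output `ψ a` on every input `a` computes `ψ`. -/
theorem mem_operator_iff {ψ : Baire} (h : ∀ a, ψ a ∈ M.eval φ a) (ψ' : Baire) :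
    ψ' ∈ M.operator φ ↔ ψ' = ψ := by
  have hd : ∀ a, (M.eval φ a).Dom := fun a => (h a).1
  have e : (fun a => (M.eval φ a).get (hd a)) = ψ := by
    funext a
    exact (h a).2
  constructor
  · rintro ⟨h1, h2⟩
    rw [← h2, ← e]
    rfl
  · rintro rfl
    exact ⟨hd, e⟩

end OracleMachine

end ParamSpace

namespace ParamSpace

/-! ## The machine -/

/-- The symbols on the ruler tape. -/
inductive Mark
  | first
  | lit
  | last
  | ctlZero
  | ctlOne
  deriving DecidableEq

instance : Fintype Mark :=
  ⟨{.first, .lit, .last, .ctlZero, .ctlOne}, by rintro (_ | _) <;> simp⟩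

/-- The letter of the control string that belongs to a position of the ruler. -/
def Mark.control : Mark → Letter
  | .ctlZero => .zero
  | _ => .one

/-- The letter of the radius that belongs to a position of the ruler. -/
def Mark.radius : Mark → Letter
  | .first => .sep
  | .last => .one
  | _ => .zero

/-- What the machine does after the heads have returned to the first cell. -/
inductive Target
  | call
  | copy
  | emit
  deriving DecidableEq

instance : Fintype Target :=
  ⟨{.call, .copy, .emit}, by rintro (_ | _) <;> simp⟩

/-- The parts of the machine that scan the answer tape. -/
inductive Scan
  | radiusHead
  | radiusSep
  | radiusFrac
  | copyInt
  | copyFrac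
  deriving DecidableEq

instance : Fintype Scan :=
  ⟨{.radiusHead, .radiusSep, .radiusFrac, .copyInt, .copyFrac}, by rintro (_ | _) <;> simp⟩

/-- The query states write the first two letters of the query; each ruler state then appends a zero
to the query and a mark to the ruler, so the exponent of the first query equals the length of the
ruler. The states `stepBack` and `rewind` are shared by all phases and remember where to continue.
The skip states walk along one track of a pair, whose letters are three cells apart. -/
inductive TranslateState
  | queryZero
  | queryOne
  | rulerFirst
  | rulerLit
  | rulerCtlZero
  | rulerCtlOne
  | oracle
  | resume
  | stepBack (t : Target)
  | rewind (t : Target)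
  | skipThree (p : Scan)
  | skipTwo (p : Scan)
  | skipOne (p : Scan)
  | scan (p : Scan)
  | emitControl
  | emitCentre
  | emitRadius
  | halt
  deriving Fintype

namespace Translate

open TranslateState Scan Target

/-- The state in which the next letter of a track is visited. -/
def next (inI : Bool) (p : Scan) : TranslateState :=
  if inI then skipThree p else skipOne p

/-- The state in which the copying of the centre starts. -/
def startCopy (inI : Bool) : TranslateState :=
  if inI then skipOne copyInt else scan copyInt

def target (inI : Bool) : Target → TranslateState
  | call => oracle
  | copy => startCopy inI
  | emit => emitControl

/-- Move to the right unless the cell is blank. -/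
def advance {Aux : Type} : Cell Aux → Move
  | .blank => .stay
  | _ => .right

/-- Move to the left unless the cell is blank. -/
def retreat {Aux : Type} : Cell Aux → Move
  | .blank => .stay
  | _ => .left

def isBlank {Aux : Type} : Cell Aux → Bool
  | .blank => true
  | _ => false

/-- The letter in a cell; blank cells count as zero. -/
def toLetter {Aux : Type} : Cell Aux → Letter
  | .letter s => s
  | _ => .zero

def markControl : Cell Mark → Letter
  | .aux m => m.control
  | _ => .zero

def markRadius : Cell Mark → Letter
  | .aux m => m.radius
  | _ => .zero

abbrev TapeAction := TapeName Bool → Cell Mark × Move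

/-- The action that keeps all tapes except for the listed ones. -/
def acting (rd : TapeName Bool → Cell Mark) (q a r w o : Option (Cell Mark × Move)) (i : Move) :
    TapeAction
  | .input => (rd .input, i)
  | .query => q.getD (rd .query, .stay)
  | .answer => a.getD (rd .answer, .stay)
  | .work false => r.getD (rd (.work false), .stay)
  | .work true => w.getD (rd (.work true), .stay)
  | .output => o.getD (rd .output, .stay)

/-- Append letters to the query tape and marks to the ruler tape. -/
def extend (rd : TapeName Bool → Cell Mark) (x : Letter) (m : Option Mark) (i : Move) :
    TapeAction :=
  acting rd (some (.letter x, .right)) none (m.map fun m => (.aux m, .right)) none none i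

/-- Move the heads on the answer tape, the ruler and the result tape. -/
def moving (rd : TapeName Bool → Cell Mark) (a r w : Move) : TapeAction :=
  acting rd none (some (rd .answer, a)) (some (rd (.work false), r))
    (some (rd (.work true), w)) none .stay

/-- Append a letter to the result tape and move the head on the ruler. -/
def write (rd : TapeName Bool → Cell Mark) (x : Letter) (r : Move) : TapeAction :=
  acting rd none none (some (rd (.work false), r)) (some (.letter x, .right)) none .stay

/-- Append a letter to the output tape and move the heads on the ruler and the result tape. -/
def output (rd : TapeName Bool → Cell Mark) (x : Letter) (r w : Move) : TapeAction :=
  acting rd none none (some (rd (.work false), r)) (some (rd (.work true), w))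
    (some (.letter x, .right)) .stay

/-- Appending a zero to the code of `2 ^ k` yields the code of `2 ^ (k + 1)`, the next query of the
search. -/
def reject (rd : TapeName Bool → Cell Mark) : TranslateState × TapeAction :=
  (stepBack call, extend rd .zero none .stay)

/-- In the two fraction states the ruler is a counter: they end when its head meets the blank after
the last mark, so exactly as many digits are tested or copied as the ruler is long. Cells after the
answer count as zero, so a short fraction needs no special treatment. The final `one` is required
because the last digit of a dyadic code must not be zero. -/
def scanTrans (inI : Bool) (rd : TapeName Bool → Cell Mark) : Scan → TranslateState × TapeAction
  | radiusHead =>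
    (next inI (if toLetter (rd .answer) = .sep then radiusFrac else radiusSep),
      moving rd .stay .stay .stay)
  | radiusSep =>
    if toLetter (rd .answer) = .sep then (next inI radiusFrac, moving rd .stay .stay .stay)
    else reject rd
  | radiusFrac =>
    if isBlank (rd (.work false)) then (stepBack copy, moving rd .stay .stay .stay)
    else if toLetter (rd .answer) = .zero then
      (next inI radiusFrac, moving rd .stay .right .stay)
    else reject rd
  | copyInt =>
    if isBlank (rd .answer) || decide (toLetter (rd .answer) = .sep) then
      (next inI copyFrac, write rd .sep .stay)
    else (next inI copyInt, write rd (toLetter (rd .answer)) .stay)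
  | copyFrac =>
    if isBlank (rd (.work false)) then (stepBack emit, write rd .one .stay)
    else (next inI copyFrac,
      write rd (if toLetter (rd .answer) = .one then .one else .zero) .right)

def trans (inI outI : Bool) (st : TranslateState) (rd : TapeName Bool → Cell Mark) :
    TranslateState × TapeAction :=
  match st with
  | queryZero => (queryOne, extend rd .zero none .stay)
  | queryOne => (rulerFirst, extend rd .one none .stay)
  | rulerFirst => (rulerLit, extend rd .zero (some .first) .stay)
  | rulerLit =>
    if isBlank (rd .input) then (rulerCtlZero, extend rd .zero (some .last) .stay)
    else (rulerLit, extend rd .zero (some .lit) .right)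
  | rulerCtlZero => (rulerCtlOne, extend rd .zero (some .ctlZero) .stay)
  | rulerCtlOne => (stepBack call, extend rd .zero (some .ctlOne) .stay)
  | resume =>
    (if inI then skipTwo radiusHead else startCopy inI, moving rd .stay .stay .stay)
  | stepBack t => (rewind t, moving rd .left .left .left)
  | rewind t =>
    if isBlank (rd .answer) && isBlank (rd (.work false)) && isBlank (rd (.work true)) then
      (target inI t, moving rd .right .right .right)
    else (rewind t, moving rd (retreat (rd .answer)) (retreat (rd (.work false)))
      (retreat (rd (.work true))))
  | skipThree p => (skipTwo p, moving rd (advance (rd .answer)) .stay .stay)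
  | skipTwo p => (skipOne p, moving rd (advance (rd .answer)) .stay .stay)
  | skipOne p => (scan p, moving rd (advance (rd .answer)) .stay .stay)
  | scan p => scanTrans inI rd p
  | emitControl =>
    if isBlank (rd (.work true)) then (halt, moving rd .stay .stay .stay)
    else if outI then (emitCentre, output rd (markControl (rd (.work false))) .stay .stay)
    else (emitControl, output rd (toLetter (rd (.work true))) .stay .right)
  | emitCentre => (emitRadius, output rd (toLetter (rd (.work true))) .stay .stay)
  | emitRadius =>
    (emitControl, output rd (markRadius (rd (.work false))) (advance (rd (.work false))) .right)
  | oracle | halt => (halt, moving rd .stay .stay .stay)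

/-- The machine that translates names. The flags say whether the given name and the name to be
computed are names of the interval reals. -/
def machine (inI outI : Bool) : OracleMachine where
  State := TranslateState
  Aux := Mark
  Work := Bool
  finiteState := inferInstance
  finiteAux := inferInstance
  finiteWork := inferInstance
  start := queryZero
  halt := halt
  oracle := oracle
  resume := resume
  trans := trans inI outI

open Tape

/-- Tapes with the words `a`, `o`, `q`, `s`, the ruler `R` and the result `w`. -/
def tapesOf (a : Str) (i : ℕ) (o q s : Str) (p : ℤ) (R : List Mark) (r : ℤ) (w : Str) (u : ℤ) :
    TapeName Bool → Tape Mark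
  | .input => ⟨cellsBy Cell.letter a, i⟩
  | .output => ⟨cellsBy Cell.letter o, o.length⟩
  | .query => ⟨cellsBy Cell.letter q, q.length⟩
  | .answer => ⟨cellsBy Cell.letter s, p⟩
  | .work false => ⟨cellsBy Cell.aux R, r⟩
  | .work true => ⟨cellsBy Cell.letter w, u⟩

/-- The configurations that occur in computations. -/
def conf (inI outI : Bool) (st : TranslateState) (a : Str) (i : ℕ) (o q s : Str) (p : ℤ)
    (R : List Mark) (r : ℤ) (w : Str) (u : ℤ) : (machine inI outI).Cfg :=
  ⟨st, tapesOf a i o q s p R r w u⟩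

/-- At oracle calls, the answer tape carries a previous answer and its head is in cell `0`; the head
on the query tape is at the end of a query of bounded length. -/
def Disciplined {M : OracleMachine} (φ : Baire) (B : ℕ) (c : M.Cfg) : Prop :=
  c.state = M.oracle → ∃ q s : Str, c.tapes .query = ⟨cellsOf q, q.length⟩ ∧ q.length ≤ B ∧
    c.tapes .answer = ⟨cellsOf s, 0⟩ ∧ s.length ≤ size φ B

/-! ### Single steps of the translating machine -/

section Steps

variable {inI outI : Bool} {φ : Baire} {B : ℕ} {a o q s w : Str} {i : ℕ} {p r u : ℤ}
  {R : List Mark} {st st' : TranslateState}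

theorem init_eq : (machine inI outI).init a =
    conf inI outI queryZero a 0 [] [] [] 0 [] 0 [] 0 := by
  refine congrArg (OracleMachine.Cfg.mk (M := machine inI outI) queryZero) (funext fun k => ?_)
  rcases k with _ | _ | _ | _ | (_ | _) <;> simp only [cellsOf_eq] <;> rfl

/-- The symbols that are read in a configuration. -/
def reads (a : Str) (i : ℕ) (o q s : Str) (p : ℤ) (R : List Mark) (r : ℤ) (w : Str) (u : ℤ) :
    TapeName Bool → Cell Mark
  | .input => cellsBy Cell.letter a i
  | .output => cellsBy Cell.letter o o.length
  | .query => cellsBy Cell.letter q q.length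
  | .answer => cellsBy Cell.letter s p
  | .work false => cellsBy Cell.aux R r
  | .work true => cellsBy Cell.letter w u

theorem reads_eq : (fun k => ((conf inI outI st a i o q s p R r w u).tapes k).read) =
    reads a i o q s p R r w u := by
  funext k
  rcases k with _ | _ | _ | _ | (_ | _) <;> rfl

/-- `Disciplined` constrains configurations in the oracle state only, so it is vacuous for the steps
considered here. It remains to compare the tapes one by one. -/
theorem step_of_trans (h : st ≠ halt) (h' : st ≠ oracle) {A : TapeAction}
    {a' o' q' s' w' : Str} {i' : ℕ} {p' r' u' : ℤ} {R' : List Mark}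
    (ht : trans inI outI st (reads a i o q s p R r w u) = (st', A))
    (hA : ∀ k, (tapesOf a i o q s p R r w u k).act (A k).1 (A k).2 =
      tapesOf a' i' o' q' s' p' R' r' w' u' k) :
    OracleMachine.Reaches (machine inI outI) φ (Disciplined φ B) 1
      (conf inI outI st a i o q s p R r w u) (conf inI outI st' a' i' o' q' s' p' R' r' w' u') := by
  refine .single (fun e => absurd e h') ?_
  have ht' : (machine inI outI).trans (conf inI outI st a i o q s p R r w u).state
      (fun k => ((conf inI outI st a i o q s p R r w u).tapes k).read) = (st', A) := by
    rw [reads_eq]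
    exact ht
  rw [OracleMachine.step_eq h h', ht']
  exact congrArg (OracleMachine.Cfg.mk (M := machine inI outI) st') (funext hA)

theorem step_extend (h : st ≠ halt) (h' : st ≠ oracle) {x : Letter} {m : Option Mark} {d : Move}
    {i' : ℕ} (hi : (i : ℤ) + d.shift = i') (hr : m ≠ none → r = R.length)
    (ht : trans inI outI st (reads a i o q s p R r w u) =
      (st', extend (reads a i o q s p R r w u) x m d)) :
    OracleMachine.Reaches (machine inI outI) φ (Disciplined φ B) 1
      (conf inI outI st a i o q s p R r w u)
      (conf inI outI st' a i' o (q ++ [x]) s p (R ++ m.toList) (r + m.toList.length) w u) := by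
  refine step_of_trans h h' ht ?_
  rintro (_ | _ | _ | _ | (_ | _))
  · simp [tapesOf, extend, acting, reads, act_read, hi]
  · simp [tapesOf, extend, acting, reads, act_read, Move.shift]
  · simp [tapesOf, extend, acting, act_append, Move.shift]
  · simp [tapesOf, extend, acting, reads, act_read, Move.shift]
  · cases m with
    | none => simp [tapesOf, extend, acting, reads, act_read, Move.shift]
    | some m =>
      obtain rfl := hr (by simp)
      simp [tapesOf, extend, acting, act_append, Move.shift]
  · simp [tapesOf, extend, acting, reads, act_read, Move.shift]

theorem step_moving (h : st ≠ halt) (h' : st ≠ oracle) {d e f : Move}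
    (ht : trans inI outI st (reads a i o q s p R r w u) =
      (st', moving (reads a i o q s p R r w u) d e f)) :
    OracleMachine.Reaches (machine inI outI) φ (Disciplined φ B) 1
      (conf inI outI st a i o q s p R r w u)
      (conf inI outI st' a i o q s (p + d.shift) R (r + e.shift) w (u + f.shift)) := by
  refine step_of_trans h h' ht ?_
  rintro (_ | _ | _ | _ | (_ | _)) <;>
    simp [tapesOf, moving, acting, reads, act_read, Move.shift]

theorem step_write (h : st ≠ halt) (h' : st ≠ oracle) {x : Letter} {e : Move}
    (ht : trans inI outI st (reads a i o q s p R r w w.length) =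
      (st', write (reads a i o q s p R r w w.length) x e)) :
    OracleMachine.Reaches (machine inI outI) φ (Disciplined φ B) 1
      (conf inI outI st a i o q s p R r w w.length)
      (conf inI outI st' a i o q s p R (r + e.shift) (w ++ [x]) (w ++ [x]).length) := by
  refine step_of_trans h h' ht ?_
  rintro (_ | _ | _ | _ | (_ | _)) <;>
    simp [tapesOf, write, acting, reads, act_read, act_append, Move.shift]

theorem step_output (h : st ≠ halt) (h' : st ≠ oracle) {x : Letter} {e f : Move}
    (ht : trans inI outI st (reads a i o q s p R r w u) =
      (st', output (reads a i o q s p R r w u) x e f)) :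
    OracleMachine.Reaches (machine inI outI) φ (Disciplined φ B) 1
      (conf inI outI st a i o q s p R r w u)
      (conf inI outI st' a i (o ++ [x]) q s p R (r + e.shift) w (u + f.shift)) := by
  refine step_of_trans h h' ht ?_
  rintro (_ | _ | _ | _ | (_ | _)) <;>
    simp [tapesOf, output, acting, reads, act_read, act_append, Move.shift]

/-- The only kind of step at which the discipline is a real obligation. -/
theorem step_oracle (hq : q.length ≤ B) (hs : s.length ≤ size φ B) :
    OracleMachine.Reaches (machine inI outI) φ (Disciplined φ B) 1
      (conf inI outI oracle a i o q s 0 R r w u) (conf inI outI resume a i o q (φ q) 0 R r w u) := by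
  refine .single (fun _ => ⟨q, s, ?_, hq, ?_, hs⟩) ?_
  · rw [cellsOf_eq]
    rfl
  · rw [cellsOf_eq]
    rfl
  · have hc : ((conf inI outI oracle a i o q s 0 R r w u).tapes .query).content = q := by
      change (⟨cellsBy Cell.letter q, q.length⟩ : Tape Mark).content = q
      rw [← cellsOf_eq, content_cellsOf]
    have h1 : (conf inI outI oracle a i o q s 0 R r w u).state ≠ (machine inI outI).halt := by
      change oracle ≠ halt
      simp
    have h2 : (conf inI outI oracle a i o q s 0 R r w u).state = (machine inI outI).oracle := rfl
    rw [OracleMachine.step, if_neg h1, if_pos h2, hc]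
    refine congrArg (OracleMachine.Cfg.mk (M := machine inI outI) resume) (funext fun k => ?_)
    rcases k with _ | _ | _ | _ | (_ | _) <;> simp only [cellsOf_eq] <;> rfl

end Steps

end Translate

end ParamSpace

/-! ### Rewinding the heads and walking along a track -/

namespace ParamSpace

namespace Translate

open TranslateState Scan Target Tape

/-- Runs of the machine in which the oracle calls are disciplined. -/
abbrev Goes (inI outI : Bool) (φ : Baire) (B : ℕ) :=
  OracleMachine.Reaches (machine inI outI) φ (Disciplined φ B)

/-- The head position after `p` attempts to move to the right on a tape that carries `s`. -/
def pos (s : Str) (p : ℕ) : ℤ := (min p s.length : ℕ)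

theorem cellsBy_pos {Aux : Type} (f : Letter → Cell Aux) (s : Str) (p : ℕ) :
    cellsBy f s (pos s p) = (s[p]?).elim Cell.blank f := by
  rw [pos, cellsBy_natCast]
  rcases le_total p s.length with h | h
  · rw [min_eq_left h]
  · rw [min_eq_right h, List.getElem?_eq_none h, List.getElem?_eq_none le_rfl]

/-- Since `advance` does not leave the first blank cell, attempted moves past the end of the answer
do no harm; the truncated position `pos` records where the head really is. -/
theorem pos_advance {Aux : Type} (s : Str) (p : ℕ) :
    pos s p + (advance (cellsBy (Cell.letter (Aux := Aux)) s (pos s p))).shift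
      = pos s (p + 1) := by
  rw [cellsBy_pos]
  simp only [pos]
  rcases lt_or_ge p s.length with h | h
  · rw [List.getElem?_eq_getElem h, min_eq_left h.le, min_eq_left h]
    simp [advance, Move.shift]
  · rw [List.getElem?_eq_none h, min_eq_right h, min_eq_right (by omega)]
    simp [advance, Move.shift]

theorem isBlank_cellsBy {Aux α : Type} (f : α → Cell Aux) (hf : ∀ x, f x ≠ Cell.blank)
    (l : List α) (h : ℤ) :
    isBlank (cellsBy f l h) = true ↔ ¬ (0 ≤ h ∧ h < l.length) := by
  rw [← cellsBy_ne_blank f hf]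
  cases cellsBy f l h <;> simp [isBlank]

theorem retreat_shift {Aux α : Type} (f : α → Cell Aux) (hf : ∀ x, f x ≠ Cell.blank)
    (l : List α) (h : ℤ) (h1 : -1 ≤ h) (h2 : h < l.length) :
    h + (retreat (cellsBy f l h)).shift = max (h - 1) (-1) := by
  have := cellsBy_ne_blank f hf l h
  rcases eq_or_lt_of_le h1 with rfl | h3
  · rw [cellsBy_neg _ _ (by simp)]
    simp [retreat, Move.shift]
  · have h4 := this.2 ⟨by omega, h2⟩
    rw [max_eq_left (by omega)]
    cases hc : cellsBy f l h <;> simp_all [retreat, Move.shift] <;> rfl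

theorem letter_ne_blank (x : Letter) : (Cell.letter x : Cell Mark) ≠ Cell.blank := by simp

theorem aux_ne_blank (x : Mark) : (Cell.aux x : Cell Mark) ≠ Cell.blank := by simp

section Phases

variable {inI outI : Bool} {φ : Baire} {B : ℕ} {a o q s w : Str} {i : ℕ} {p r u : ℤ}
  {R : List Mark}

/-- The three heads retreat simultaneously to cell `-1`, so the cost is governed by the farthest
one; the common step to the right then brings all of them to cell `0`. -/
theorem goes_rewind (t : Target) (W : ℕ) : ∀ p r u : ℤ, -1 ≤ p → p < s.length → p < W → -1 ≤ r →
    r < R.length → r < W → -1 ≤ u → u < w.length → u < W →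
    Goes inI outI φ B (W + 1) (conf inI outI (rewind t) a i o q s p R r w u)
      (conf inI outI (target inI t) a i o q s 0 R 0 w 0) := by
  induction W with
  | zero =>
    intro p r u hp _ hp' hr _ hr' hu _ hu'
    obtain rfl : p = -1 := by simp at hp'; omega
    obtain rfl : r = -1 := by simp at hr'; omega
    obtain rfl : u = -1 := by simp at hu'; omega
    exact step_moving (by simp) (by simp) (d := .right) (e := .right) (f := .right)
      (by simp [trans, reads, cellsBy_neg, isBlank])
  | succ W ih =>
    intro p r u hp hps hp' hr hrR hr' hu huw hu'
    push_cast at hp' hr' hu'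
    by_cases h : p = -1 ∧ r = -1 ∧ u = -1
    · obtain ⟨rfl, rfl, rfl⟩ := h
      exact (ih (-1) (-1) (-1) hp hps (by omega) hr hrR (by omega) hu huw (by omega)).mono (by omega)
    · have hn : (isBlank (cellsBy (Cell.letter (Aux := Mark)) s p) &&
          isBlank (cellsBy (Cell.aux (Aux := Mark)) R r) &&
          isBlank (cellsBy (Cell.letter (Aux := Mark)) w u)) = false := by
        by_contra hb
        simp only [Bool.not_eq_false, Bool.and_eq_true,
          isBlank_cellsBy _ letter_ne_blank, isBlank_cellsBy _ aux_ne_blank] at hb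
        omega
      have h1 := step_moving (inI := inI) (outI := outI) (φ := φ) (B := B) (a := a) (o := o)
        (q := q) (s := s) (w := w) (i := i) (p := p) (r := r) (u := u) (R := R)
        (st := rewind t) (st' := rewind t) (by simp) (by simp)
        (by simp only [trans, reads, hn]; rfl)
      rw [retreat_shift _ letter_ne_blank s p hp hps,
        retreat_shift _ aux_ne_blank R r hr hrR, retreat_shift _ letter_ne_blank w u hu huw] at h1
      exact (h1.trans (ih _ _ _ (by omega) (by omega) (by omega) (by omega) (by omega)
        (by omega) (by omega) (by omega) (by omega))).mono (by omega)

/-- A head may stand on the blank just after its word, where `retreat` would not move it. One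
unconditional step to the left first brings every head onto its word or to cell `-1`. -/
theorem goes_stepBack (t : Target) (W : ℕ) (hp : 0 ≤ p) (hps : p ≤ s.length) (hpW : p ≤ W)
    (hr : 0 ≤ r) (hrR : r ≤ R.length) (hrW : r ≤ W) (hu : 0 ≤ u) (huw : u ≤ w.length)
    (huW : u ≤ W) :
    Goes inI outI φ B (W + 2) (conf inI outI (stepBack t) a i o q s p R r w u)
      (conf inI outI (target inI t) a i o q s 0 R 0 w 0) := by
  have h1 := step_moving (inI := inI) (outI := outI) (φ := φ) (B := B) (a := a) (o := o)
    (q := q) (s := s) (w := w) (i := i) (p := p) (r := r) (u := u) (R := R)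
    (st := stepBack t) (st' := rewind t) (by simp) (by simp) (by simp only [trans]; rfl)
  simp only [Move.shift] at h1
  exact (h1.trans (goes_rewind t W _ _ _ (by omega) (by omega) (by omega) (by omega) (by omega)
    (by omega) (by omega) (by omega) (by omega))).mono (by omega)

theorem goes_skipOne (P : Scan) (p : ℕ) :
    Goes inI outI φ B 1 (conf inI outI (skipOne P) a i o q s (pos s p) R r w u)
      (conf inI outI (scan P) a i o q s (pos s (p + 1)) R r w u) := by
  have h1 := step_moving (inI := inI) (outI := outI) (φ := φ) (B := B) (a := a) (o := o)
    (q := q) (s := s) (w := w) (i := i) (p := pos s p) (r := r) (u := u) (R := R)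
    (st := skipOne P) (st' := scan P) (by simp) (by simp) (by simp only [trans]; rfl)
  rw [reads, pos_advance] at h1
  simpa only [Move.shift, add_zero] using h1

theorem goes_skipTwo (P : Scan) (p : ℕ) :
    Goes inI outI φ B 2 (conf inI outI (skipTwo P) a i o q s (pos s p) R r w u)
      (conf inI outI (scan P) a i o q s (pos s (p + 2)) R r w u) := by
  have h1 := step_moving (inI := inI) (outI := outI) (φ := φ) (B := B) (a := a) (o := o)
    (q := q) (s := s) (w := w) (i := i) (p := pos s p) (r := r) (u := u) (R := R)
    (st := skipTwo P) (st' := skipOne P) (by simp) (by simp) (by simp only [trans]; rfl)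
  simp only [reads] at h1
  rw [pos_advance] at h1
  simp only [Move.shift, add_zero] at h1
  exact h1.trans (goes_skipOne P (p + 1))

/-- The distance of consecutive letters of a track. -/
def stride (inI : Bool) : ℕ := if inI then 3 else 1

theorem goes_next (P : Scan) (p : ℕ) :
    Goes inI outI φ B 3 (conf inI outI (next inI P) a i o q s (pos s p) R r w u)
      (conf inI outI (scan P) a i o q s (pos s (p + stride inI)) R r w u) := by
  cases inI with
  | false => exact (goes_skipOne P p).mono (by omega)
  | true =>
    have h1 := step_moving (inI := true) (outI := outI) (φ := φ) (B := B) (a := a) (o := o)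
      (q := q) (s := s) (w := w) (i := i) (p := pos s p) (r := r) (u := u) (R := R)
      (st := skipThree P) (st' := skipTwo P) (by simp) (by simp) (by simp only [trans]; rfl)
    simp only [reads] at h1
    rw [pos_advance] at h1
    simp only [Move.shift, add_zero] at h1
    exact h1.trans (goes_skipTwo P (p + 1))

end Phases

end Translate

end ParamSpace

/-! ### The run of the translating machine: query, search, copying, output -/

namespace ParamSpace

theorem length_le_size (φ : Baire) {a : Str} {n : ℕ} (h : a.length ≤ n) :
    (φ a).length ≤ size φ n :=
  le_csSup (size_bddAbove φ n) ⟨a, h, rfl⟩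

theorem codeTwoPow_append (n : ℕ) : codeTwoPow n ++ [Letter.zero] = codeTwoPow (n + 1) := by
  simp [codeTwoPow, ← List.replicate_succ']

theorem length_codeTwoPow (n : ℕ) : (codeTwoPow n).length = n + 2 := by
  simp [codeTwoPow]

namespace Translate

open TranslateState Scan Target Tape

/-- The ruler for inputs of length `n`. -/
def ruler (n : ℕ) : List Mark :=
  .first :: List.replicate n .lit ++ [.last, .ctlZero, .ctlOne]

theorem length_ruler (n : ℕ) : (ruler n).length = n + 4 := by
  simp [ruler]

/-- The letter in a position of a string; beyond the end, it counts as zero. -/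
def letterAt (s : Str) (p : ℕ) : Letter := s[p]?.getD .zero

theorem toLetter_pos (s : Str) (p : ℕ) :
    toLetter (cellsBy (Cell.letter (Aux := Mark)) s (pos s p)) = letterAt s p := by
  rw [cellsBy_pos, letterAt]
  cases s[p]? <;> rfl

/-- The second track of `s` has only zeros in `k` positions from position `p` on. -/
def ZerosAt (s : Str) (p k : ℕ) : Prop := ∀ i < k, letterAt s (p + 3 * i) = .zero

theorem zerosAt_succ (s : Str) (p k : ℕ) :
    ZerosAt s p (k + 1) ↔ letterAt s p = .zero ∧ ZerosAt s (p + 3) k := by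
  constructor
  · intro h
    refine ⟨h 0 (by omega), fun i hi => ?_⟩
    rw [← h (i + 1) (by omega)]
    congr 1
    ring
  · rintro ⟨h0, h⟩ (_ | i) hi
    · exact h0
    · rw [← h i (by omega)]
      congr 1
      ring

/-- The radius that is encoded on the second track has integer part zero, and its first `k` digits
after the point are zero. -/
def SmallRadius (s : Str) (k : ℕ) : Prop :=
  letterAt s 2 = .sep ∧ ZerosAt s 5 k ∨
    letterAt s 2 ≠ .sep ∧ letterAt s 5 = .sep ∧ ZerosAt s 8 k

/-- The condition on an answer for the search to stop. -/
def Accepts (inI : Bool) (s : Str) (k : ℕ) : Prop := inI = true → SmallRadius s k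

/-- The digits in `k` positions of a track, from position `p` on. -/
def digitsAt (d : ℕ) (s : Str) : ℕ → ℕ → Str
  | _, 0 => []
  | p, k + 1 => (if letterAt s p = .one then .one else .zero) :: digitsAt d s (p + d) k

theorem length_digitsAt (d : ℕ) (s : Str) (p k : ℕ) : (digitsAt d s p k).length = k := by
  induction k generalizing p with
  | zero => rfl
  | succ k ih => simp [digitsAt, ih]

/-- The first position of the first track. -/
def offset (inI : Bool) : ℕ := if inI then 1 else 0

/-- The word `w`, interleaved with the control string and the radius that belong to a ruler. -/
def interleave : List Mark → Str → Str
  | _, [] => []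
  | [], x :: w => .zero :: x :: .zero :: interleave [] w
  | m :: R, x :: w => m.control :: x :: m.radius :: interleave R w

/-- The output for the centre `w` on inputs of length `n`. -/
def result (outI : Bool) (n : ℕ) (w : Str) : Str :=
  if outI then interleave (ruler n) w else w

section Phases

variable {inI outI : Bool} {φ : Baire} {B : ℕ} {a o q s w : Str} {i : ℕ} {p r u : ℤ}
  {R : List Mark}

theorem goes_extend {st st' : TranslateState} (h : st ≠ halt) (h' : st ≠ oracle) {x : Letter}
    {m : Mark} {d : Move} {i' : ℕ} (hi : (i : ℤ) + d.shift = i')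
    (ht : trans inI outI st (reads a i o q s p R R.length w u) =
      (st', extend (reads a i o q s p R R.length w u) x (some m) d)) :
    Goes inI outI φ B 1 (conf inI outI st a i o q s p R R.length w u)
      (conf inI outI st' a i' o (q ++ [x]) s p (R ++ [m]) (R ++ [m]).length w u) := by
  simpa using step_extend (φ := φ) (B := B) h h' hi (fun _ => rfl) ht

/-- Here `k` counts the input letters that are still to be passed. Query and ruler grow together,
which keeps the exponent of the query equal to the length of the ruler. -/
theorem goes_rulerLit (k : ℕ) : ∀ i, i + k = a.length →
    Goes inI outI φ B (k + 1)
      (conf inI outI rulerLit a i [] (codeTwoPow (i + 1)) [] 0 (.first :: List.replicate i .lit)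
        (Mark.first :: List.replicate i .lit).length [] 0)
      (conf inI outI rulerCtlZero a a.length [] (codeTwoPow (a.length + 2)) [] 0
        (.first :: List.replicate a.length .lit ++ [.last])
        (Mark.first :: List.replicate a.length Mark.lit ++ [Mark.last]).length [] 0) := by
  induction k with
  | zero =>
    rintro i hi
    obtain rfl : i = a.length := hi
    have h := goes_extend (inI := inI) (outI := outI) (φ := φ) (B := B) (a := a) (o := [])
      (q := codeTwoPow (a.length + 1)) (s := []) (w := []) (i := a.length) (p := 0) (u := 0)
      (R := .first :: List.replicate a.length .lit)
      (st := rulerLit) (st' := rulerCtlZero) (i' := a.length) (d := .stay) (by simp) (by simp) (by simp [Move.shift])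
      (by simp only [trans, reads, cellsBy_natCast, List.getElem?_length, Option.elim, isBlank,
          if_true]; rfl)
    rw [codeTwoPow_append] at h
    exact h
  | succ k ih =>
    intro i hi
    have hlt : i < a.length := by omega
    have h := goes_extend (inI := inI) (outI := outI) (φ := φ) (B := B) (a := a) (o := [])
      (q := codeTwoPow (i + 1)) (s := []) (w := []) (i := i) (p := 0) (u := 0)
      (R := .first :: List.replicate i .lit)
      (st := rulerLit) (st' := rulerLit) (i' := i + 1) (by simp) (by simp)
      (d := .right) (by simp [Move.shift]) (x := .zero) (m := .lit)
      (by simp [trans, reads, cellsBy_natCast, hlt, isBlank])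
    rw [codeTwoPow_append, List.cons_append, ← List.replicate_succ'] at h
    exact (h.trans (ih (i + 1) (by omega))).mono (by omega)

/-- The letters of the input are never inspected, only its end is detected; so query and ruler
depend on the length alone. -/
theorem goes_init : Goes inI outI φ B (2 * a.length + 12) ((machine inI outI).init a)
    (conf inI outI oracle a a.length [] (codeTwoPow (a.length + 4)) [] 0 (ruler a.length) 0 [] 0) := by
  rw [init_eq]
  have h0 : Goes inI outI φ B 1 (conf inI outI queryZero a 0 [] [] [] 0 [] 0 [] 0)
      (conf inI outI queryOne a 0 [] [.zero] [] 0 [] 0 [] 0) :=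
    step_extend (by simp) (by simp) (m := none) (d := .stay) (by rfl) (by simp) (by rfl)
  have h1 : Goes inI outI φ B 1 (conf inI outI queryOne a 0 [] [.zero] [] 0 [] 0 [] 0)
      (conf inI outI rulerFirst a 0 [] (codeTwoPow 0) [] 0 [] 0 [] 0) :=
    step_extend (by simp) (by simp) (m := none) (d := .stay) (by rfl) (by simp) (by rfl)
  have h2 : Goes inI outI φ B 1 (conf inI outI rulerFirst a 0 [] (codeTwoPow 0) [] 0 [] 0 [] 0)
      (conf inI outI rulerLit a 0 [] (codeTwoPow 1) [] 0 [.first] 1 [] 0) :=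
    goes_extend (by simp) (by simp) (d := .stay) (by rfl) (by rfl)
  have h3 := goes_rulerLit (inI := inI) (outI := outI) (φ := φ) (B := B) (a := a) a.length 0
    (by omega)
  have h4 := goes_extend (inI := inI) (outI := outI) (φ := φ) (B := B) (a := a) (o := [])
    (q := codeTwoPow (a.length + 2)) (s := []) (w := []) (i := a.length) (p := 0) (u := 0)
    (R := .first :: List.replicate a.length .lit ++ [.last])
    (st := rulerCtlZero) (st' := rulerCtlOne) (i' := a.length) (d := .stay) (by simp) (by simp) (by simp [Move.shift]) (by rfl)
  have h5 := goes_extend (inI := inI) (outI := outI) (φ := φ) (B := B) (a := a) (o := [])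
    (q := codeTwoPow (a.length + 3)) (s := []) (w := []) (i := a.length) (p := 0) (u := 0)
    (R := .first :: List.replicate a.length .lit ++ [.last] ++ [.ctlZero])
    (st := rulerCtlOne) (st' := stepBack call) (i' := a.length) (d := .stay) (by simp) (by simp) (by simp [Move.shift])
    (by rfl)
  rw [codeTwoPow_append] at h4 h5
  have e : Mark.first :: List.replicate a.length Mark.lit ++ [Mark.last] ++ [Mark.ctlZero] ++
      [Mark.ctlOne] = ruler a.length := by simp [ruler]
  rw [e] at h5
  have h6 := goes_stepBack (inI := inI) (outI := outI) (φ := φ) (B := B) (a := a) (o := [])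
    (q := codeTwoPow (a.length + 4)) (s := []) (w := []) (i := a.length) (p := 0) (u := 0)
    (R := ruler a.length) (r := (ruler a.length).length) call (a.length + 4)
    (by simp) (by simp) (by omega) (by omega) le_rfl (by rw [length_ruler]) (by simp)
    (by simp) (by omega)
  exact (((((h0.trans h1).trans h2).trans h3).trans h4).trans (h5.trans h6)).mono (by omega)

theorem goes_reject {st : TranslateState} (h : st ≠ halt) (h' : st ≠ oracle) (W : ℕ)
    (ht : trans inI outI st (reads a i o q s p R r [] 0) =
      reject (reads a i o q s p R r [] 0))
    (hp : 0 ≤ p) (hps : p ≤ s.length) (hpW : p ≤ W)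
    (hr : 0 ≤ r) (hrR : r ≤ R.length) (hrW : r ≤ W) :
    Goes inI outI φ B (W + 3) (conf inI outI st a i o q s p R r [] 0)
      (conf inI outI oracle a i o (q ++ [.zero]) s 0 R 0 [] 0) := by
  have h1 := step_extend (inI := inI) (outI := outI) (φ := φ) (B := B) h h' (x := .zero)
    (m := none) (d := .stay) (i' := i) (st' := stepBack call) (by simp [Move.shift]) (by simp) ht
  simp only [Option.toList, List.append_nil, List.length_nil, Nat.cast_zero, add_zero] at h1
  exact (h1.trans (goes_stepBack call W hp hps hpW hr hrR hrW le_rfl (by simp) (by simp))).mono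
    (by omega)

theorem pos_nonneg (s : Str) (p : ℕ) : 0 ≤ pos s p := by simp only [pos]; omega

theorem pos_le_length (s : Str) (p : ℕ) : pos s p ≤ s.length := by simp only [pos]; omega

theorem pos_le (s : Str) (p : ℕ) : pos s p ≤ p := by simp only [pos]; omega

theorem pos_zero (s : Str) : pos s 0 = 0 := by simp [pos]

theorem goes_stay {st st' : TranslateState} (h : st ≠ halt) (h' : st ≠ oracle)
    (ht : trans inI outI st (reads a i o q s p R r w u) =
      (st', moving (reads a i o q s p R r w u) .stay .stay .stay)) :
    Goes inI outI φ B 1 (conf inI outI st a i o q s p R r w u)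
      (conf inI outI st' a i o q s p R r w u) := by
  simpa [Move.shift] using step_moving (φ := φ) (B := B) h h' ht

theorem isBlank_ruler {r : ℕ} (hr : r < R.length) :
    isBlank (cellsBy (Cell.aux (Aux := Mark)) R r) = false := by
  rw [cellsBy_natCast, List.getElem?_eq_getElem hr]
  rfl

theorem isBlank_length {α : Type} (f : α → Cell Mark) (l : List α) :
    isBlank (cellsBy f l l.length) = true := by
  rw [cellsBy_natCast, List.getElem?_eq_none le_rfl]
  rfl

open Classical in
-- The remaining `k` marks of the ruler count the digits that are still to be tested. Both outcomes
-- leave the three heads in cell `0`, as needed for copying and for the next oracle call.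
theorem goes_radiusFrac (k : ℕ) : ∀ p r : ℕ, r + k = R.length →
    Goes true outI φ B (7 * k + p + R.length + 4)
      (conf true outI (scan radiusFrac) a i o q s (pos s p) R r [] 0)
      (if ZerosAt s p k then conf true outI (startCopy true) a i o q s 0 R 0 [] 0
        else conf true outI oracle a i o (q ++ [.zero]) s 0 R 0 [] 0) := by
  induction k with
  | zero =>
    intro p r hr
    obtain rfl : r = R.length := by omega
    have hz : ZerosAt s p 0 := fun i hi => absurd hi (by omega)
    rw [if_pos hz]
    have h1 := goes_stay (inI := true) (outI := outI) (φ := φ) (B := B) (a := a) (o := o)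
      (q := q) (s := s) (w := []) (i := i) (p := pos s p) (r := R.length) (u := 0) (R := R)
      (st := scan radiusFrac) (st' := stepBack copy) (by simp) (by simp)
      (by simp only [trans, scanTrans, reads, isBlank_length, if_true])
    have := pos_le s p
    exact (h1.trans (goes_stepBack copy (p + R.length) (pos_nonneg _ _) (pos_le_length _ _)
      (by push_cast; omega) (by omega) le_rfl (by push_cast; omega) le_rfl (by simp)
      (by omega))).mono (by omega)
  | succ k ih =>
    intro p r hr
    have hb := isBlank_ruler (R := R) (r := r) (by omega)
    by_cases hz : letterAt s p = .zero
    · have h1 := step_moving (inI := true) (outI := outI) (φ := φ) (B := B) (a := a) (o := o)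
        (q := q) (s := s) (w := []) (i := i) (p := pos s p) (r := r) (u := 0) (R := R)
        (st := scan radiusFrac) (st' := next true radiusFrac) (d := .stay) (e := .right)
        (f := .stay) (by simp) (by simp)
        (by simp [trans, scanTrans, reads, hb, toLetter_pos, hz])
      simp only [Move.shift, add_zero] at h1
      have h2 := goes_next (inI := true) (outI := outI) (φ := φ) (B := B) (a := a) (o := o)
        (q := q) (s := s) (w := []) (i := i) (r := (r : ℤ) + 1) (u := 0) (R := R) radiusFrac p
      have h3 := ih (p + 3) (r + 1) (by omega)
      simp only [zerosAt_succ, hz, true_and]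
      push_cast at h3
      exact ((h1.trans h2).trans h3).mono (by omega)
    · rw [if_neg (by rw [zerosAt_succ]; tauto)]
      have := pos_le s p
      exact (goes_reject (by simp) (by simp) (p + R.length)
        (by simp [trans, scanTrans, reads, hb, toLetter_pos, hz]) (pos_nonneg _ _)
        (pos_le_length _ _) (by push_cast; omega) (by omega) (by omega)
        (by push_cast; omega)).mono (by omega)

open Classical in
-- The cost of testing an answer depends on the ruler only. The length of the answer must not enter,
-- because for interval names the parameter does not bound it.
theorem goes_resume :
    Goes inI outI φ B (8 * R.length + 24) (conf inI outI resume a i o q s 0 R 0 [] 0)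
      (if Accepts inI s R.length then conf inI outI (startCopy inI) a i o q s 0 R 0 [] 0
        else conf inI outI oracle a i o (q ++ [.zero]) s 0 R 0 [] 0) := by
  cases inI with
  | false =>
    rw [if_pos (by simp [Accepts])]
    exact (goes_stay (by simp) (by simp) (by simp [trans])).mono (by omega)
  | true =>
    have h1 : Goes true outI φ B 1 (conf true outI resume a i o q s 0 R 0 [] 0)
        (conf true outI (skipTwo radiusHead) a i o q s (pos s 0) R 0 [] 0) := by
      rw [pos_zero]
      exact goes_stay (by simp) (by simp) (by simp [trans])
    have h2 := h1.trans (goes_skipTwo radiusHead 0)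
    simp only [Accepts, true_implies, SmallRadius]
    by_cases hs : letterAt s 2 = .sep
    · have h3 := goes_stay (inI := true) (outI := outI) (φ := φ) (B := B) (a := a) (o := o)
        (q := q) (s := s) (w := []) (i := i) (p := pos s 2) (r := 0) (u := 0) (R := R)
        (st := scan radiusHead) (st' := next true radiusFrac) (by simp) (by simp)
        (by simp [trans, scanTrans, reads, toLetter_pos, hs])
      have h4 := h3.trans (goes_next radiusFrac 2)
      have h5 := goes_radiusFrac (outI := outI) (φ := φ) (B := B) (a := a) (i := i) (o := o)
        (q := q) (s := s) (R := R) R.length 5 0 (by omega)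
      simp only [hs, true_and, ne_eq, not_true, false_and, or_false]
      exact ((h2.trans h4).trans h5).mono (by omega)
    · have h3 := goes_stay (inI := true) (outI := outI) (φ := φ) (B := B) (a := a) (o := o)
        (q := q) (s := s) (w := []) (i := i) (p := pos s 2) (r := 0) (u := 0) (R := R)
        (st := scan radiusHead) (st' := next true radiusSep) (by simp) (by simp)
        (by simp [trans, scanTrans, reads, toLetter_pos, hs])
      have h4 := h2.trans (h3.trans (goes_next radiusSep 2))
      by_cases hs' : letterAt s 5 = .sep
      · have h5 := goes_stay (inI := true) (outI := outI) (φ := φ) (B := B) (a := a) (o := o)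
          (q := q) (s := s) (w := []) (i := i) (p := pos s 5) (r := 0) (u := 0) (R := R)
          (st := scan radiusSep) (st' := next true radiusFrac) (by simp) (by simp)
          (by simp [trans, scanTrans, reads, toLetter_pos, hs'])
        have h6 := h5.trans (goes_next radiusFrac 5)
        have h7 := goes_radiusFrac (outI := outI) (φ := φ) (B := B) (a := a) (i := i) (o := o)
          (q := q) (s := s) (R := R) R.length 8 0 (by omega)
        simp only [hs, false_and, false_or, hs', true_and, ne_eq, not_false_eq_true]
        exact ((h4.trans h6).trans h7).mono (by omega)
      · rw [if_neg (by tauto)]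
        have := pos_le s 5
        have h5 := goes_reject (inI := true) (outI := outI) (φ := φ) (B := B) (a := a) (o := o)
          (q := q) (s := s) (i := i) (p := pos s 5) (r := 0) (R := R)
          (st := scan radiusSep) (by simp) (by simp) 5
          (by simp [trans, scanTrans, reads, toLetter_pos, hs']) (pos_nonneg _ _)
          (pos_le_length _ _) (by push_cast at *; omega) le_rfl (by omega) (by omega)
        exact (h4.trans h5).mono (by omega)

/-- Induction on the number of rejections, with the exponent of the current query and the previous
answer as variables. The previous answer belongs to a shorter query, so `size φ B` bounds it; this
is what the discipline demands. -/
theorem goes_search (t : ℕ) : ∀ (n : ℕ) (s : Str), n + t + 2 ≤ B → s.length ≤ size φ B →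
    (∀ j < t, ¬ Accepts inI (φ (codeTwoPow (n + j))) R.length) →
    Accepts inI (φ (codeTwoPow (n + t))) R.length →
    Goes inI outI φ B ((t + 1) * (8 * R.length + 25))
      (conf inI outI oracle a i o (codeTwoPow n) s 0 R 0 [] 0)
      (conf inI outI (startCopy inI) a i o (codeTwoPow (n + t)) (φ (codeTwoPow (n + t))) 0 R 0
        [] 0) := by
  induction t with
  | zero =>
    intro n s hB hs _ hacc
    have h1 : Goes inI outI φ B 1 _ _ := step_oracle (inI := inI) (outI := outI) (φ := φ) (B := B)
      (a := a) (o := o) (q := codeTwoPow n) (s := s) (w := []) (i := i) (r := 0) (u := 0) (R := R)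
      (by rw [length_codeTwoPow]; omega) hs
    have h2 := goes_resume (inI := inI) (outI := outI) (φ := φ) (B := B) (a := a) (i := i) (o := o)
      (q := codeTwoPow n) (s := φ (codeTwoPow n)) (R := R)
    rw [add_zero] at hacc ⊢
    rw [if_pos hacc] at h2
    exact (h1.trans h2).mono (by omega)
  | succ t ih =>
    intro n s hB hs hrej hacc
    have h1 : Goes inI outI φ B 1 _ _ := step_oracle (inI := inI) (outI := outI) (φ := φ) (B := B)
      (a := a) (o := o) (q := codeTwoPow n) (s := s) (w := []) (i := i) (r := 0) (u := 0) (R := R)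
      (by rw [length_codeTwoPow]; omega) hs
    have h2 := goes_resume (inI := inI) (outI := outI) (φ := φ) (B := B) (a := a) (i := i) (o := o)
      (q := codeTwoPow n) (s := φ (codeTwoPow n)) (R := R)
    rw [if_neg (by simpa using hrej 0 (by omega)), codeTwoPow_append] at h2
    have e : ∀ j, n + 1 + j = n + (j + 1) := fun j => by omega
    have h3 := ih (n + 1) (φ (codeTwoPow n)) (by omega)
      (length_le_size φ (by rw [length_codeTwoPow]; omega))
      (fun j hj => by rw [e]; exact hrej (j + 1) (by omega)) (by rw [e]; exact hacc)
    rw [e] at h3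
    exact ((h1.trans h2).trans h3).mono (le_of_eq (by ring))

theorem goes_startCopy :
    Goes inI outI φ B 1 (conf inI outI (startCopy inI) a i o q s 0 R r w u)
      (conf inI outI (scan copyInt) a i o q s (pos s (offset inI)) R r w u) := by
  cases inI with
  | false =>
    simp only [offset, startCopy, Bool.false_eq_true, if_false, pos_zero]
    exact .refl _ _
  | true =>
    have h := goes_skipOne (inI := true) (outI := outI) (φ := φ) (B := B) (a := a) (i := i) (o := o)
      (q := q) (s := s) (R := R) (r := r) (w := w) (u := u) copyInt 0
    rw [pos_zero] at h
    exact h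

/-- The hypotheses speak of actual cells instead of `letterAt`, because a blank would end the
copying as well. -/
theorem goes_copyInt (U : Str) : ∀ (p : ℕ) (w : Str), Letter.sep ∉ U →
    (∀ j < U.length, s[p + stride inI * j]? = U[j]?) →
    s[p + stride inI * U.length]? = some .sep →
    Goes inI outI φ B (4 * (U.length + 1))
      (conf inI outI (scan copyInt) a i o q s (pos s p) R r w w.length)
      (conf inI outI (scan copyFrac) a i o q s (pos s (p + stride inI * (U.length + 1))) R r
        (w ++ U ++ [Letter.sep]) (w ++ U ++ [Letter.sep]).length) := by
  induction U with
  | nil =>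
    intro p w _ _ hs
    simp only [List.length_nil, mul_zero, add_zero] at hs
    have h1 := step_write (inI := inI) (outI := outI) (φ := φ) (B := B) (a := a) (o := o)
      (q := q) (s := s) (w := w) (i := i) (p := pos s p) (r := r) (R := R)
      (st := scan copyInt) (st' := next inI copyFrac) (x := .sep) (e := .stay) (by simp) (by simp)
      (by simp [trans, scanTrans, reads, cellsBy_pos, hs, toLetter])
    simp only [Move.shift, add_zero] at h1
    simpa using h1.trans (goes_next copyFrac p)
  | cons x U ih =>
    intro p w hsep hU hs
    rw [List.mem_cons, not_or] at hsep
    have hx := hU 0 (by simp)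
    simp only [mul_zero, add_zero, List.getElem?_cons_zero] at hx
    have h1 := step_write (inI := inI) (outI := outI) (φ := φ) (B := B) (a := a) (o := o)
      (q := q) (s := s) (w := w) (i := i) (p := pos s p) (r := r) (R := R)
      (st := scan copyInt) (st' := next inI copyInt) (x := x) (e := .stay) (by simp) (by simp)
      (by simp [trans, scanTrans, reads, cellsBy_pos, hx, toLetter, isBlank, Ne.symm hsep.1])
    simp only [Move.shift, add_zero] at h1
    have h2 := h1.trans (goes_next copyInt p)
    have e : ∀ j, p + stride inI + stride inI * j = p + stride inI * (j + 1) := fun j => by ring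
    have h3 := ih (p + stride inI) (w ++ [x]) hsep.2
      (fun j hj => by rw [e, hU (j + 1) (by simpa using hj), List.getElem?_cons_succ])
      (by rw [e]; exact hs)
    rw [e] at h3
    simp only [List.append_assoc, List.cons_append, List.nil_append, List.length_cons] at h2 h3 ⊢
    exact (h2.trans h3).mono (by omega)

/-- The ruler, scanned from `r` on, fixes the number of copied digits. Nothing is assumed about the
answer: positions past its end contribute zeros. -/
theorem goes_copyFrac (k : ℕ) : ∀ (p r : ℕ) (w : Str), r + k = R.length →
    Goes inI outI φ B (4 * k + 1)
      (conf inI outI (scan copyFrac) a i o q s (pos s p) R r w w.length)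
      (conf inI outI (stepBack emit) a i o q s (pos s (p + stride inI * k)) R R.length
        (w ++ digitsAt (stride inI) s p k ++ [Letter.one])
        (w ++ digitsAt (stride inI) s p k ++ [Letter.one]).length) := by
  induction k with
  | zero =>
    intro p r w hr
    obtain rfl : r = R.length := by omega
    have h1 := step_write (inI := inI) (outI := outI) (φ := φ) (B := B) (a := a) (o := o)
      (q := q) (s := s) (w := w) (i := i) (p := pos s p) (r := R.length) (R := R)
      (st := scan copyFrac) (st' := stepBack emit) (x := .one) (e := .stay) (by simp) (by simp)
      (by simp only [trans, scanTrans, reads, isBlank_length, if_true])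
    simpa [Move.shift, digitsAt] using h1
  | succ k ih =>
    intro p r w hr
    have hb := isBlank_ruler (R := R) (r := r) (by omega)
    have h1 := step_write (inI := inI) (outI := outI) (φ := φ) (B := B) (a := a) (o := o)
      (q := q) (s := s) (w := w) (i := i) (p := pos s p) (r := r) (R := R)
      (st := scan copyFrac) (st' := next inI copyFrac)
      (x := if letterAt s p = .one then .one else .zero) (e := .right) (by simp) (by simp)
      (by simp only [trans, scanTrans, reads, hb, toLetter_pos]; rfl)
    simp only [Move.shift] at h1
    have h2 := h1.trans (goes_next copyFrac p)
    have h3 := ih (p + stride inI) (r + 1)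
      (w ++ [if letterAt s p = .one then .one else .zero]) (by omega)
    have e : p + stride inI + stride inI * k = p + stride inI * (k + 1) := by ring
    rw [e] at h3
    push_cast at h3
    simp only [digitsAt, List.append_assoc, List.cons_append, List.nil_append] at h2 h3 ⊢
    exact (h2.trans h3).mono (by omega)

theorem goes_emit_false (k : ℕ) : ∀ (u : ℕ) (o : Str), u + k = w.length →
    Goes inI false φ B (k + 1) (conf inI false emitControl a i o q s p R r w u)
      (conf inI false halt a i (o ++ w.drop u) q s p R r w w.length) := by
  induction k with
  | zero =>
    intro u o hu
    obtain rfl : u = w.length := by omega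
    rw [List.drop_length, List.append_nil]
    exact goes_stay (by simp) (by simp) (by simp only [trans, reads, isBlank_length, if_true])
  | succ k ih =>
    intro u o hu
    have hlt : u < w.length := by omega
    have h1 := step_output (inI := inI) (outI := false) (φ := φ) (B := B) (a := a) (o := o)
      (q := q) (s := s) (w := w) (i := i) (p := p) (r := r) (u := u) (R := R)
      (st := emitControl) (st' := emitControl) (x := w[u]) (e := .stay) (f := .right)
      (by simp) (by simp)
      (by simp [trans, reads, cellsBy_natCast, hlt, toLetter, isBlank])
    simp only [Move.shift, add_zero] at h1
    have h2 := ih (u + 1) (o ++ [w[u]]) (by omega)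
    rw [List.append_assoc, List.singleton_append, List.getElem_cons_drop] at h2
    push_cast at h2
    exact (h1.trans h2).mono (by omega)

/-- The result tape decides when the output ends. If the ruler ends earlier, its head stays on the
blank, which is read as zero on both accompanying tracks. The final position of that head is
irrelevant, hence existential. -/
theorem goes_emit_true (k : ℕ) : ∀ (r u : ℕ) (o : Str), u + k = w.length → r ≤ R.length →
    ∃ r' : ℤ, Goes inI true φ B (3 * k + 1) (conf inI true emitControl a i o q s p R r w u)
      (conf inI true halt a i (o ++ interleave (R.drop r) (w.drop u)) q s p R r' w w.length) := by
  induction k with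
  | zero =>
    intro r u o hu _
    obtain rfl : u = w.length := by omega
    refine ⟨r, ?_⟩
    rw [List.drop_length]
    have e : o ++ interleave (R.drop r) [] = o := by simp [interleave]
    rw [e]
    exact goes_stay (by simp) (by simp) (by simp only [trans, reads, isBlank_length, if_true])
  | succ k ih =>
    intro r u o hu hr
    have hlt : u < w.length := by omega
    have h1 := step_output (inI := inI) (outI := true) (φ := φ) (B := B) (a := a) (o := o)
      (q := q) (s := s) (w := w) (i := i) (p := p) (r := r) (u := u) (R := R)
      (st := emitControl) (st' := emitCentre) (x := markControl (cellsBy Cell.aux R r))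
      (e := .stay) (f := .stay) (by simp) (by simp)
      (by simp [trans, reads, cellsBy_natCast, hlt, isBlank])
    have h2 := step_output (inI := inI) (outI := true) (φ := φ) (B := B) (a := a)
      (o := o ++ [markControl (cellsBy Cell.aux R r)])
      (q := q) (s := s) (w := w) (i := i) (p := p) (r := r) (u := u) (R := R)
      (st := emitCentre) (st' := emitRadius) (x := w[u]) (e := .stay) (f := .stay)
      (by simp) (by simp)
      (by simp [trans, reads, cellsBy_natCast, hlt, toLetter])
    have h3 := step_output (inI := inI) (outI := true) (φ := φ) (B := B) (a := a)
      (o := o ++ [markControl (cellsBy Cell.aux R r)] ++ [w[u]])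
      (q := q) (s := s) (w := w) (i := i) (p := p) (r := r) (u := u) (R := R)
      (st := emitRadius) (st' := emitControl) (x := markRadius (cellsBy Cell.aux R r))
      (e := advance (cellsBy (Cell.aux (Aux := Mark)) R r)) (f := .right)
      (by simp) (by simp) (by simp [trans, reads])
    simp only [Move.shift, add_zero] at h1 h2
    have h4 := (h1.trans h2).trans h3
    rw [← List.getElem_cons_drop hlt]
    rcases eq_or_lt_of_le hr with rfl | hrlt
    · obtain ⟨r', h5⟩ := ih R.length (u + 1) (o ++ [.zero, w[u], .zero]) (by omega) le_rfl
      refine ⟨r', ?_⟩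
      simp only [cellsBy_natCast, List.getElem?_length, Option.elim, advance, markControl,
        markRadius, Move.shift, add_zero, List.append_assoc, List.cons_append, List.nil_append] at h4
      simp only [List.drop_length, interleave, List.append_assoc, List.cons_append,
        List.nil_append] at h5 ⊢
      push_cast at h5
      exact (h4.trans h5).mono (by omega)
    · obtain ⟨r', h5⟩ := ih (r + 1) (u + 1) (o ++ [R[r].control, w[u], R[r].radius]) (by omega)
        hrlt
      refine ⟨r', ?_⟩
      simp only [cellsBy_natCast, List.getElem?_eq_getElem hrlt, Option.elim, advance, markControl,
        markRadius, Move.shift, List.append_assoc, List.cons_append, List.nil_append] at h4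
      rw [← List.getElem_cons_drop hrlt]
      simp only [interleave, List.append_assoc, List.cons_append,
        List.nil_append] at h5 ⊢
      push_cast at h5
      exact (h4.trans h5).mono (by omega)

theorem goes_emit : ∃ r' : ℤ, Goes inI outI φ B (3 * w.length + 1)
    (conf inI outI emitControl a i [] q s p (ruler a.length) 0 w 0)
    (conf inI outI halt a i (result outI a.length w) q s p (ruler a.length) r' w w.length) := by
  cases outI with
  | false => exact ⟨0, (goes_emit_false w.length 0 [] (by omega)).mono (by omega)⟩
  | true => exact goes_emit_true w.length 0 0 [] (by omega) (by omega)

/-- The computation of the machine, if the search ends at the query `2 ^ (n + t)` and the first track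
of the answer contains the integer part `U`. -/
theorem goes_halt (t : ℕ) (U : Str) {n : ℕ} (hn : n = a.length + 4)
    (hrej : ∀ j < t, ¬ Accepts inI (φ (codeTwoPow (n + j))) n)
    (hacc : Accepts inI (φ (codeTwoPow (n + t))) n) (hs : φ (codeTwoPow (n + t)) = s)
    (hsep : Letter.sep ∉ U)
    (hU : ∀ j < U.length, s[offset inI + stride inI * j]? = U[j]?)
    (hU' : s[offset inI + stride inI * U.length]? = some .sep) :
    ∃ c, Goes inI outI φ (n + t + 2) (100 * ((t + 1) * (n + U.length + 1)))
        ((machine inI outI).init a) c ∧ c.state = halt ∧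
      (c.tapes .output).content = result outI a.length (U ++ [Letter.sep] ++
        digitsAt (stride inI) s (offset inI + stride inI * (U.length + 1)) n ++ [Letter.one]) := by
  have hR : (ruler a.length).length = n := by rw [length_ruler, hn]
  have h1 := goes_init (inI := inI) (outI := outI) (φ := φ) (B := n + t + 2) (a := a)
  rw [← hn] at h1
  have h2 := goes_search (inI := inI) (outI := outI) (φ := φ) (B := n + t + 2) (a := a)
    (i := a.length) (o := []) (R := ruler a.length) t n [] le_rfl (by simp)
    (by rw [hR]; exact hrej) (by rw [hR]; exact hacc)
  rw [hs] at h2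
  have h3 := h2.trans (goes_startCopy.trans (goes_copyInt U _ [] hsep hU hU'))
  rw [List.nil_append] at h3
  have h4 := goes_copyFrac (inI := inI) (outI := outI) (φ := φ) (B := n + t + 2) (a := a)
    (i := a.length) (o := []) (q := codeTwoPow (n + t)) (s := s) (R := ruler a.length) n
    (offset inI + stride inI * (U.length + 1)) 0 (U ++ [Letter.sep]) (by omega)
  set w := U ++ [Letter.sep] ++ digitsAt (stride inI) s (offset inI + stride inI * (U.length + 1)) n
    ++ [Letter.one] with hw
  have hlen : w.length = U.length + n + 2 := by
    rw [hw]
    simp only [List.length_append, length_digitsAt, List.length_singleton]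
    omega
  set p := offset inI + stride inI * (U.length + 1) + stride inI * n with hp
  have hple : p ≤ 3 * U.length + 3 * n + 4 := by
    rw [hp]
    cases inI <;> simp only [offset, stride, if_true, Bool.false_eq_true, if_false] <;> omega
  have := pos_le s p
  have h5 := goes_stepBack (inI := inI) (outI := outI) (φ := φ) (B := n + t + 2) (a := a)
    (i := a.length) (o := []) (q := codeTwoPow (n + t)) (s := s) (R := ruler a.length)
    (p := pos s p) (r := (ruler a.length).length) (w := w) (u := w.length) emit
    (3 * U.length + 3 * n + 4) (pos_nonneg _ _) (pos_le_length _ _) (by omega)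
    (by omega) le_rfl (by omega) (by omega) le_rfl (by omega)
  obtain ⟨r', h6⟩ := goes_emit (inI := inI) (outI := outI) (φ := φ) (B := n + t + 2) (a := a)
    (i := a.length) (q := codeTwoPow (n + t)) (s := s) (p := 0) (w := w)
  refine ⟨_, ((((h1.trans h3).trans h4).trans h5).trans h6).mono ?_, rfl, ?_⟩
  -- The search costs `(t + 1) * (8 * n + 25)` and every other phase is linear in `n + U.length`;
  -- the constant `100` is generous.
  · rw [hR, hlen]
    nlinarith [Nat.zero_le t, Nat.zero_le n, Nat.zero_le U.length, Nat.zero_le (t * n),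
      Nat.zero_le (t * U.length)]
  · change (⟨cellsBy Cell.letter _, _⟩ : Tape Mark).content = _
    rw [← cellsOf_eq, content_cellsOf]

end Phases

end Translate

end ParamSpace

namespace ParamSpace

open Translate

/-! ## Binary expansions -/

/-- The value of binary digits after the point. -/
def fracVal : List Bool → ℚ
  | [] => 0
  | b :: l => (b.toNat + fracVal l) / 2

theorem fracVal_nonneg (l : List Bool) : 0 ≤ fracVal l := by
  induction l with
  | nil => exact le_rfl
  | cons b l ih =>
    rw [fracVal]
    positivity

theorem fracVal_le_one (l : List Bool) : fracVal l ≤ 1 := by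
  induction l with
  | nil => simp [fracVal]
  | cons b l ih =>
    have : (b.toNat : ℚ) ≤ 1 := by cases b <;> simp
    rw [fracVal]
    linarith

theorem binVal_cons (b : Bool) (l : List Bool) :
    binVal (b :: l) = b.toNat * 2 ^ l.length + binVal l := by
  induction l using List.reverseRecOn with
  | nil => simp [binVal]
  | append_singleton l c ih =>
    rw [← List.cons_append, binVal_append, binVal_append, ih, List.length_append,
      List.length_singleton, pow_succ]
    ring

theorem binVal_lt (l : List Bool) : binVal l < 2 ^ l.length := by
  induction l with
  | nil => simp [binVal]
  | cons b l ih =>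
    have : b.toNat ≤ 1 := by cases b <;> simp
    rw [binVal_cons, List.length_cons, pow_succ]
    nlinarith [Nat.mul_le_mul_right (2 ^ l.length) this]

theorem binVal_div (l : List Bool) : (binVal l : ℚ) / 2 ^ l.length = fracVal l := by
  induction l with
  | nil => simp [binVal, fracVal]
  | cons b l ih =>
    rw [fracVal, ← ih, binVal_cons, List.length_cons, pow_succ]
    push_cast
    field_simp

/-- The first `k` digits after the point. -/
def truncate : ℕ → List Bool → List Bool
  | 0, _ => []
  | k + 1, [] => false :: truncate k []
  | k + 1, b :: l => b :: truncate k l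

/-- Appending the digit one after `k` digits yields the midpoint of the possible values. -/
theorem abs_fracVal_truncate (k : ℕ) (l : List Bool) :
    |fracVal (truncate k l ++ [true]) - fracVal l| ≤ (2 : ℚ)⁻¹ ^ (k + 1) := by
  induction k generalizing l with
  | zero =>
    have h0 := fracVal_nonneg l
    have h1 := fracVal_le_one l
    simp only [truncate, List.nil_append, fracVal, Bool.toNat_true, Nat.cast_one, zero_add, pow_one]
    rw [abs_le]
    constructor <;> norm_num <;> linarith
  | succ k ih =>
    cases l with
    | nil =>
      have := ih []
      rw [abs_le] at this ⊢
      simp only [truncate, List.cons_append, fracVal, Bool.toNat_false, Nat.cast_zero] at this ⊢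
      rw [pow_succ]
      constructor <;> norm_num <;> linarith
    | cons b l =>
      have := ih l
      rw [abs_le] at this ⊢
      simp only [truncate, List.cons_append, fracVal] at this ⊢
      rw [pow_succ]
      constructor <;> norm_num <;> linarith

theorem toBits_eq_some {s : Str} {l : List Bool} (h : toBits s = some l) : s = ofBits l := by
  induction s generalizing l with
  | nil =>
    obtain rfl : [] = l := by simpa [toBits] using h
    rfl
  | cons x s ih =>
    cases x with
    | sep => simp [toBits] at h
    | zero =>
      simp only [toBits, Option.map_eq_some_iff] at h
      obtain ⟨l', h, rfl⟩ := h
      rw [ih h]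
      simp [ofBits]
    | one =>
      simp only [toBits, Option.map_eq_some_iff] at h
      obtain ⟨l', h, rfl⟩ := h
      rw [ih h]
      simp [ofBits]

theorem length_ofBits (l : List Bool) : (ofBits l).length = l.length := by simp [ofBits]

theorem letterAt_ofBits_cons_zero (b : Bool) (l : List Bool) :
    letterAt (ofBits (b :: l)) 0 = if b then .one else .zero := by
  simp [letterAt, ofBits]

theorem letterAt_cons_succ (x : Letter) (s : Str) (i : ℕ) :
    letterAt (x :: s) (i + 1) = letterAt s i := by
  simp [letterAt]

theorem letterAt_ofBits_cons_succ (b : Bool) (l : List Bool) (i : ℕ) :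
    letterAt (ofBits (b :: l)) (i + 1) = letterAt (ofBits l) i :=
  letterAt_cons_succ _ _ _

theorem letterAt_nil (i : ℕ) : letterAt [] i = .zero := by simp [letterAt]

theorem fracVal_le_of_zeros (k : ℕ) (l : List Bool)
    (h : ∀ i < k, letterAt (ofBits l) i = .zero) : fracVal l ≤ (2 : ℚ)⁻¹ ^ k := by
  induction k generalizing l with
  | zero => simpa using fracVal_le_one l
  | succ k ih =>
    cases l with
    | nil =>
      simp only [fracVal]
      positivity
    | cons b l =>
      have h0 := h 0 (by omega)
      rw [letterAt_ofBits_cons_zero] at h0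
      have hb : b = false := by
        cases b with
        | false => rfl
        | true => simp at h0
      have := ih l fun i hi => by
        rw [← h (i + 1) (by omega), letterAt_ofBits_cons_succ]
      rw [fracVal, hb, pow_succ]
      simp only [Bool.toNat_false, Nat.cast_zero]
      linarith

/-- Strictness is essential: `2 ^ (-k)` itself has the digit one in the `k`-th place. Together with
`fracVal_le_of_zeros`, the test on the digits lies between `<` and `≤`. -/
theorem zeros_of_fracVal_lt (k : ℕ) (l : List Bool) (h : fracVal l < (2 : ℚ)⁻¹ ^ k) :
    ∀ i < k, letterAt (ofBits l) i = .zero := by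
  induction k generalizing l with
  | zero =>
    intro i hi
    omega
  | succ k ih =>
    cases l with
    | nil =>
      intro i _
      exact letterAt_nil i
    | cons b l =>
      rw [fracVal, pow_succ] at h
      have hp : (2 : ℚ)⁻¹ ^ k ≤ 1 := pow_le_one₀ (by norm_num) (by norm_num)
      have h0 := fracVal_nonneg l
      have hb : b = false := by
        cases b with
        | false => rfl
        | true =>
          simp only [Bool.toNat_true, Nat.cast_one] at h
          linarith
      subst hb
      simp only [Bool.toNat_false, Nat.cast_zero] at h
      rintro (_ | i) hi
      · rw [letterAt_ofBits_cons_zero]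
        rfl
      · rw [letterAt_ofBits_cons_succ]
        exact ih l (by linarith) i (by omega)

theorem digitsAt_eq {d : ℕ} {s : Str} (k : ℕ) : ∀ (p : ℕ) (l : List Bool),
    (∀ i, letterAt s (p + d * i) = letterAt (ofBits l) i) →
    digitsAt d s p k = ofBits (truncate k l) := by
  induction k with
  | zero =>
    intro p l _
    rfl
  | succ k ih =>
    intro p l h
    have h0 := h 0
    rw [mul_zero, add_zero] at h0
    have hs : ∀ i, letterAt s (p + d + d * i) = letterAt (ofBits l) (i + 1) := fun i => by
      rw [← h (i + 1)]
      congr 1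
      ring
    cases l with
    | nil =>
      rw [show ofBits [] = [] from rfl, letterAt_nil] at h0
      rw [digitsAt, h0, ih (p + d) [] fun i => (hs i).trans rfl]
      rfl
    | cons b l =>
      rw [letterAt_ofBits_cons_zero] at h0
      rw [digitsAt, h0, ih (p + d) l fun i => (hs i).trans (letterAt_ofBits_cons_succ b l i)]
      cases b <;> rfl

/-! ## Codes of integers and dyadic numbers -/

/-- The length of a code and the magnitude of the integer determine each other up to a bounded
factor. The lower bound comes from the absence of leading zeros; without it, the integer part of a
small number could be arbitrarily long. -/
theorem notationInt_cases {U : Str} {z : ℤ} (h : notationInt U = some z) :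
    (∃ l, U = ofBits l) ∧ |z| < 2 ^ U.length ∧
      (U.length ≤ 1 ∨ (2 : ℤ) ^ (U.length - 2) ≤ |z|) := by
  unfold notationInt at h
  cases hb : toBits U with
  | none => simp [hb] at h
  | some l =>
    obtain rfl := toBits_eq_some hb
    rw [length_ofBits]
    refine ⟨⟨l, rfl⟩, ?_⟩
    rw [hb] at h
    match l, h with
    | [], h =>
      obtain rfl : 0 = z := by simpa using h
      simp
    | [_], h =>
      obtain rfl : 0 = z := by simpa using h
      simp
    | b :: true :: t, h =>
      obtain rfl := Option.some.inj h
      have e : |(if b then -1 else 1) * (binVal (true :: t) : ℤ)| = binVal (true :: t) := by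
        cases b <;> simp
      rw [e, binVal_cons]
      have := binVal_lt t
      simp only [List.length_cons, Bool.toNat_true, one_mul]
      constructor
      · rw [pow_succ, pow_succ]
        push_cast
        have h2 : (binVal t : ℤ) < 2 ^ t.length := by exact_mod_cast this
        have h3 : (0 : ℤ) < 2 ^ t.length := by positivity
        linarith
      · right
        rw [show t.length + 1 + 1 - 2 = t.length by omega]
        push_cast
        have : (0 : ℤ) ≤ binVal t := by positivity
        linarith

/-- The sign that is encoded by the first letter. -/
def signOf (s : Str) : ℚ := if s.head? = some Letter.one then -1 else 1

theorem abs_signOf (s : Str) : |signOf s| = 1 := by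
  unfold signOf
  split_ifs <;> simp

/-- The sign is read off the first letter of the whole code. Writing it as `signOf (U ++
[Letter.sep])` covers an empty `U` and shows that the sign does not depend on the digits after the
point, so truncating them preserves it. -/
theorem notationDyadic_append {U : Str} {z : ℤ} {d : List Bool} (hz : notationInt U = some z)
    (hd : d.getLast? ≠ some false) :
    notationDyadic (U ++ Letter.sep :: ofBits d) =
      some (signOf (U ++ [Letter.sep]) * (|(z : ℚ)| + fracVal d)) := by
  obtain ⟨⟨l, rfl⟩, -⟩ := notationInt_cases hz
  rw [notationDyadic_code l d z hz hd, binVal_div]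
  rfl

theorem notationDyadic_eq_some {s : Str} {r : ℚ} (h : notationDyadic s = some r) :
    ∃ (U : Str) (d : List Bool) (z : ℤ), s = U ++ Letter.sep :: ofBits d ∧
      notationInt U = some z ∧ r = signOf (U ++ [Letter.sep]) * (|(z : ℚ)| + fracVal d) := by
  unfold notationDyadic at h
  have happ := List.takeWhile_append_dropWhile (p := fun x => decide (x ≠ Letter.sep)) (l := s)
  cases hd : s.dropWhile (· ≠ Letter.sep) with
  | nil =>
    rw [hd] at h
    cases h
  | cons x v =>
    have hx : x = Letter.sep := by
      have := List.head?_dropWhile_not (fun x => decide (x ≠ Letter.sep)) s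
      rw [hd] at this
      simpa using this
    subst hx
    rw [hd] at h happ
    simp only at h
    cases hz : notationInt (s.takeWhile (· ≠ Letter.sep)) with
    | none =>
      rw [hz] at h
      cases h
    | some z =>
      cases hv : toBits v with
      | none =>
        rw [hz, hv] at h
        cases h
      | some d =>
        rw [hz, hv] at h
        simp only at h
        by_cases hl : d.getLast? = some false
        · rw [if_pos hl] at h
          cases h
        rw [if_neg hl] at h
        obtain rfl := toBits_eq_some hv
        have hs : s.head? = (s.takeWhile (· ≠ Letter.sep) ++ [Letter.sep]).head? := by
          conv_lhs => rw [← happ]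
          cases s.takeWhile (· ≠ Letter.sep) <;> rfl
        refine ⟨_, d, z, happ.symm, hz, ?_⟩
        rw [signOf, ← hs, ← binVal_div]
        exact (Option.some.inj h).symm

theorem sep_not_mem_of_notationInt {U : Str} {z : ℤ} (h : notationInt U = some z) :
    Letter.sep ∉ U := by
  obtain ⟨⟨l, rfl⟩, -⟩ := notationInt_cases h
  exact sep_not_mem_ofBits l

theorem getLast?_append_true (l : List Bool) : (l ++ [true]).getLast? ≠ some false := by simp

/-- Truncating the digits of a dyadic number and appending the digit one yields an approximation. -/
theorem exists_notationDyadic_truncate {U : Str} {d : List Bool} {z : ℤ} {r : ℚ}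
    (hz : notationInt U = some z) (hr : r = signOf (U ++ [Letter.sep]) * (|(z : ℚ)| + fracVal d))
    (k : ℕ) : ∃ q, notationDyadic (U ++ [Letter.sep] ++ ofBits (truncate k d) ++ [Letter.one]) = some q ∧
      |q - r| ≤ (2 : ℚ)⁻¹ ^ (k + 1) := by
  have e : U ++ [Letter.sep] ++ ofBits (truncate k d) ++ [Letter.one]
      = U ++ Letter.sep :: ofBits (truncate k d ++ [true]) := by
    simp [ofBits]
  refine ⟨_, by rw [e, notationDyadic_append hz (getLast?_append_true _)], ?_⟩
  rw [hr, ← mul_sub, abs_mul, abs_signOf, one_mul, add_sub_add_left_eq_sub]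
  exact abs_fracVal_truncate k d

theorem abs_eq_of_signOf {U : Str} {d : List Bool} {z : ℤ} {r : ℚ}
    (hr : r = signOf (U ++ [Letter.sep]) * (|(z : ℚ)| + fracVal d)) :
    |r| = |(z : ℚ)| + fracVal d := by
  rw [hr, abs_mul, abs_signOf, one_mul, abs_of_nonneg]
  have := fracVal_nonneg d
  positivity

/-- Apart from the sign digit, a code of length at least two starts with a one, so the integer part
is at least `2 ^ (U.length - 2)`. -/
theorem length_le_of_abs_le {U : Str} {d : List Bool} {z : ℤ} {r : ℚ}
    (hz : notationInt U = some z) (hr : r = signOf (U ++ [Letter.sep]) * (|(z : ℚ)| + fracVal d))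
    {m : ℕ} (hm : |r| ≤ 2 ^ m) : U.length ≤ m + 2 := by
  rw [abs_eq_of_signOf hr] at hm
  have h0 := fracVal_nonneg d
  obtain ⟨-, -, h | h⟩ := notationInt_cases hz
  · omega
  · have h1 : (2 : ℚ) ^ (U.length - 2) ≤ |(z : ℚ)| := by exact_mod_cast h
    have h2 : (2 : ℚ) ^ (U.length - 2) ≤ 2 ^ m := by linarith
    have h3 := (pow_le_pow_iff_right₀ (by norm_num : (1 : ℚ) < 2)).1 h2
    omega

theorem abs_le_two_pow {U : Str} {d : List Bool} {z : ℤ} {r : ℚ}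
    (hz : notationInt U = some z) (hr : r = signOf (U ++ [Letter.sep]) * (|(z : ℚ)| + fracVal d)) :
    |r| ≤ 2 ^ U.length := by
  rw [abs_eq_of_signOf hr]
  obtain ⟨-, h, -⟩ := notationInt_cases hz
  have h1 : |z| + 1 ≤ 2 ^ U.length := h
  have h2 : |(z : ℚ)| + 1 ≤ 2 ^ U.length := by exact_mod_cast h1
  linarith [fracVal_le_one d]

/-! ## The tracks of a pair -/

/-- Within the shorter strings the tracks are spaced by three; after their end only the rest of `c`
follows, whence the shift of the index by `2 * a.length`. -/
theorem alternate_track (c a b : Str) : a.length = b.length → a.length ≤ c.length → ∀ i,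
    (i < a.length → (alternate c a b)[3 * i + 1]? = a[i]? ∧
      (alternate c a b)[3 * i + 2]? = b[i]?) ∧
    (a.length ≤ i → letterAt (alternate c a b) (3 * i + 1) =
        letterAt c (3 * i + 1 - 2 * a.length) ∧
      letterAt (alternate c a b) (3 * i + 2) = letterAt c (3 * i + 2 - 2 * a.length)) := by
  induction a generalizing b c with
  | nil =>
    intro h _ i
    obtain rfl : b = [] := by simpa using h.symm
    cases c <;> simp [alternate]
  | cons y a ih =>
    intro h h' i
    obtain ⟨z, b, rfl⟩ : ∃ z b', b = z :: b' := by
      cases b with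
      | nil => simp at h
      | cons z b => exact ⟨z, b, rfl⟩
    obtain ⟨x, c, rfl⟩ : ∃ x c', c = x :: c' := by
      cases c with
      | nil => simp at h'
      | cons x c => exact ⟨x, c, rfl⟩
    simp only [List.length_cons] at h h'
    rcases i with _ | i
    · simp [alternate]
    · have hi := ih c b (by omega) (by omega) i
      rw [alternate, show 3 * (i + 1) + 1 = 3 * i + 1 + 1 + 1 + 1 by ring,
        show 3 * (i + 1) + 2 = 3 * i + 2 + 1 + 1 + 1 by ring]
      simp only [List.getElem?_cons_succ, List.length_cons, letterAt_cons_succ]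
      refine ⟨fun hlt => hi.1 (by omega), fun hle => ?_⟩
      rw [(hi.2 (by omega)).1, (hi.2 (by omega)).2,
        show 3 * i + 1 + 1 + 1 + 1 - 2 * (a.length + 1) = (3 * i + 1 - 2 * a.length) + 1 by omega,
        show 3 * i + 2 + 1 + 1 + 1 - 2 * (a.length + 1) = (3 * i + 2 - 2 * a.length) + 1 by omega,
        letterAt_cons_succ, letterAt_cons_succ]
      exact ⟨rfl, rfl⟩

theorem letterAt_append_right (s t : Str) (i : ℕ) :
    letterAt (s ++ t) (s.length + i) = letterAt t i := by
  rw [letterAt, letterAt, List.getElem?_append_right (by omega), Nat.add_sub_cancel_left]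

theorem letterAt_append_left (s t : Str) {i : ℕ} (h : i < s.length) :
    letterAt (s ++ t) i = letterAt s i := by
  simp [letterAt, List.getElem?_append_left h]

theorem letterAt_replicate (n i : ℕ) : letterAt (List.replicate n .zero) i = .zero := by
  rw [letterAt, List.getElem?_replicate]
  split_ifs <;> rfl

theorem letterAt_pad (n : ℕ) (a : Str) (i : ℕ) : letterAt (pad n a) i = letterAt a i := by
  rcases lt_or_ge i a.length with h | h
  · rw [pad, letterAt_append_left _ _ h]
  · obtain ⟨j, rfl⟩ := Nat.exists_eq_add_of_le h
    rw [pad, letterAt_append_right, letterAt_replicate]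
    simp [letterAt]

theorem letterAt_control (a b : Str) {i : ℕ} (h : max a.length b.length + 1 ≤ i) :
    letterAt (control a b) i = .zero := by
  obtain ⟨j, rfl⟩ := Nat.exists_eq_add_of_le (show min a.length b.length + 1 ≤ i by omega)
  have hl : (List.replicate (min a.length b.length) Letter.one).length
      = min a.length b.length := by simp
  have h1 := letterAt_append_right (List.replicate (min a.length b.length) .one)
    (.zero :: (if b.length < a.length then Letter.one else Letter.zero) ::
      List.replicate (max a.length b.length - (min a.length b.length + 2)) .zero) (j + 1)
  rw [hl] at h1
  rw [control, show min a.length b.length + 1 + j = min a.length b.length + (j + 1) by omega, h1,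
    letterAt_cons_succ]
  -- This position holds the digit that compares the two lengths. It satisfies the hypothesis on `i`
  -- only if the lengths are equal, and then the digit is zero.
  rcases j with _ | j
  · have : ¬ b.length < a.length := by omega
    simp [letterAt, this]
  · rw [letterAt_cons_succ, letterAt_replicate]

/-- Valid for all `i`, also past the end of both strings: there the positions `3 * i + 1` and `3 * i
+ 2` fall into the end of the control string, where `letterAt_control` gives zeros. So the machine
may scan a fixed number of digits without knowing the lengths of the components. -/
theorem letterAt_pairStr (u v : Str) (i : ℕ) :
    letterAt (pairStr (u, v)) (3 * i + 1) = letterAt u i ∧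
      letterAt (pairStr (u, v)) (3 * i + 2) = letterAt v i := by
  have h1 := pad_length (max u.length v.length) u (le_max_left _ _)
  have h2 := pad_length (max u.length v.length) v (le_max_right _ _)
  have h3 := control_length u v
  have h := alternate_track (control u v) (pad (max u.length v.length) u)
    (pad (max u.length v.length) v) (by omega) (by omega) i
  rw [← letterAt_pad (max u.length v.length) u i, ← letterAt_pad (max u.length v.length) v i]
  simp only [pairStr]
  by_cases hi : i < (pad (max u.length v.length) u).length
  · simp only [letterAt, h.1 hi, and_self]
  · have hu : letterAt (pad (max u.length v.length) u) i = .zero := by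
      rw [letterAt, List.getElem?_eq_none (by omega)]
      rfl
    have hv : letterAt (pad (max u.length v.length) v) i = .zero := by
      rw [letterAt, List.getElem?_eq_none (by omega)]
      rfl
    rw [(h.2 (by omega)).1, (h.2 (by omega)).2, hu, hv]
    exact ⟨letterAt_control u v (by omega), letterAt_control u v (by omega)⟩

/-- The version for genuine letters, needed to copy the integer part and its separator, where a
blank must not pass for a zero. -/
theorem getElem?_pairStr (u v : Str) {i : ℕ} (hi : i < u.length) :
    (pairStr (u, v))[1 + 3 * i]? = u[i]? := by
  have h1 := pad_length (max u.length v.length) u (le_max_left _ _)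
  have h2 := pad_length (max u.length v.length) v (le_max_right _ _)
  have h3 := control_length u v
  have h := alternate_track (control u v) (pad (max u.length v.length) u)
    (pad (max u.length v.length) v) (by omega) (by omega) i
  rw [add_comm]
  exact ((h.1 (by omega)).1).trans (List.getElem?_append_left hi)

/-! ## The radius of a coded interval -/

theorem notationInterval_eq_some {s : Str} {r ε : ℚ}
    (h : notationInterval s = some (.finite r ε)) : ∃ u v, s = pairStr (u, v) ∧
      notationDyadic u = some r ∧ notationDyadic v = some ε ∧ 0 ≤ ε := by
  classical
  unfold notationInterval at h
  split_ifs at h with hs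
  · simp at h
  · cases hp : Function.partialInv pairStr s with
    | none => simp [hp] at h
    | some uv =>
      obtain ⟨u, v⟩ := uv
      have hs : pairStr (u, v) = s :=
        (pairStr_injective.isPartialInv _ _).1 hp
      rw [hp] at h
      simp only at h
      cases hu : notationDyadic u with
      | none => simp [hu] at h
      | some r' =>
        cases hv : notationDyadic v with
        | none => simp [hu, hv] at h
        | some ε' =>
          rw [hu, hv] at h
          simp only at h
          split_ifs at h with h0
          simp only [Option.some.injEq, Interval.finite.injEq] at h
          exact ⟨u, v, hs.symm, by rw [hu, h.1], by rw [hv, h.2], h.2 ▸ h0⟩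

theorem eq_nil_of_notationInterval {s : Str} (h : notationInterval s = some .infinite) :
    s = [] := by
  classical
  unfold notationInterval at h
  by_contra hs
  rw [if_neg hs] at h
  split at h
  · simp at h
  · split at h
    · split_ifs at h
      simp at h
    · simp at h

theorem not_smallRadius_nil (k : ℕ) : ¬ SmallRadius [] k := by
  simp [SmallRadius, letterAt]

/-- The test on the second track, in terms of the code of the radius. -/
theorem smallRadius_pairStr (u v : Str) (k : ℕ) : SmallRadius (pairStr (u, v)) k ↔
    (letterAt v 0 = .sep ∧ ∀ i < k, letterAt v (i + 1) = .zero) ∨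
      (letterAt v 0 ≠ .sep ∧ letterAt v 1 = .sep ∧ ∀ i < k, letterAt v (i + 2) = .zero) := by
  have h := fun i => (letterAt_pairStr u v i).2
  have h5 : ∀ i, letterAt (pairStr (u, v)) (5 + 3 * i) = letterAt v (i + 1) := fun i => by
    rw [← h (i + 1)]
    congr 1
    ring
  have h8 : ∀ i, letterAt (pairStr (u, v)) (8 + 3 * i) = letterAt v (i + 2) := fun i => by
    rw [← h (i + 2)]
    congr 1
    ring
  have h50 := h5 0
  have h20 := h 0
  simp only [mul_zero, zero_add, add_zero] at h50 h20
  simp only [SmallRadius, ZerosAt, h5, h8, h50, h20]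

/-- An integer code contains no separator, so its length is at most one exactly if the separator
stands in position `0` or `1` of the dyadic code. These are the two positions that the machine
inspects. -/
theorem smallRadius_iff_of_code {u U : Str} {d : List Bool} {z : ℤ} (hz : notationInt U = some z)
    (k : ℕ) : SmallRadius (pairStr (u, U ++ Letter.sep :: ofBits d)) k ↔
      U.length ≤ 1 ∧ ∀ i < k, letterAt (ofBits d) i = .zero := by
  rw [smallRadius_pairStr]
  have hsep := sep_not_mem_of_notationInt hz
  match U, hsep with
  | [], _ =>
    simp only [List.nil_append, letterAt_cons_succ]
    simp [letterAt]
  | [x], hsep =>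
    have hx : x ≠ Letter.sep := by simpa [eq_comm] using hsep
    simp only [List.cons_append, List.nil_append, letterAt_cons_succ]
    simp [letterAt, hx]
  | x :: y :: U, hsep =>
    simp only [List.mem_cons, not_or] at hsep
    have h1 : ¬ (x :: y :: U).length ≤ 1 := by simp
    simp only [h1, false_and, iff_false]
    simp [letterAt, Ne.symm hsep.1, Ne.symm hsep.2.1]

/-- Soundness of the test: an integer code of length at most one means zero, and leading zeros bound
the fraction. -/
theorem SmallRadius.le {u v : Str} {ε : ℚ} {k : ℕ} (hv : notationDyadic v = some ε)
    (h : SmallRadius (pairStr (u, v)) k) : ε ≤ (2 : ℚ)⁻¹ ^ k := by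
  obtain ⟨U, d, z, rfl, hz, hε⟩ := notationDyadic_eq_some hv
  obtain ⟨hU, hd⟩ := (smallRadius_iff_of_code hz k).1 h
  have hz0 : |z| = 0 := by
    obtain ⟨⟨l, rfl⟩, -⟩ := notationInt_cases hz
    rw [length_ofBits] at hU
    match l, hU with
    | [], _ => simpa [notationInt, ofBits, toBits, eq_comm] using hz
    | [b], _ => cases b <;> simpa [notationInt, ofBits, toBits, eq_comm] using hz
  have h1 := abs_eq_of_signOf hε
  rw [show |(z : ℚ)| = 0 by exact_mod_cast hz0, zero_add] at h1
  exact (le_abs_self ε).trans (h1 ▸ fracVal_le_of_zeros k d hd)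

/-- Completeness of the test, with a strict inequality. A radius below one has integer part zero,
and a longer integer code would force the integer part to be at least one. -/
theorem smallRadius_of_lt {u v : Str} {ε : ℚ} {k : ℕ} (hv : notationDyadic v = some ε)
    (h0 : 0 ≤ ε) (h : ε < (2 : ℚ)⁻¹ ^ k) : SmallRadius (pairStr (u, v)) k := by
  obtain ⟨U, d, z, rfl, hz, hε⟩ := notationDyadic_eq_some hv
  rw [smallRadius_iff_of_code hz]
  have h1 := abs_eq_of_signOf hε
  rw [abs_of_nonneg h0] at h1
  have h2 := fracVal_nonneg d
  have h3 : (2 : ℚ)⁻¹ ^ k ≤ 1 := pow_le_one₀ (by norm_num) (by norm_num)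
  constructor
  · obtain ⟨-, -, h4 | h4⟩ := notationInt_cases hz
    · exact h4
    · have h5 : (2 : ℚ) ^ (U.length - 2) ≤ |(z : ℚ)| := by exact_mod_cast h4
      have h6 : (1 : ℚ) ≤ 2 ^ (U.length - 2) := one_le_pow₀ (by norm_num)
      linarith
  · have : 0 ≤ |(z : ℚ)| := abs_nonneg _
    exact zeros_of_fracVal_lt k d (by linarith)

/-! ## The interleaved output -/

/-- The code of `2 ^ (-(n + 1))`. -/
def codeRadius (n : ℕ) : Str := Letter.sep :: List.replicate n .zero ++ [Letter.one]

theorem length_codeRadius (n : ℕ) : (codeRadius n).length = n + 2 := by simp [codeRadius]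

theorem fracVal_replicate (n : ℕ) :
    fracVal (List.replicate n false ++ [true]) = (2 : ℚ)⁻¹ ^ (n + 1) := by
  induction n with
  | zero => simp [fracVal]
  | succ n ih =>
    rw [List.replicate_succ, List.cons_append, fracVal, ih, pow_succ _ (n + 1)]
    simp only [Bool.toNat_false, Nat.cast_zero]
    ring

theorem notationDyadic_codeRadius (n : ℕ) :
    notationDyadic (codeRadius n) = some ((2 : ℚ)⁻¹ ^ (n + 1)) := by
  have e : codeRadius n = [] ++ Letter.sep :: ofBits (List.replicate n false ++ [true]) := by
    simp [codeRadius, ofBits]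
  rw [e, notationDyadic_append (z := 0) rfl (getLast?_append_true _), fracVal_replicate]
  simp [signOf]

theorem interleave_nil (w : Str) : interleave [] w =
    alternate (List.replicate w.length .zero) w (List.replicate w.length .zero) := by
  induction w with
  | nil => simp [interleave, alternate]
  | cons x w ih => simp [interleave, ih, List.replicate_succ, alternate]

theorem interleave_eq (R : List Mark) (w : Str) (h : R.length ≤ w.length) : interleave R w =
    alternate (R.map Mark.control ++ List.replicate (w.length - R.length) .zero) w
      (R.map Mark.radius ++ List.replicate (w.length - R.length) .zero) := by
  induction R generalizing w with
  | nil => simpa using interleave_nil w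
  | cons m R ih =>
    cases w with
    | nil => simp at h
    | cons x w => simp [interleave, alternate, ih w (by simpa using h)]

/-- The first `n + 2` marks give as many ones as the radius code has letters, and the two control
marks give the zero and the digit saying that `w` is the longer string. The control string, like the
padded radius, continues with zeros, which is what `interleave` inserts after the end of the ruler.
-/
theorem interleave_ruler (n : ℕ) (w : Str) (h : n + 4 ≤ w.length) :
    interleave (ruler n) w = pairStr (w, codeRadius n) := by
  rw [interleave_eq _ _ (by rw [length_ruler]; exact h), length_ruler, pairStr]
  simp only [length_codeRadius]
  rw [max_eq_left (by omega)]
  congr 1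
  · rw [control, length_codeRadius, min_eq_right (by omega), max_eq_left (by omega), if_pos (by omega)]
    simp only [ruler, List.map_append, List.map_cons, List.map_replicate, List.map_nil, Mark.control]
    have e : List.replicate (n + 2) Letter.one
        = Letter.one :: List.replicate n .one ++ [Letter.one] := by
      rw [List.cons_append, ← List.replicate_succ', ← List.replicate_succ]
    have e' : w.length - (n + 2) - 2 = w.length - (n + 4) := by omega
    have e'' : List.replicate (w.length - (n + 2 + 2)) Letter.zero =
      List.replicate (w.length - (n + 4)) .zero := by congr 1
    rw [e, e'']
    simp
  · simp [pad]
  · rw [pad, length_codeRadius, show w.length - (n + 2) = (w.length - (n + 4)) + 1 + 1 by omega,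
      List.replicate_succ, List.replicate_succ]
    simp [ruler, codeRadius, Mark.radius]

end ParamSpace

namespace ParamSpace

open Translate

/-! ## Reading names -/

/-- A name of a real number; the flag says whether it is a name of the interval reals. -/
def IsNameOf (inI : Bool) (φ : Baire) (x : ℝ) : Prop :=
  if inI then IsIntervalName φ x else IsCauchyName φ x

/-- The parameter of a name of `x`. -/
noncomputable def rate (inI : Bool) (φ : Baire) (x : ℝ) (n : ℕ) : ℕ :=
  if inI then convergenceRate φ n + ⌈Real.logb 2 (|x| + 1)⌉₊ else size φ n

/-- The search for an answer of precision `2 ^ (-n)` ends after `t` rejections, and the centre of the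
accepted answer `s` has the integer part `U` and the digits `d` after the point. -/
structure IsAnswer (inI : Bool) (φ : Baire) (x : ℝ) (n t : ℕ) (U : Str) (d : List Bool) (s : Str) :
    Prop where
  answer_eq : φ (codeTwoPow (n + t)) = s
  rejects : ∀ j < t, ¬ Accepts inI (φ (codeTwoPow (n + j))) n
  accepts : Accepts inI (φ (codeTwoPow (n + t))) n
  intPart : ∀ j < U.length, s[offset inI + stride inI * j]? = U[j]?
  point : s[offset inI + stride inI * U.length]? = some Letter.sep
  digits : ∀ i, letterAt s (offset inI + stride inI * (U.length + 1) + stride inI * i) =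
    letterAt (ofBits d) i
  near : ∃ (z : ℤ) (r : ℚ), notationInt U = some z ∧
    r = signOf (U ++ [Letter.sep]) * (|(z : ℚ)| + fracVal d) ∧ |(r : ℝ) - x| ≤ (2 : ℝ)⁻¹ ^ n

theorem letterAt_code_digits (U : Str) (d : List Bool) (i : ℕ) :
    letterAt (U ++ Letter.sep :: ofBits d) (U.length + 1 + i) = letterAt (ofBits d) i := by
  rw [add_assoc, letterAt_append_right, add_comm, letterAt_cons_succ]

theorem getElem?_code_left (U : Str) (v : Str) {j : ℕ} (h : j < U.length) :
    (U ++ Letter.sep :: v)[j]? = U[j]? := List.getElem?_append_left h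

theorem getElem?_code_sep (U : Str) (v : Str) :
    (U ++ Letter.sep :: v)[U.length]? = some Letter.sep := by simp

/-- No search is needed, and the integer part is part of the answer to a query of length `n + 2`, so
the size function bounds it. -/
theorem exists_isAnswer_false {φ : Baire} {x : ℝ} (h : IsCauchyName φ x) (n : ℕ) :
    ∃ U d s, IsAnswer false φ x n 0 U d s ∧ U.length ≤ size φ (n + 2) := by
  obtain ⟨q, hq, hx⟩ := h
  obtain ⟨U, d, z, hs, hz, hr⟩ := notationDyadic_eq_some (hq n _ (notationInt_codeTwoPow n))
  refine ⟨U, d, _, ⟨rfl, by simp, by simp [Accepts], ?_, ?_, ?_, z, _, hz, hr, hx n⟩, ?_⟩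
  · intro j hj
    simp only [offset, stride, Bool.false_eq_true, if_false, zero_add, one_mul, add_zero]
    rw [hs, getElem?_code_left _ _ hj]
  · simp only [offset, stride, Bool.false_eq_true, if_false, zero_add, one_mul, add_zero]
    rw [hs, getElem?_code_sep]
  · intro i
    simp only [offset, stride, Bool.false_eq_true, if_false, zero_add, one_mul, add_zero]
    rw [hs, letterAt_code_digits]
  · have h1 := length_le_size φ (length_codeTwoPow n).le
    rw [hs] at h1
    simp only [List.length_append] at h1
    omega

theorem Interval.not_univ_subset_Icc (a b : ℝ) : ¬ (Set.univ ⊆ Set.Icc a b) := by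
  intro h
  have := (h (Set.mem_univ (b + 1))).2
  linarith

/-- Nestedness makes a bound on the length persist: no later interval can be infinite, and the radii
do not increase. This is needed because the search starts at the entry `n` and not at `0`. -/
theorem exists_finite_of_rate {φ : Baire} {J : ℕ → Interval} (hJ : Encodes notationInterval φ J)
    (hnest : ∀ n, (J (n + 1)).toSet ⊆ (J n).toSet) {N : ℕ} {δ : ℚ}
    (hN : (J N).diam ≤ ((δ : ℚ) : WithTop ℚ)) (j : ℕ) :
    ∃ r ε, J (N + j) = .finite r ε ∧ 2 * ε ≤ δ := by
  have hnonneg : ∀ k r ε, J k = .finite r ε → 0 ≤ ε := by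
    intro k r ε h
    have h1 := hJ k _ (notationInt_codeTwoPow k)
    rw [h] at h1
    obtain ⟨-, -, -, -, -, h0⟩ := notationInterval_eq_some h1
    exact h0
  induction j with
  | zero =>
    rw [add_zero]
    cases hc : J N with
    | infinite => simp [hc, Interval.diam] at hN
    | finite r ε =>
      rw [hc] at hN
      exact ⟨r, ε, rfl, WithTop.coe_le_coe.1 hN⟩
  | succ j ih =>
    obtain ⟨r, ε, h1, h2⟩ := ih
    have hsub := hnest (N + j)
    rw [h1] at hsub
    rw [← add_assoc]
    cases hc : J (N + j + 1) with
    | infinite =>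
      rw [hc] at hsub
      exact absurd hsub (Interval.not_univ_subset_Icc _ _)
    | finite r' ε' =>
      rw [hc] at hsub
      have h0 := hnonneg _ _ _ hc
      have h0' : (0 : ℝ) ≤ ε' := by exact_mod_cast h0
      simp only [Interval.toSet] at hsub
      -- Comparing the endpoints requires the inner interval to be nonempty, hence the nonnegativity
      -- of coded radii.
      rw [Set.Icc_subset_Icc_iff (by linarith)] at hsub
      have h3 : (ε' : ℝ) ≤ ε := by linarith [hsub.1, hsub.2]
      have h4 : ε' ≤ ε := by exact_mod_cast h3
      exact ⟨r', ε', rfl, by linarith⟩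

theorem abs_add_one_le_two_pow (x : ℝ) : |x| + 1 ≤ 2 ^ ⌈Real.logb 2 (|x| + 1)⌉₊ := by
  have h := Nat.le_ceil (Real.logb 2 (|x| + 1))
  rw [Real.logb_le_iff_le_rpow (by norm_num) (by positivity), Real.rpow_natCast] at h
  exact h

theorem ceil_logb_le {x : ℝ} {m : ℕ} (h : |x| + 1 ≤ 2 ^ m) : ⌈Real.logb 2 (|x| + 1)⌉₊ ≤ m := by
  rw [Nat.ceil_le, Real.logb_le_iff_le_rpow (by norm_num) (by positivity), Real.rpow_natCast]
  exact h

/-- The two summands of the parameter play separate roles: the rate of convergence bounds the number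
of rejections, the logarithm bounds the length of the integer part. -/
theorem exists_isAnswer_true {φ : Baire} {x : ℝ} (h : IsIntervalName φ x) (n : ℕ) :
    ∃ t U d s, IsAnswer true φ x n t U d s ∧ t ≤ convergenceRate φ n ∧
      U.length ≤ ⌈Real.logb 2 (|x| + 1)⌉₊ + 2 := by
  classical
  obtain ⟨J, hJ, hnest, hx⟩ := h
  have hcode : ∀ k, notationInterval (φ (codeTwoPow k)) = some (J k) := fun k =>
    hJ k _ (notationInt_codeTwoPow k)
  obtain ⟨N, hN, hdiam⟩ : ∃ N ≤ convergenceRate φ n,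
      (J N).diam ≤ (((2 : ℚ)⁻¹ ^ n : ℚ) : WithTop ℚ) := by
    obtain ⟨N, hN⟩ := exists_diam_le J x hnest hx n
    obtain ⟨J', hJ', h⟩ := Nat.sInf_mem (s := {N | ∃ J : ℕ → Interval,
      Encodes notationInterval φ J ∧ (J N).diam ≤ (((2 : ℚ)⁻¹ ^ n : ℚ) : WithTop ℚ)})
      ⟨N, J, hJ, hN⟩
    obtain rfl := hJ.unique hJ'
    exact ⟨convergenceRate φ n, le_rfl, h⟩
  -- The entry `n + N` follows the entry `N` of length at most `2 ^ (-n)`, so its radius is at most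
  -- half of that. The factor two supplies the strict inequality that the completeness of the test
  -- needs.
  have hacc : SmallRadius (φ (codeTwoPow (n + N))) n := by
    obtain ⟨r, ε, h1, h2⟩ := exists_finite_of_rate hJ hnest hdiam n
    rw [add_comm] at h1
    have h3 := hcode (n + N)
    rw [h1] at h3
    obtain ⟨u, v, hs, -, hv, h0⟩ := notationInterval_eq_some h3
    rw [hs]
    have hp : (0 : ℚ) < 2⁻¹ ^ n := by positivity
    exact smallRadius_of_lt hv h0 (by linarith)
  have hex : ∃ t, SmallRadius (φ (codeTwoPow (n + t))) n := ⟨N, hacc⟩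
  set t := Nat.find hex with ht
  have hsmall : SmallRadius (φ (codeTwoPow (n + t))) n := Nat.find_spec hex
  have hxm : x ∈ (J (n + t)).toSet :=
    Set.mem_iInter.1 (hx.symm ▸ Set.mem_singleton x : x ∈ ⋂ n, (J n).toSet) _
  cases hc : J (n + t) with
  -- The infinite interval is coded by the empty string, where the test finds no separator.
  | infinite =>
    have h3 := hcode (n + t)
    rw [hc] at h3
    rw [eq_nil_of_notationInterval h3] at hsmall
    exact absurd hsmall (not_smallRadius_nil n)
  | finite r ε =>
    have h3 := hcode (n + t)
    rw [hc] at h3 hxm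
    obtain ⟨u, v, hs, hu, hv, h0⟩ := notationInterval_eq_some h3
    obtain ⟨U, d, z, rfl, hz, hr⟩ := notationDyadic_eq_some hu
    have hε : (ε : ℝ) ≤ (2 : ℝ)⁻¹ ^ n := by
      have h1 := SmallRadius.le hv (hs ▸ hsmall)
      have h2 : ((ε : ℚ) : ℝ) ≤ (((2 : ℚ)⁻¹ ^ n : ℚ) : ℝ) := Rat.cast_le.2 h1
      push_cast at h2
      exact h2
    have hnear : |(r : ℝ) - x| ≤ (2 : ℝ)⁻¹ ^ n := by
      simp only [Interval.toSet, Set.mem_Icc] at hxm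
      rw [abs_le]
      constructor <;> linarith
    have hlen : (U ++ Letter.sep :: ofBits d).length = U.length + 1 + (ofBits d).length := by
      simp only [List.length_append, List.length_cons]
      omega
    refine ⟨t, U, d, _, ⟨rfl, ?_, fun _ => hsmall, ?_, ?_, ?_, z, r, hz, hr, hnear⟩,
      (Nat.find_min' hex hacc).trans hN, ?_⟩
    · intro j hj hcon
      exact Nat.find_min hex hj (hcon rfl)
    · intro j hj
      simp only [offset, stride, if_true]
      rw [hs, getElem?_pairStr _ _ (by omega), getElem?_code_left _ _ hj]
    · simp only [offset, stride, if_true]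
      rw [hs, getElem?_pairStr _ _ (by omega), getElem?_code_sep]
    · intro i
      simp only [offset, stride, if_true]
      rw [hs, show 1 + 3 * (U.length + 1) + 3 * i = 3 * (U.length + 1 + i) + 1 by ring,
        (letterAt_pairStr _ _ _).1, letterAt_code_digits]
    -- The accepted radius is at most one, so `|r| ≤ |x| + 1`; this is why the parameter contains
    -- the logarithm of `|x| + 1`.
    · apply length_le_of_abs_le hz hr
      have h1 := abs_add_one_le_two_pow x
      have h2 : (2 : ℝ)⁻¹ ^ n ≤ 1 := pow_le_one₀ (by norm_num) (by norm_num)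
      have h3 : |(r : ℝ)| ≤ |x| + 1 := by
        have := abs_sub_abs_le_abs_sub (r : ℝ) x
        linarith
      have h4 : |(r : ℝ)| ≤ 2 ^ ⌈Real.logb 2 (|x| + 1)⌉₊ := h3.trans h1
      exact_mod_cast h4

theorem exists_isAnswer {inI : Bool} {φ : Baire} {x : ℝ} (h : IsNameOf inI φ x) (n : ℕ) :
    ∃ t U d s, IsAnswer inI φ x n t U d s ∧ t ≤ rate inI φ x n ∧
      U.length ≤ rate inI φ x (n + 2) + 2 := by
  cases inI with
  | false =>
    obtain ⟨U, d, s, h1, h2⟩ := exists_isAnswer_false h n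
    exact ⟨0, U, d, s, h1, Nat.zero_le _, h2.trans (Nat.le_add_right _ _)⟩
  | true =>
    obtain ⟨t, U, d, s, h1, h2, h3⟩ := exists_isAnswer_true h n
    refine ⟨t, U, d, s, h1, h2.trans (Nat.le_add_right _ _), h3.trans ?_⟩
    simp only [rate, if_true]
    omega

theorem ofGraph_fn_eq {X : Type} {N : Baire → X → Prop}
    (hN : ∀ φ x y, N φ x → N φ y → x = y) {φ : Baire} {x : X} (h : N φ x)
    (hd : φ ∈ (ofGraph N).Dom) : (ofGraph N).fn φ hd = x :=
  hN _ _ _ ((mem_ofGraph hN φ _).1 ⟨hd, rfl⟩) h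

/-- The space of interval reals or of Cauchy reals. -/
noncomputable def space (inI : Bool) : PreparametrisedSpace ℝ :=
  if inI then intervalReals else cauchyReals

theorem mem_space_rep {inI : Bool} {φ : Baire} {x : ℝ} :
    x ∈ (space inI).rep φ ↔ IsNameOf inI φ x := by
  cases inI with
  | false => exact mem_ofGraph IsCauchyName.unique φ x
  | true => exact mem_ofGraph IsIntervalName.unique φ x

theorem space_param {inI : Bool} {x : ℝ} (φ : (space inI).rep.Dom)
    (h : IsNameOf inI φ x) : (space inI).param φ = rate inI φ x := by
  cases inI with
  | false => rfl
  | true =>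
    funext n
    exact congrArg (fun y : ℝ => convergenceRate φ n + ⌈Real.logb 2 (|y| + 1)⌉₊)
      (ofGraph_fn_eq IsIntervalName.unique h φ.2)

theorem rate_monotone {inI : Bool} {φ : Baire} {x : ℝ} (h : IsNameOf inI φ x) :
    Monotone (rate inI φ x) := by
  have hx := mem_space_rep.2 h
  let φ' : (space inI).rep.Dom := ⟨φ, hx.1⟩
  rw [← space_param φ' h]
  exact (space inI).param_monotone φ'

/-! ## Computing names -/

theorem eq_replicate_of_binVal_eq_zero {l : List Bool} (h : binVal l = 0) :
    l = List.replicate l.length false := by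
  induction l with
  | nil => rfl
  | cons b l ih =>
    rw [binVal_cons] at h
    have h1 : binVal l = 0 := by omega
    have h2 : b.toNat * 2 ^ l.length = 0 := by omega
    have hb : b = false := by
      cases b with
      | false => rfl
      | true => simp at h2
    rw [List.length_cons, List.replicate_succ, ← ih h1, hb]

/-- Binary expansions without leading zeros are unique, and the sign digit of a positive number is
zero. So a name need only be checked on the strings `codeTwoPow n`, whose length reveals `n`. -/
theorem eq_codeTwoPow {a : Str} {n : ℕ} (h : notationInt a = some (2 ^ n)) :
    a = codeTwoPow n := by
  have hp : (0 : ℤ) < 2 ^ n := by positivity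
  unfold notationInt at h
  cases hb : toBits a with
  | none => simp [hb] at h
  | some l =>
    obtain rfl := toBits_eq_some hb
    rw [hb] at h
    match l, h with
    | [], h =>
      have := Option.some.inj h
      omega
    | [_], h =>
      have := Option.some.inj h
      omega
    | b :: true :: t, h =>
      have h1 := Option.some.inj h
      cases b with
      | true =>
        have : (0 : ℤ) ≤ binVal (true :: t) := by positivity
        simp only [if_true] at h1
        omega
      | false =>
        have h2 : ((binVal (true :: t) : ℕ) : ℤ) = ((2 ^ n : ℕ) : ℤ) := by simpa using h1
        have h3 : binVal (true :: t) = 2 ^ n := by exact_mod_cast h2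
        rw [binVal_cons] at h3
        simp only [Bool.toNat_true, one_mul] at h3
        have hlt := binVal_lt t
        have h4 : t.length = n := by
          have h5 : 2 ^ t.length ≤ 2 ^ n := by omega
          have h6 : 2 ^ n < 2 ^ (t.length + 1) := by rw [pow_succ]; omega
          have h7 := (Nat.pow_le_pow_iff_right (by norm_num)).1 h5
          have h8 := (Nat.pow_lt_pow_iff_right (by norm_num)).1 h6
          omega
        rw [h4] at h3
        have h5 := eq_replicate_of_binVal_eq_zero (l := t) (by omega)
        rw [h4] at h5
        rw [h5]
        simp [ofBits, codeTwoPow]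

/-- The function `w` maps strings of length `n` to codes of approximations of `x`. -/
def Approximates (w : Baire) (x : ℝ) : Prop :=
  ∀ a : Str, a.length + 4 ≤ (w a).length ∧ ∃ q : ℚ, notationDyadic (w a) = some q ∧
    |(q : ℝ) - x| ≤ 2 * (2 : ℝ)⁻¹ ^ (a.length + 4)

theorem Approximates.isCauchyName {w : Baire} {x : ℝ} (h : Approximates w x) :
    IsCauchyName w x := by
  choose q hq hx using fun n => (h (codeTwoPow n)).2
  refine ⟨q, fun n a ha => by rw [eq_codeTwoPow ha, hq], fun n => (hx n).trans ?_⟩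
  rw [length_codeTwoPow, pow_add, pow_add]
  have : (0 : ℝ) < 2⁻¹ ^ n := by positivity
  norm_num
  linarith

theorem Approximates.isIntervalName {w : Baire} {x : ℝ} (h : Approximates w x) :
    IsIntervalName (fun a => result true a.length (w a)) x ∧
      ∀ n, convergenceRate (fun a => result true a.length (w a)) n ≤ n := by
  choose q hq hx using fun n => (h (codeTwoPow n)).2
  -- The input `codeTwoPow n` has length `n + 2`, so the ruler produces the radius `2 ^ (-(n + 3))`,
  -- while the centre is off by at most `2 * 2 ^ (-(n + 6))`.
  set J : ℕ → Interval := fun n => .finite (q n) (2⁻¹ ^ (n + 3)) with hJ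
  have hJe : Encodes notationInterval (fun a => result true a.length (w a)) J := by
    intro n a ha
    obtain rfl := eq_codeTwoPow ha
    simp only [result, if_true]
    rw [interleave_ruler _ _ (h _).1]
    have h1 := notationInterval_pairStr _ _ _ _ (hq n)
      (notationDyadic_codeRadius (codeTwoPow n).length) (by positivity)
    rw [h1, length_codeTwoPow]
  have hε : ∀ n, (((2⁻¹ ^ (n + 3) : ℚ)) : ℝ) = 2⁻¹ ^ n / 8 := by
    intro n
    push_cast
    rw [pow_add]
    norm_num
    ring
  have hx' : ∀ n, |(q n : ℝ) - x| ≤ 2⁻¹ ^ n / 32 := by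
    intro n
    refine (hx n).trans (le_of_eq ?_)
    rw [length_codeTwoPow, pow_add, pow_add]
    norm_num
    ring
  have hpos : ∀ n, (0 : ℝ) < (2 : ℝ)⁻¹ ^ n := fun n => by positivity
  refine ⟨⟨J, hJe, ?_, ?_⟩, ?_⟩
  · intro n
    have h1 := abs_le.1 (hx' n)
    have h2 := abs_le.1 (hx' (n + 1))
    have h3 := hpos n
    simp only [hJ, Interval.toSet]
    -- In units of `2 ^ (-n)`, consecutive centres differ by at most `1/32 + 1/64`, and the radius
    -- shrinks by `1/8 - 1/16`.
    apply Set.Icc_subset_Icc <;> rw [hε, hε, pow_succ] <;> rw [pow_succ] at h2 <;> linarith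
  · ext y
    simp only [hJ, Interval.toSet, Set.mem_iInter, Set.mem_Icc, Set.mem_singleton_iff]
    constructor
    · intro hy
      have hb : ∀ n, |y - x| ≤ (2 : ℝ)⁻¹ ^ n := by
        intro n
        have h1 := abs_le.1 (hx' n)
        have h2 := hy n
        have h3 := hpos n
        rw [hε] at h2
        rw [abs_le]
        constructor <;> linarith
      have h0 := ge_of_tendsto' (tendsto_pow_atTop_nhds_zero_of_lt_one (r := (2 : ℝ)⁻¹)
        (by norm_num) (by norm_num)) hb
      have := abs_nonpos_iff.1 h0
      linarith
    · rintro rfl n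
      have h1 := abs_le.1 (hx' n)
      have h2 := hpos n
      rw [hε]
      constructor <;> linarith
  · intro n
    refine Nat.sInf_le ⟨J, hJe, ?_⟩
    simp only [hJ, Interval.diam]
    rw [WithTop.coe_le_coe, pow_add]
    have : (0 : ℚ) < 2⁻¹ ^ n := by positivity
    norm_num
    linarith

/-- For Cauchy names: the approximation `r` with error at most one has an integer part of length at
most `s = size φ 2`, so `|x| + 1 ≤ 2 ^ s + 2 ≤ 2 ^ (s + 2)`. Hence the logarithmic summand of an
interval name can be controlled from a Cauchy name. -/
theorem ceil_logb_le_rate {inI : Bool} {φ : Baire} {x : ℝ} (h : IsNameOf inI φ x) :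
    ⌈Real.logb 2 (|x| + 1)⌉₊ ≤ rate inI φ x 2 + 2 := by
  cases inI with
  | true =>
    simp only [rate, if_true]
    omega
  | false =>
    obtain ⟨U, d, s, h1, h2⟩ := exists_isAnswer_false h 0
    obtain ⟨z, r, hz, hr, hx⟩ := h1.near
    change _ ≤ size φ 2 + 2
    apply ceil_logb_le
    have h3 := abs_le_two_pow hz hr
    have h4 : |(r : ℝ)| ≤ 2 ^ U.length := by exact_mod_cast h3
    have h5 : (2 : ℝ) ^ U.length ≤ 2 ^ size φ 2 := pow_le_pow_right₀ (by norm_num) h2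
    have h6 : (1 : ℝ) ≤ 2 ^ size φ 2 := one_le_pow₀ (by norm_num)
    have h7 := abs_sub_abs_le_abs_sub x (r : ℝ)
    rw [abs_sub_comm x] at h7
    simp only [pow_zero] at hx
    rw [pow_add]
    linarith

theorem OracleMachine.Reaches.imp {M : OracleMachine} {φ : Baire} {D D' : M.Cfg → Prop} {t : ℕ}
    {c c' : M.Cfg} (h : M.Reaches φ D t c c') (hD : ∀ c, D c → D' c) : M.Reaches φ D' t c c' := by
  induction h with
  | refl t c => exact .refl _ _
  | head hc _ ih => exact .head (hD _ hc) ih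

theorem Translate.Disciplined.mono {M : OracleMachine} {φ : Baire} {B B' : ℕ} (hB : B ≤ B')
    {c : M.Cfg} (h : Disciplined φ B c) : Disciplined φ B' c := by
  intro hc
  obtain ⟨q, s, h1, h2, h3, h4⟩ := h hc
  exact ⟨q, s, h1, h2.trans hB, h3, h4.trans (size_monotone φ hB)⟩

/-- The bound on the running time of the machine, in terms of the parameter. -/
def timeBound (l : ℕ → ℕ) (n : ℕ) : ℕ := 100 * ((l (n + 6) + 1) * (n + l (n + 6) + 7))

/-- The bound on the parameter of the computed name and on the length of queries. -/
def paramBound (l : ℕ → ℕ) (n : ℕ) : ℕ := l (n + 6) + n + 8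

/-- On every name `φ` of a real number, the machine computes another name. -/
theorem exists_translation (inI outI : Bool) {φ : Baire} {x : ℝ} (h : IsNameOf inI φ x) :
    ∃ ψ : Baire, IsNameOf outI ψ x ∧ (∀ n, rate outI ψ x n ≤ paramBound (rate inI φ x) n) ∧
      ∀ a : Str, ∃ c, (machine inI outI).Reaches φ
          (Disciplined φ (paramBound (rate inI φ x) a.length)) (timeBound (rate inI φ x) a.length)
          ((machine inI outI).init a) c ∧
        c.state = (machine inI outI).halt ∧ (c.tapes .output).content = ψ a := by
  have hmono := rate_monotone h
  choose t U d s hans ht hU using fun n => exists_isAnswer h n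
  -- The word is defined for all strings and not only for codes, because the machine has to be total
  -- and the size of a Cauchy name takes all inputs into account.
  set w : Baire := fun a => U (a.length + 4) ++ [Letter.sep] ++
    ofBits (truncate (a.length + 4) (d (a.length + 4))) ++ [Letter.one] with hw
  have htrunc : ∀ k l, (truncate k l).length = k := by
    intro k
    induction k with
    | zero => intro l; rfl
    | succ k ih =>
      intro l
      cases l <;> simp [truncate, ih]
  have hlen : ∀ a, (w a).length = (U (a.length + 4)).length + a.length + 6 := by
    intro a
    simp only [hw, List.length_append, length_ofBits, htrunc, List.length_singleton]
    omega
  have happ : Approximates w x := by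
    intro a
    refine ⟨by rw [hlen]; omega, ?_⟩
    obtain ⟨z, r, hz, hr, hx⟩ := (hans (a.length + 4)).near
    obtain ⟨q, hq, hqr⟩ := exists_notationDyadic_truncate hz hr (a.length + 4)
    refine ⟨q, hq, ?_⟩
    have h1 : |(q : ℝ) - r| ≤ (2 : ℝ)⁻¹ ^ (a.length + 4 + 1) := by
      have h0 : ((|q - r| : ℚ) : ℝ) ≤ (((2 : ℚ)⁻¹ ^ (a.length + 4 + 1) : ℚ) : ℝ) :=
        Rat.cast_le.2 hqr
      push_cast at h0
      exact h0
    have h2 := abs_sub_le (q : ℝ) r x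
    have h3 : (0 : ℝ) < 2⁻¹ ^ (a.length + 4) := by positivity
    -- Truncation contributes half of `2 ^ (-(|a| + 4))`, the accepted centre the whole of it.
    rw [pow_succ _ (a.length + 4)] at h1
    linarith
  refine ⟨fun a => result outI a.length (w a), ?_, ?_, ?_⟩
  · cases outI with
    | false => exact happ.isCauchyName
    | true => exact happ.isIntervalName.1
  · intro n
    cases outI with
    | false =>
      -- The word has length `|U| + |a| + 6`, and `|U|` is at most the parameter at `|a| + 6` plus
      -- two; this explains the constants of `paramBound`.
      refine csSup_le' ?_
      rintro k ⟨a, ha, rfl⟩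
      have h1 := hU (a.length + 4)
      have h2 := hmono (show a.length + 4 + 2 ≤ n + 6 by omega)
      have h3 := hlen a
      simp only [result, Bool.false_eq_true, if_false, paramBound]
      omega
    | true =>
      -- The new interval name converges at a fixed rate, whatever the given name; only the
      -- logarithmic summand has to be taken over from the old parameter.
      have h1 := happ.isIntervalName.2 n
      have h2 := ceil_logb_le_rate h
      have h3 := hmono (show 2 ≤ n + 6 by omega)
      simp only [rate, if_true, paramBound]
      simp only [rate] at h2 h3
      omega
  · intro a
    obtain ⟨z, r, hz, hr, hx⟩ := (hans (a.length + 4)).near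
    obtain ⟨c, h1, h2, h3⟩ := goes_halt (inI := inI) (outI := outI) (φ := φ) (a := a)
      (t (a.length + 4)) (U (a.length + 4)) rfl (hans _).rejects (hans _).accepts
      (hans _).answer_eq (sep_not_mem_of_notationInt hz) (hans _).intPart (hans _).point
    have h4 := ht (a.length + 4)
    have h5 : _ ≤ rate inI φ x (a.length + 6) + 2 := hU (a.length + 4)
    have h6 := hmono (show a.length + 4 ≤ a.length + 6 by omega)
    refine ⟨c, (h1.imp fun c hc => hc.mono ?_).mono ?_, h2, ?_⟩
    · simp only [paramBound]
      omega
    · simp only [timeBound]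
      refine Nat.mul_le_mul_left _ (Nat.mul_le_mul ?_ ?_) <;> omega
    · rw [h3, digitsAt_eq _ _ (d (a.length + 4)) (hans _).digits]

theorem sop_timeBound : SOP timeBound := by
  have hl : SOP fun l n => l (n + 6) := by
    have := SOP.app (SOP.poly (Polynomial.X + Polynomial.C 6))
    simpa using this
  have hc : ∀ k : ℕ, SOP fun _ _ => k := fun k => by
    simpa using SOP.poly (Polynomial.C k)
  have hn : SOP fun _ n => n := by simpa using SOP.poly Polynomial.X
  exact (hc 100).mul ((hl.add (hc 1)).mul ((hn.add hl).add (hc 7)))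

theorem sop_paramBound : SOP paramBound := by
  have hl : SOP fun l n => l (n + 6) := by
    have := SOP.app (SOP.poly (Polynomial.X + Polynomial.C 6))
    simpa using this
  have hc : ∀ k : ℕ, SOP fun _ _ => k := fun k => by
    simpa using SOP.poly (Polynomial.C k)
  have hn : SOP fun _ n => n := by simpa using SOP.poly Polynomial.X
  exact (hl.add hn).add (hc 8)

theorem exists_name (inI : Bool) (φ : (space inI).rep.Dom) : ∃ x, IsNameOf inI φ x :=
  ⟨_, mem_space_rep.1 ⟨φ.2, rfl⟩⟩

/-- The identity is polytime computable between the two spaces. -/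
theorem polytimeComputable_id (inI outI : Bool) :
    PolytimeComputable (space inI) (space outI) id := by
  refine ⟨machine inI outI, timeBound, paramBound, sop_timeBound, sop_paramBound, ?_, ?_, ?_⟩
  · intro φ x hx
    obtain ⟨ψ, h1, -, h3⟩ := exists_translation inI outI (mem_space_rep.1 hx)
    refine ⟨ψ, (OracleMachine.mem_operator_iff (fun a => ?_) ψ).2 rfl, mem_space_rep.2 h1⟩
    obtain ⟨c, hc, hc', e⟩ := h3 a
    rw [← e]
    exact (hc.halts hc').2
  · intro φ a
    obtain ⟨x, hx⟩ := exists_name inI φ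
    obtain ⟨ψ, -, -, h3⟩ := exists_translation inI outI hx
    obtain ⟨c, hc, hc', -⟩ := h3 a
    rw [space_param φ hx]
    exact (hc.halts hc').1
  · intro φ ψ' hψ n
    obtain ⟨x, hx⟩ := exists_name inI φ
    obtain ⟨ψ, h1, h2, h3⟩ := exists_translation inI outI hx
    -- The operator of a machine is single-valued, so the arbitrary output name is the one that was
    -- constructed.
    have e : (ψ' : Baire) = ψ := by
      refine (OracleMachine.mem_operator_iff (fun a => ?_) ψ').1 hψ
      obtain ⟨c, hc, hc', e⟩ := h3 a
      rw [← e]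
      exact (hc.halts hc').2
    rw [space_param φ hx, space_param ψ' (e.symm ▸ h1), e]
    exact h2 n

end ParamSpace

namespace ParamSpace

open Translate

/-! ## Replacing the oracle by a machine -/

namespace Substitution

/-- The states of the composed machine: the states of the two machines and those of the oracle calls. -/
inductive State (S T : Type)
  | main (s : S)
  | idle
  | copyQuery
  | seekQueryEnd
  | seekAnswerEnd
  | eraseAnswer
  | mark
  | sim (t : T)
  | seekOutputEnd
  | seekOrigin
  | copyOutput
  | rewindAnswer
  | seekEnds
  | eraseTapes

open State

instance (S T : Type) [Finite S] [Finite T] : Finite (State S T) := by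
  refine Finite.of_surjective (α := (S ⊕ T) ⊕ Fin 12) (fun
    | .inl (.inl s) => main s
    | .inl (.inr t) => sim t
    | .inr i => ![idle, copyQuery, seekQueryEnd, seekAnswerEnd, eraseAnswer, mark, seekOutputEnd,
        seekOrigin, copyOutput, rewindAnswer, seekEnds, eraseTapes] i) ?_
  rintro (s | _ | _ | _ | _ | _ | _ | t | _ | _ | _ | _ | _ | _)
  · exact ⟨.inl (.inl s), rfl⟩
  · exact ⟨.inr 0, rfl⟩
  · exact ⟨.inr 1, rfl⟩
  · exact ⟨.inr 2, rfl⟩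
  · exact ⟨.inr 3, rfl⟩
  · exact ⟨.inr 4, rfl⟩
  · exact ⟨.inr 5, rfl⟩
  · exact ⟨.inl (.inr t), rfl⟩
  · exact ⟨.inr 6, rfl⟩
  · exact ⟨.inr 7, rfl⟩
  · exact ⟨.inr 8, rfl⟩
  · exact ⟨.inr 9, rfl⟩
  · exact ⟨.inr 10, rfl⟩
  · exact ⟨.inr 11, rfl⟩

instance (W : Type) [Finite W] : Finite (TapeName W) := by
  refine Finite.of_surjective (α := W ⊕ Fin 4) (fun
    | .inl w => .work w
    | .inr i => ![.input, .output, .query, .answer] i) ?_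
  rintro (_ | _ | _ | _ | w)
  · exact ⟨.inr 0, rfl⟩
  · exact ⟨.inr 1, rfl⟩
  · exact ⟨.inr 2, rfl⟩
  · exact ⟨.inr 3, rfl⟩
  · exact ⟨.inl w, rfl⟩

instance (A : Type) [Finite A] : Finite (Cell A) := by
  refine Finite.of_surjective (α := Letter ⊕ Option A) (fun
    | .inl s => .letter s
    | .inr none => .blank
    | .inr (some x) => .aux x) ?_
  rintro (_ | s | x)
  · exact ⟨.inr none, rfl⟩
  · exact ⟨.inl s, rfl⟩
  · exact ⟨.inr (some x), rfl⟩

/-- The auxiliary symbols of the composed machine: those of the first machine, and symbols for the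
visited cells of the second machine, with a flag for the cell with number zero. -/
abbrev Symbol (X Y : Type) := X ⊕ (Cell Y × Bool)

variable {X Y V W : Type}

/-- Symbols of the first machine. -/
def lift : Cell X → Cell (Symbol X Y)
  | .blank => .blank
  | .letter s => .letter s
  | .aux x => .aux (.inl x)

def unlift : Cell (Symbol X Y) → Cell X
  | .letter s => .letter s
  | .aux (.inl x) => .aux x
  | _ => .blank

theorem unlift_lift (c : Cell X) : unlift (lift c : Cell (Symbol X Y)) = c := by
  cases c <;> rfl

/-- Symbols of the second machine in a visited cell. -/
def visited (c : Cell Y) (b : Bool) : Cell (Symbol X Y) := .aux (.inr (c, b))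

def unvisit : Cell (Symbol X Y) → Cell Y
  | .aux (.inr (c, _)) => c
  | _ => .blank

def isOrigin : Cell (Symbol X Y) → Bool
  | .aux (.inr (_, b)) => b
  | _ => false

def liftTape (T : Tape X) : Tape (Symbol X Y) := ⟨fun i => lift (T.cells i), T.head⟩

theorem liftTape_act (T : Tape X) (c : Cell X) (m : Move) :
    (liftTape T : Tape (Symbol X Y)).act (lift c) m = liftTape (T.act c m) := by
  simp only [liftTape, Tape.act]
  congr 1
  funext i
  by_cases h : i = T.head <;> simp [h]

/-- The tapes of the composed machine are those of the two machines. -/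
def split : TapeName (V ⊕ TapeName W) → TapeName V ⊕ TapeName W
  | .input => .inl .input
  | .output => .inl .output
  | .query => .inl .query
  | .answer => .inl .answer
  | .work (.inl v) => .inl (.work v)
  | .work (.inr k) => .inr k

def embed : TapeName V → TapeName (V ⊕ TapeName W)
  | .input => .input
  | .output => .output
  | .query => .query
  | .answer => .answer
  | .work v => .work (.inl v)

theorem split_embed (k : TapeName V) : split (embed k : TapeName (V ⊕ TapeName W)) = .inl k := by
  cases k <;> rfl

/-- An action for every tape. -/
abbrev Action (V X : Type) := TapeName V → Cell X × Move

def keep (r : TapeName V → Cell X) : Action V X := fun k => (r k, .stay)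

def onInput (r : TapeName V → Cell X) (x : Cell X × Move) : Action V X
  | .input => x
  | k => (r k, .stay)

def onOutput (r : TapeName V → Cell X) (x : Cell X × Move) : Action V X
  | .output => x
  | k => (r k, .stay)

def onQuery (r : TapeName V → Cell X) (x : Cell X × Move) : Action V X
  | .query => x
  | k => (r k, .stay)

def onAnswer (r : TapeName V → Cell X) (x : Cell X × Move) : Action V X
  | .answer => x
  | k => (r k, .stay)

variable (M N : OracleMachine)

/-- The transition function of the composed machine, on the tapes of the two machines. -/
noncomputable def core (st : State M.State N.State) (r : TapeName M.Work → Cell M.Aux)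
    (r' : TapeName N.Work → Cell (Symbol M.Aux N.Aux)) :
    State M.State N.State × Action M.Work M.Aux × Action N.Work (Symbol M.Aux N.Aux) :=
  open Classical in
  match st with
  | main s =>
    if s = M.oracle then (copyQuery, onQuery r (r .query, .left), keep r')
    else (main (M.trans s r).1, (M.trans s r).2, keep r')
  | idle => (main M.halt, keep r, keep r')
  | copyQuery =>
    match r .query with
    | .letter x => (copyQuery, onQuery r (.letter x, .left),
        onInput r' (visited (.letter x) false, .left))
    | c => (seekQueryEnd, onQuery r (c, .right), onInput r' (r' .input, .right))
  | seekQueryEnd =>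
    if isBlank (r .query) then (seekAnswerEnd, keep r, keep r')
    else (seekQueryEnd, onQuery r (r .query, .right), keep r')
  | seekAnswerEnd =>
    if isBlank (r .answer) then (eraseAnswer, onAnswer r (r .answer, .left), keep r')
    else (seekAnswerEnd, onAnswer r (r .answer, .right), keep r')
  | eraseAnswer =>
    if isBlank (r .answer) then (mark, onAnswer r (r .answer, .right), keep r')
    else (eraseAnswer, onAnswer r (.blank, .left), keep r')
  | mark => (sim N.start, keep r, fun k => (visited (unvisit (r' k)) true, .stay))
  | sim t =>
    if t = N.halt then
      (seekOutputEnd, keep r, fun k => (visited (unvisit (r' k)) (isOrigin (r' k)), .stay))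
    else
      (sim (N.trans t fun k => unvisit (r' k)).1, keep r, fun k =>
        (visited ((N.trans t fun k => unvisit (r' k)).2 k).1 (isOrigin (r' k)),
          ((N.trans t fun k => unvisit (r' k)).2 k).2))
  | seekOutputEnd =>
    if isBlank (r' .output) then (seekOrigin, keep r, onOutput r' (r' .output, .left))
    else (seekOutputEnd, keep r, onOutput r' (r' .output, .right))
  | seekOrigin =>
    if isOrigin (r' .output) then (copyOutput, keep r, keep r')
    else (seekOrigin, keep r, onOutput r' (r' .output, .left))
  | copyOutput =>
    match (unvisit (r' .output)).letter? with
    | some x => (copyOutput, onAnswer r (.letter x, .right), onOutput r' (r' .output, .right))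
    | none => (rewindAnswer, onAnswer r (r .answer, .left), keep r')
  | rewindAnswer =>
    if isBlank (r .answer) then (seekEnds, onAnswer r (r .answer, .right), keep r')
    else (rewindAnswer, onAnswer r (r .answer, .left), keep r')
  | seekEnds =>
    if ∀ k, r' k = .blank then (eraseTapes, keep r, fun k => (r' k, .left))
    else (seekEnds, keep r, fun k => (r' k, advance (r' k)))
  | eraseTapes =>
    if ∀ k, r' k = .blank then (main M.resume, keep r, keep r')
    else (eraseTapes, keep r, fun k => (.blank, retreat (r' k)))

/-- The machine `M`, with `N` in the place of the oracle. -/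
noncomputable def machine : OracleMachine where
  State := State M.State N.State
  Aux := Symbol M.Aux N.Aux
  Work := M.Work ⊕ TapeName N.Work
  finiteState := by
    have := M.finiteState
    have := N.finiteState
    infer_instance
  finiteAux := by
    have := M.finiteAux
    have := N.finiteAux
    infer_instance
  finiteWork := by
    have := M.finiteWork
    have := N.finiteWork
    infer_instance
  start := main M.start
  halt := main M.halt
  oracle := idle
  resume := idle
  trans st rd :=
    let r := core M N st (fun k => unlift (rd (embed k))) fun k => rd (.work (.inr k))
    (r.1, fun k => match split k with
      | .inl k => (lift (r.2.1 k).1, (r.2.1 k).2)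
      | .inr k => r.2.2 k)

/-- The state `idle` serves as the formal oracle state, and no transition leads to it. -/
theorem machine_oracleFree : (machine M N).OracleFree := by
  classical
  refine ⟨(by intro h; cases h), fun st rd => ?_⟩
  change (core M N st _ _).1 ≠ idle
  cases st <;> simp only [core] <;> (try split_ifs) <;> (try split) <;> simp

variable {M N}

/-- The tapes of the composed machine. -/
def joinTapes (A : TapeName V → Tape X) (B : TapeName W → Tape (Symbol X Y)) :
    TapeName (V ⊕ TapeName W) → Tape (Symbol X Y) := fun k =>
  match split k with
  | .inl k => liftTape (A k)
  | .inr k => B k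

def conf (st : State M.State N.State) (A : TapeName M.Work → Tape M.Aux)
    (B : TapeName N.Work → Tape (Symbol M.Aux N.Aux)) : (machine M N).Cfg :=
  ⟨st, joinTapes A B⟩

/-- Runs of the composed machine. -/
abbrev Goes (θ : Baire) := (machine M N).Reaches θ fun _ => True

def reads (A : TapeName V → Tape X) : TapeName V → Cell X := fun k => (A k).read

/-- Reduces a step of the composed machine to `core`, whose actions on the two groups of tapes can
be checked separately; the common alphabet and tape names disappear here. -/
theorem goes_of_core {θ : Baire} {st st' : State M.State N.State}
    {A A' : TapeName M.Work → Tape M.Aux} {B B' : TapeName N.Work → Tape (Symbol M.Aux N.Aux)}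
    {f : Action M.Work M.Aux} {g : Action N.Work (Symbol M.Aux N.Aux)}
    (h : st ≠ main M.halt) (h' : st ≠ idle) (hc : core M N st (reads A) (reads B) = (st', f, g))
    (hA : ∀ k, (A k).act (f k).1 (f k).2 = A' k) (hB : ∀ k, (B k).act (g k).1 (g k).2 = B' k) :
    Goes θ 1 (conf st A B) (conf st' A' B') := by
  refine .single trivial ?_
  have e : (fun k => unlift (((conf st A B).tapes (embed k)).read)) = reads A := by
    funext k
    change unlift ((joinTapes A B (embed k)).read) = _
    simp only [joinTapes, split_embed]
    exact unlift_lift _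
  have ht : (machine M N).trans (conf st A B).state (fun k => ((conf st A B).tapes k).read) =
      (st', fun k => match split k with
        | .inl k => (lift (f k).1, (f k).2)
        | .inr k => g k) := by
    change (let r := core M N st (fun k => unlift (((conf st A B).tapes (embed k)).read)) (reads B)
      ((r.1, fun k => match split k with
        | .inl k => (lift (r.2.1 k).1, (r.2.1 k).2)
        | .inr k => r.2.2 k) : State M.State N.State ×
          Action (M.Work ⊕ TapeName N.Work) (Symbol M.Aux N.Aux))) = _
    rw [e, hc]
    rfl
  rw [OracleMachine.step_eq h h', ht]
  refine congrArg (OracleMachine.Cfg.mk (M := machine M N) st') (funext fun k => ?_)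
  change (joinTapes A B k).act _ _ = joinTapes A' B' k
  simp only [joinTapes]
  cases split k with
  | inl k => rw [liftTape_act, hA]
  | inr k => exact hB k

theorem Tape.act_read_stay (T : Tape X) : T.act T.read .stay = T := by
  cases T
  simp [Tape.act, Tape.read, Move.shift]

def setInput (A : TapeName V → Tape X) (T : Tape X) : TapeName V → Tape X
  | .input => T
  | k => A k

def setOutput (A : TapeName V → Tape X) (T : Tape X) : TapeName V → Tape X
  | .output => T
  | k => A k

def setQuery (A : TapeName V → Tape X) (T : Tape X) : TapeName V → Tape X
  | .query => T
  | k => A k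

def setAnswer (A : TapeName V → Tape X) (T : Tape X) : TapeName V → Tape X
  | .answer => T
  | k => A k

section Acts

variable (A : TapeName V → Tape X) (T : Tape X) (c : Cell X) (m : Move) (k : TapeName V)

theorem act_keep : (A k).act (keep (reads A) k).1 (keep (reads A) k).2 = A k :=
  Tape.act_read_stay _

theorem act_onInput : (setInput A T k).act (onInput (reads (setInput A T)) (c, m) k).1
    (onInput (reads (setInput A T)) (c, m) k).2 = setInput A (T.act c m) k := by
  cases k <;> first | rfl | exact Tape.act_read_stay _

theorem act_onOutput : (setOutput A T k).act (onOutput (reads (setOutput A T)) (c, m) k).1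
    (onOutput (reads (setOutput A T)) (c, m) k).2 = setOutput A (T.act c m) k := by
  cases k <;> first | rfl | exact Tape.act_read_stay _

theorem act_onQuery : (setQuery A T k).act (onQuery (reads (setQuery A T)) (c, m) k).1
    (onQuery (reads (setQuery A T)) (c, m) k).2 = setQuery A (T.act c m) k := by
  cases k <;> first | rfl | exact Tape.act_read_stay _

theorem act_onAnswer : (setAnswer A T k).act (onAnswer (reads (setAnswer A T)) (c, m) k).1
    (onAnswer (reads (setAnswer A T)) (c, m) k).2 = setAnswer A (T.act c m) k := by
  cases k <;> first | rfl | exact Tape.act_read_stay _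

end Acts

end Substitution

end ParamSpace

namespace ParamSpace

open Translate

namespace Substitution

open State Tape

variable {X Y V W : Type} {M N : OracleMachine} {θ : Baire}

/-! ### Tapes of the second machine -/

theorem unvisit_visited (c : Cell Y) (b : Bool) : unvisit (visited c b : Cell (Symbol X Y)) = c :=
  rfl

theorem visited_ne_blank (c : Cell Y) (b : Bool) :
    (visited c b : Cell (Symbol X Y)) ≠ .blank := by
  simp [visited]

/-- The tape `T'` represents `T`, shifted by `d`; the cells from `lo` to `hi - 1` have been visited. -/
structure Represents (T : Tape Y) (T' : Tape (Symbol X Y)) (d lo hi : ℤ) : Prop where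
  cells : ∀ i, T'.cells (i + d) =
    if lo ≤ i ∧ i < hi then visited (T.cells i) (decide (i = 0)) else .blank
  outside : ∀ i, ¬ (lo ≤ i ∧ i < hi) → T.cells i = .blank
  head : T'.head = T.head + d
  lo_le : lo ≤ 0
  lt_hi : 0 < hi
  le_head : lo - 1 ≤ T.head
  head_le : T.head ≤ hi

namespace Represents

variable {T : Tape Y} {T' : Tape (Symbol X Y)} {d lo hi : ℤ}

theorem unvisit_cells (h : Represents T T' d lo hi) (i : ℤ) :
    unvisit (T'.cells (i + d)) = T.cells i := by
  rw [h.cells]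
  split_ifs with hi
  · rfl
  · exact (h.outside i hi).symm

theorem unvisit_read (h : Represents T T' d lo hi) : unvisit T'.read = T.read := by
  rw [Tape.read, h.head, h.unvisit_cells]
  rfl

theorem isOrigin_cells (h : Represents T T' d lo hi) (i : ℤ) :
    isOrigin (T'.cells (i + d)) = decide (i = 0) := by
  rw [h.cells]
  split_ifs with hi
  · rfl
  · have := h.lo_le
    have := h.lt_hi
    have : i ≠ 0 := by
      rintro rfl
      exact hi ⟨by omega, by omega⟩
    simp [isOrigin, this]

theorem isOrigin_read (h : Represents T T' d lo hi) : isOrigin T'.read = decide (T.head = 0) := by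
  rw [Tape.read, h.head, h.isOrigin_cells]

theorem ne_blank_iff (h : Represents T T' d lo hi) (i : ℤ) :
    T'.cells i ≠ .blank ↔ lo + d ≤ i ∧ i < hi + d := by
  have := h.cells (i - d)
  rw [sub_add_cancel] at this
  rw [this]
  split_ifs with h1
  · simp only [ne_eq, visited_ne_blank, not_false_eq_true, true_iff]
    omega
  · simp only [ne_eq, not_true, false_iff]
    omega

/-- Every step visits the cell under the head. -/
theorem act (h : Represents T T' d lo hi) (c : Cell Y) (m : Move) :
    Represents (T.act c m) (T'.act (visited c (isOrigin T'.read)) m) d (min lo T.head)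
      (max hi (T.head + 1)) := by
  have h1 := h.lo_le
  have h2 := h.lt_hi
  have h3 := h.le_head
  have h4 := h.head_le
  have hm : -1 ≤ m.shift ∧ m.shift ≤ 1 := by cases m <;> simp [Move.shift]
  refine ⟨fun i => ?_, fun i hi => ?_, ?_, by omega, by omega, ?_, ?_⟩
  · simp only [Tape.act, Function.update_apply, h.isOrigin_read, h.head, add_left_inj]
    by_cases hi : i = T.head
    · subst hi
      rw [if_pos rfl, if_pos rfl, if_pos (by omega)]
    · rw [if_neg hi, if_neg hi, h.cells]
      congr 1
      apply propext
      omega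
  · simp only [Tape.act, Function.update_apply]
    rw [if_neg (by omega)]
    exact h.outside i (by omega)
  · simp only [Tape.act, h.head]
    ring
  · simp only [Tape.act]
    omega
  · simp only [Tape.act]
    omega

/-- The letters of the content are visited. -/
theorem length_content_le (h : Represents T T' d lo hi) : (T.content.length : ℤ) ≤ hi := by
  have hne : {n : ℕ | (T.cells n).letter? = none}.Nonempty := by
    refine ⟨hi.toNat, ?_⟩
    have := h.lt_hi
    have h1 : ((hi.toNat : ℕ) : ℤ) = hi := Int.toNat_of_nonneg (by omega)
    change (T.cells (hi.toNat : ℤ)).letter? = none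
    rw [h1, h.outside hi (by omega)]
    rfl
  have h1 : T.content.length ≤ sInf {n : ℕ | (T.cells n).letter? = none} := by
    rw [Tape.content]
    exact (List.length_filterMap_le _ _).trans (by simp)
  have h2 : sInf {n : ℕ | (T.cells n).letter? = none} ≤ hi.toNat := by
    apply Nat.sInf_le
    have := h.lt_hi
    have h1 : ((hi.toNat : ℕ) : ℤ) = hi := Int.toNat_of_nonneg (by omega)
    change (T.cells (hi.toNat : ℤ)).letter? = none
    rw [h1, h.outside hi (by omega)]
    rfl
  have := h.lt_hi
  omega

end Represents

/-- The content of a tape consists of the letters up to the first cell without a letter. -/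
theorem content_spec (T : Tape Y) (hT : ∃ n : ℕ, (T.cells n).letter? = none) :
    (∀ n : ℕ, n < T.content.length → (T.cells n).letter? = T.content[n]?) ∧
      (T.cells T.content.length).letter? = none := by
  set m := sInf {n : ℕ | (T.cells n).letter? = none} with hm
  have hmem : (T.cells m).letter? = none :=
    Nat.sInf_mem (s := {n : ℕ | (T.cells n).letter? = none}) hT
  have hlt : ∀ n < m, ∃ x, (T.cells n).letter? = some x := by
    intro n hn
    have := Nat.notMem_of_lt_sInf hn
    exact Option.ne_none_iff_exists'.1 this
  have key : ∀ k ≤ m, ∀ s, s = (List.range k).filterMap (fun i : ℕ => (T.cells i).letter?) →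
      s.length = k ∧ ∀ n < k, (T.cells n).letter? = s[n]? := by
    intro k
    induction k with
    | zero =>
      rintro - s rfl
      simp
    | succ k ih =>
      rintro hk s rfl
      obtain ⟨h1, h2⟩ := ih (by omega) _ rfl
      obtain ⟨x, hx⟩ := hlt k (by omega)
      rw [List.range_succ, List.filterMap_append]
      have e : List.filterMap (fun i : ℕ => (T.cells i).letter?) [k] = [x] := by simp [hx]
      rw [e]
      refine ⟨by simp [h1], fun n hn => ?_⟩
      rcases Nat.lt_succ_iff_lt_or_eq.1 hn with h | rfl
      · rw [List.getElem?_append_left (by omega)]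
        exact h2 n h
      · rw [List.getElem?_append_right (by omega), h1]
        simpa using hx
  obtain ⟨h1, h2⟩ := key m le_rfl T.content rfl
  rw [h1]
  exact ⟨h2, hmem⟩

/-! ### Oracle calls -/

variable {A : TapeName M.Work → Tape M.Aux}
  {B : TapeName N.Work → Tape (Symbol M.Aux N.Aux)} {q s : Str}

theorem isBlank_eq_false {c : Cell X} (h : c ≠ .blank) : isBlank c = false := by
  cases c <;> simp_all [isBlank]

/-- The part of the input of the second machine from position `j` on, in visited cells. -/
def inputPart (q : Str) (d : ℤ) (j : ℕ) : ℤ → Cell (Symbol X Y) := fun i =>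
  if (j : ℤ) + d ≤ i ∧ i < q.length + d then visited (cellsOf q (i - d)) false else .blank

/-- Under the discipline the query head stands at the end of the query, so the query is copied
backwards, without rewinding first. The last step bounces off the blank in cell `-1` and leaves the
simulated input head on the first letter, which has position `d`. -/
theorem goes_copyQuery (d : ℤ) (j : ℕ) : j ≤ q.length → Goes θ (j + 1)
    (conf (M := M) (N := N) copyQuery (setQuery A ⟨cellsOf q, (j : ℤ) - 1⟩)
      (setInput B ⟨inputPart q d j, (j : ℤ) - 1 + d⟩))
    (conf seekQueryEnd (setQuery A ⟨cellsOf q, 0⟩) (setInput B ⟨inputPart q d 0, d⟩)) := by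
  induction j with
  | zero =>
    intro _
    refine (goes_of_core (by simp) (by simp) (f := onQuery _ (.blank, .right))
      (g := onInput _ ((inputPart q d 0) (((0 : ℕ) : ℤ) - 1 + d), .right)) ?_
      (fun k => (act_onQuery _ _ _ _ k).trans ?_) (fun k => (act_onInput _ _ _ _ k).trans ?_)).mono
      (by omega)
    · have e : reads (setQuery A ⟨cellsOf q, ((0 : ℕ) : ℤ) - 1⟩) .query = .blank := by
        change (cellsOf q (((0 : ℕ) : ℤ) - 1)) = _
        rfl
      simp only [core, e]
      rfl
    · have h := act_read (cellsOf (Aux := M.Aux) q) (((0 : ℕ) : ℤ) - 1) .right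
      exact congrArg (fun T => setQuery A T k) h
    · have h := act_read (inputPart (X := M.Aux) (Y := N.Aux) q d 0) (((0 : ℕ) : ℤ) - 1 + d) .right
      rw [h]
      congr 2
      simp [Move.shift]
  | succ j ih =>
    intro hj
    have hr : cellsOf (Aux := M.Aux) q (j : ℤ) = .letter q[j] := by
      rw [cellsOf_eq, cellsBy_natCast, List.getElem?_eq_getElem (by omega)]
      rfl
    have hr' : cellsOf (Aux := N.Aux) q (j : ℤ) = .letter q[j] := by
      rw [cellsOf_eq, cellsBy_natCast, List.getElem?_eq_getElem (by omega)]
      rfl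
    have e1 : ((j + 1 : ℕ) : ℤ) - 1 = j := by push_cast; ring
    rw [e1]
    refine (OracleMachine.Reaches.trans (t := 1) ?_ (ih (by omega))).mono (by omega)
    refine goes_of_core (by simp) (by simp) (f := onQuery _ (.letter q[j], .left))
      (g := onInput _ (visited (.letter q[j]) false, .left)) ?_
      (fun k => (act_onQuery _ _ _ _ k).trans ?_) (fun k => (act_onInput _ _ _ _ k).trans ?_)
    · have e : reads (setQuery A ⟨cellsOf q, (j : ℤ)⟩) .query = .letter q[j] := hr
      simp only [core, e]
    · have h := act_read (cellsOf (Aux := M.Aux) q) (j : ℤ) .left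
      rw [hr] at h
      rw [h]
      rfl
    · congr 1
      simp only [Tape.act, Move.shift]
      congr 1
      · funext i
        simp only [Function.update_apply, inputPart]
        by_cases hi : i = j + d
        · subst hi
          rw [if_pos rfl, if_pos (by omega), add_sub_cancel_right, hr']
        · rw [if_neg hi]
          congr 1
          apply propext
          push_cast
          omega
      · ring

end Substitution

end ParamSpace

/-! ### Sweeps of the composed machine along its tapes -/

namespace ParamSpace

open Translate

namespace Substitution

open State Tape

variable {X Y V W : Type} {M N : OracleMachine} {θ : Baire}
  {A : TapeName M.Work → Tape M.Aux}
  {B : TapeName N.Work → Tape (Symbol M.Aux N.Aux)} {q s : Str}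

section Moves

variable {st st' : State M.State N.State} {j : ℤ} {m : Move}

theorem goes_moveQuery {c : ℤ → Cell M.Aux} (h : st ≠ main M.halt) (h' : st ≠ idle)
    (hc : core M N st (reads (setQuery A ⟨c, j⟩)) (reads B) =
      (st', onQuery (reads (setQuery A ⟨c, j⟩)) (c j, m), keep (reads B))) :
    Goes θ 1 (conf st (setQuery A ⟨c, j⟩) B) (conf st' (setQuery A ⟨c, j + m.shift⟩) B) :=
  goes_of_core h h' hc (fun k => (act_onQuery _ _ _ _ k).trans (by rw [act_read]))
    (fun k => act_keep _ k)

theorem goes_moveAnswer {c : ℤ → Cell M.Aux} (h : st ≠ main M.halt) (h' : st ≠ idle)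
    (hc : core M N st (reads (setAnswer A ⟨c, j⟩)) (reads B) =
      (st', onAnswer (reads (setAnswer A ⟨c, j⟩)) (c j, m), keep (reads B))) :
    Goes θ 1 (conf st (setAnswer A ⟨c, j⟩) B) (conf st' (setAnswer A ⟨c, j + m.shift⟩) B) :=
  goes_of_core h h' hc (fun k => (act_onAnswer _ _ _ _ k).trans (by rw [act_read]))
    (fun k => act_keep _ k)

theorem goes_moveOutput {c : ℤ → Cell (Symbol M.Aux N.Aux)} (h : st ≠ main M.halt) (h' : st ≠ idle)
    (hc : core M N st (reads A) (reads (setOutput B ⟨c, j⟩)) =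
      (st', keep (reads A), onOutput (reads (setOutput B ⟨c, j⟩)) (c j, m))) :
    Goes θ 1 (conf st A (setOutput B ⟨c, j⟩)) (conf st' A (setOutput B ⟨c, j + m.shift⟩)) :=
  goes_of_core h h' hc (fun k => act_keep _ k)
    (fun k => (act_onOutput _ _ _ _ k).trans (by rw [act_read]))

theorem goes_stay (h : st ≠ main M.halt) (h' : st ≠ idle)
    (hc : core M N st (reads A) (reads B) = (st', keep (reads A), keep (reads B))) :
    Goes θ 1 (conf st A B) (conf st' A B) :=
  goes_of_core h h' hc (fun k => act_keep _ k) (fun k => act_keep _ k)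

end Moves

theorem isBlank_cellsOf_nat {j : ℕ} (h : j < s.length) :
    isBlank (cellsOf (Aux := X) s (j : ℤ)) = false := by
  rw [cellsOf_eq, cellsBy_natCast, List.getElem?_eq_getElem h]
  rfl

theorem isBlank_cellsOf_length : isBlank (cellsOf (Aux := X) s (s.length : ℤ)) = true := by
  rw [cellsOf_eq, cellsBy_natCast, List.getElem?_eq_none le_rfl]
  rfl

theorem goes_seekQueryEnd (k : ℕ) : ∀ j, j + k = q.length → Goes θ (k + 1)
    (conf (N := N) seekQueryEnd (setQuery A ⟨cellsOf q, (j : ℕ)⟩) B)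
    (conf seekAnswerEnd (setQuery A ⟨cellsOf q, q.length⟩) B) := by
  induction k with
  | zero =>
    intro j hj
    obtain rfl : j = q.length := by omega
    refine goes_stay (by simp) (by simp) ?_
    have e : isBlank (reads (setQuery A ⟨cellsOf q, q.length⟩) .query) = true :=
      isBlank_cellsOf_length
    simp only [core, e, if_true]
  | succ k ih =>
    intro j hj
    have h := goes_moveQuery (θ := θ) (A := A) (B := B) (c := cellsOf q) (j := (j : ℤ))
      (st := seekQueryEnd) (st' := seekQueryEnd) (m := .right) (by simp) (by simp) (by
        have e : isBlank (reads (setQuery A ⟨cellsOf q, (j : ℤ)⟩) .query) = false :=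
          isBlank_cellsOf_nat (by omega)
        simp only [core, e, Bool.false_eq_true, if_false]
        rfl)
    exact (h.trans (ih (j + 1) (by omega))).mono (by omega)

theorem goes_seekAnswerEnd (k : ℕ) : ∀ j, j + k = s.length → Goes θ (k + 1)
    (conf (N := N) seekAnswerEnd (setAnswer A ⟨cellsOf s, (j : ℕ)⟩) B)
    (conf eraseAnswer (setAnswer A ⟨cellsOf s, s.length + -1⟩) B) := by
  induction k with
  | zero =>
    intro j hj
    obtain rfl : j = s.length := by omega
    exact goes_moveAnswer (m := .left) (by simp) (by simp) (by
      have e : isBlank (reads (setAnswer A ⟨cellsOf s, (s.length : ℤ)⟩) .answer) = true :=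
        isBlank_cellsOf_length
      simp only [core, e, if_true]
      rfl)
  | succ k ih =>
    intro j hj
    have h := goes_moveAnswer (θ := θ) (A := A) (B := B) (c := cellsOf s) (j := (j : ℤ))
      (st := seekAnswerEnd) (st' := seekAnswerEnd) (m := .right) (by simp) (by simp) (by
        have e : isBlank (reads (setAnswer A ⟨cellsOf s, (j : ℤ)⟩) .answer) = false :=
          isBlank_cellsOf_nat (by omega)
        simp only [core, e, Bool.false_eq_true, if_false]
        rfl)
    exact (h.trans (ih (j + 1) (by omega))).mono (by omega)

theorem update_cellsOf_blank (s : Str) (x : Letter) :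
    Function.update (cellsOf (Aux := X) (s ++ [x])) (s.length : ℤ) .blank = cellsOf s := by
  funext i
  by_cases hi : i = s.length
  · subst hi
    simp [cellsOf_eq, cellsBy_natCast]
  · rw [Function.update_of_ne hi, cellsOf_eq, cellsOf_eq]
    rw [← update_cellsBy, Function.update_of_ne hi]

theorem goes_eraseAnswer (s : Str) : Goes θ (s.length + 1)
    (conf (N := N) eraseAnswer (setAnswer A ⟨cellsOf s, s.length + -1⟩) B)
    (conf mark (setAnswer A ⟨cellsOf [], 0⟩) B) := by
  induction s using List.reverseRecOn with
  | nil =>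
    exact goes_moveAnswer (A := A) (B := B) (c := cellsOf []) (st := eraseAnswer) (st' := mark)
      (m := .right) (j := -1) (by simp) (by simp) (by
      have e : isBlank (reads (setAnswer A ⟨cellsOf [], -1⟩) .answer) = true := rfl
      simp only [core, e, if_true]
      rfl)
  | append_singleton s x ih =>
    have e1 : ((s ++ [x]).length : ℤ) + -1 = s.length := by simp
    rw [e1]
    refine (OracleMachine.Reaches.trans (t := 1) ?_ ih).mono (by simp [add_comm])
    refine goes_of_core (by simp) (by simp) (f := onAnswer _ (.blank, .left))
      (g := keep (reads B)) ?_ (fun k => (act_onAnswer _ _ _ _ k).trans ?_) (fun k => act_keep _ k)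
    · have e : isBlank (reads (setAnswer A ⟨cellsOf (s ++ [x]), (s.length : ℤ)⟩) .answer)
          = false := isBlank_cellsOf_nat (by simp)
      simp only [core, e, Bool.false_eq_true, if_false]
    · simp only [Tape.act, update_cellsOf_blank, Move.shift]

theorem goes_rewindAnswer (j : ℕ) : j ≤ s.length → Goes θ (j + 1)
    (conf (N := N) rewindAnswer (setAnswer A ⟨cellsOf s, (j : ℤ) + -1⟩) B)
    (conf seekEnds (setAnswer A ⟨cellsOf s, 0⟩) B) := by
  induction j with
  | zero =>
    intro _
    exact goes_moveAnswer (A := A) (B := B) (c := cellsOf s) (st := rewindAnswer) (st' := seekEnds)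
      (m := .right) (j := -1) (by simp) (by simp) (by
      have e : isBlank (reads (setAnswer A ⟨cellsOf s, -1⟩) .answer) = true := rfl
      simp only [core, e, if_true]
      rfl)
  | succ j ih =>
    intro hj
    have e1 : ((j + 1 : ℕ) : ℤ) + -1 = j := by push_cast; ring
    rw [e1]
    have h := goes_moveAnswer (θ := θ) (A := A) (B := B) (c := cellsOf s) (j := (j : ℤ))
      (st := rewindAnswer) (st' := rewindAnswer) (m := .left) (by simp) (by simp) (by
        have e : isBlank (reads (setAnswer A ⟨cellsOf s, (j : ℤ)⟩) .answer) = false :=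
          isBlank_cellsOf_nat (by omega)
        simp only [core, e, Bool.false_eq_true, if_false]
        rfl)
    exact (h.trans (ih (by omega))).mono (by omega)

/-- After a simulation it is unknown on which side of the origin the output head stands. From the
right end of the visited block, a sweep to the left certainly meets the origin. -/
theorem goes_seekOutputEnd {c : ℤ → Cell (Symbol M.Aux N.Aux)} {lo hi : ℤ}
    (hc : ∀ i, c i ≠ .blank ↔ lo ≤ i ∧ i < hi) (k : ℕ) : ∀ i, lo ≤ i → i + k = hi →
    Goes θ (k + 1) (conf seekOutputEnd A (setOutput B ⟨c, i⟩))
      (conf seekOrigin A (setOutput B ⟨c, hi + -1⟩)) := by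
  induction k with
  | zero =>
    intro i _ hik
    obtain rfl : i = hi := by simpa using hik
    exact goes_moveOutput (m := .left) (by simp) (by simp) (by
      have e0 : c i = .blank := by
        by_contra h
        have := (hc i).1 h
        omega
      have e : isBlank (reads (setOutput B ⟨c, i⟩) .output) = true := by
        change isBlank (c i) = true
        rw [e0]
        rfl
      simp only [core, e, if_true]
      rfl)
  | succ k ih =>
    intro i hlo hi
    have h := goes_moveOutput (θ := θ) (A := A) (B := B) (c := c) (j := i)
      (st := seekOutputEnd) (st' := seekOutputEnd) (m := .right) (by simp) (by simp) (by
        have e : isBlank (reads (setOutput B ⟨c, i⟩) .output) = false :=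
          isBlank_eq_false ((hc i).2 ⟨hlo, by push_cast at hi; omega⟩)
        simp only [core, e, Bool.false_eq_true, if_false]
        rfl)
    exact (h.trans (ih (i + 1) (by omega) (by push_cast at hi; omega))).mono (by omega)

/-- The content of a tape is read from cell `0`, and the flag in the symbols is the only trace of
that cell on the shifted tape. -/
theorem goes_seekOrigin {c : ℤ → Cell (Symbol M.Aux N.Aux)} {d : ℤ}
    (hc : ∀ i, isOrigin (c (i + d)) = decide (i = 0)) (k : ℕ) :
    Goes θ (k + 1) (conf seekOrigin A (setOutput B ⟨c, k + d⟩))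
      (conf copyOutput A (setOutput B ⟨c, (0 : ℕ) + d⟩)) := by
  induction k with
  | zero =>
    refine goes_stay (by simp) (by simp) ?_
    have e : isOrigin (reads (setOutput B ⟨c, ((0 : ℕ) : ℤ) + d⟩) .output) = true :=
      (hc (0 : ℕ)).trans (by simp)
    simp only [core, e, if_true]
  | succ k ih =>
    have h := goes_moveOutput (θ := θ) (A := A) (B := B) (c := c) (j := ((k + 1 : ℕ) : ℤ) + d)
      (st := seekOrigin) (st' := seekOrigin) (m := .left) (by simp) (by simp) (by
        have e : isOrigin (reads (setOutput B ⟨c, ((k + 1 : ℕ) : ℤ) + d⟩) .output) = false :=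
          (hc (k + 1 : ℕ)).trans (decide_eq_false (by omega))
        simp only [core, e, Bool.false_eq_true, if_false]
        rfl)
    have e1 : ((k + 1 : ℕ) : ℤ) + d + Move.left.shift = k + d := by
      simp only [Move.shift]
      push_cast
      ring
    rw [e1] at h
    exact (h.trans ih).mono (by omega)

theorem goes_copyOutput {c : ℤ → Cell (Symbol M.Aux N.Aux)} {d : ℤ} {w : Str}
    (hw : ∀ n : ℕ, n < w.length → (unvisit (c (n + d))).letter? = w[n]?)
    (hw' : (unvisit (c (w.length + d))).letter? = none) (k : ℕ) : ∀ j : ℕ, j + k = w.length →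
    Goes θ (k + 1)
      (conf copyOutput (setAnswer A ⟨cellsOf (w.take j), j⟩) (setOutput B ⟨c, j + d⟩))
      (conf rewindAnswer (setAnswer A ⟨cellsOf w, w.length + -1⟩)
        (setOutput B ⟨c, w.length + d⟩)) := by
  induction k with
  | zero =>
    intro j hj
    obtain rfl : j = w.length := by omega
    rw [List.take_length]
    exact goes_moveAnswer (m := .left) (by simp) (by simp) (by
      have e : (unvisit (reads (setOutput B ⟨c, (w.length : ℤ) + d⟩) .output)).letter? = none := hw'
      simp only [core, e]
      rfl)
  | succ k ih =>
    intro j hj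
    have hlt : j < w.length := by omega
    have e1 : ((j : ℤ)) = ((w.take j).length : ℕ) := by
      rw [List.length_take, min_eq_left hlt.le]
    have e : (unvisit (reads (setOutput B ⟨c, (j : ℤ) + d⟩) .output)).letter? = some w[j] :=
      (hw j hlt).trans (List.getElem?_eq_getElem hlt)
    refine (OracleMachine.Reaches.trans (t := 1) ?_ (ih (j + 1) (by omega))).mono (by omega)
    refine goes_of_core (by simp) (by simp) (f := onAnswer _ (.letter w[j], .right))
      (g := onOutput _ (c (j + d), .right)) ?_ (fun k => (act_onAnswer _ _ _ _ k).trans ?_)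
      (fun k => (act_onOutput _ _ _ _ k).trans ?_)
    · simp only [core, e]
      rfl
    · have h := act_append (Cell.letter (Aux := M.Aux)) (w.take j) w[j] .right
      rw [← cellsOf_eq, ← cellsOf_eq, ← e1, List.take_append_getElem hlt] at h
      rw [h]
      simp [Move.shift]
    · rw [act_read]
      congr 2
      simp only [Move.shift]
      push_cast
      ring

theorem advance_of_ne_blank {c : Cell X} (h : c ≠ .blank) : advance c = .right := by
  cases c <;> first | rfl | exact absurd rfl h

theorem retreat_of_ne_blank {c : Cell X} (h : c ≠ .blank) : retreat c = .left := by
  cases c <;> first | rfl | exact absurd rfl h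

/-- All heads move right together, and each waits on the first blank after its block of nonblank
cells; the largest distance governs the cost. The final common step to the left puts every head on
the last cell of its block, the starting point for erasing. -/
theorem goes_seekEnds (W : ℕ) : ∀ B : TapeName N.Work → Tape (Symbol M.Aux N.Aux),
    (∀ k, ∃ lo hi : ℤ, (∀ i, (B k).cells i ≠ .blank ↔ lo ≤ i ∧ i < hi) ∧ lo ≤ (B k).head ∧
      (B k).head ≤ hi ∧ hi ≤ (B k).head + W) →
    ∃ B' : TapeName N.Work → Tape (Symbol M.Aux N.Aux),
      (∀ k, (B' k).cells = (B k).cells ∧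
        ∃ lo, ∀ i, (B k).cells i ≠ .blank ↔ lo ≤ i ∧ i ≤ (B' k).head) ∧
      Goes θ (W + 1) (conf (M := M) seekEnds A B) (conf eraseTapes A B') := by
  induction W with
  | zero =>
    intro B hB
    refine ⟨fun k => ⟨(B k).cells, (B k).head + -1⟩, fun k => ⟨rfl, ?_⟩, ?_⟩
    · obtain ⟨lo, hi, h1, h2, h3, h4⟩ := hB k
      refine ⟨lo, fun i => (h1 i).trans ?_⟩
      simp only [Nat.cast_zero, add_zero] at h4 ⊢
      omega
    · refine goes_of_core (by simp) (by simp) (f := keep (reads A))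
        (g := fun k => (reads B k, .left)) ?_ (fun k => act_keep _ k) (fun k => act_read _ _ _)
      have e : ∀ k, reads B k = .blank := by
        intro k
        obtain ⟨lo, hi, h1, h2, h3, h4⟩ := hB k
        by_contra h
        have := (h1 _).1 h
        simp only [Nat.cast_zero, add_zero] at h4
        omega
      simp only [core]
      rw [if_pos e]
  | succ W ih =>
    intro B hB
    -- If all heads read blanks, they stand at the right ends of their blocks, so the bound `W + 1`
    -- may be replaced by any smaller one.
    by_cases e : ∀ k, reads B k = .blank
    · obtain ⟨B', h1, h2⟩ := ih B fun k => by
        obtain ⟨lo, hi, h1, h2, h3, h4⟩ := hB k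
        refine ⟨lo, hi, h1, h2, h3, ?_⟩
        have : ¬ (lo ≤ (B k).head ∧ (B k).head < hi) := fun h => (h1 _).2 h (e k)
        omega
      exact ⟨B', h1, h2.mono (by omega)⟩
    · obtain ⟨B', h1, h2⟩ := ih
        (fun k => ⟨(B k).cells, (B k).head + (advance (reads B k)).shift⟩) fun k => by
          obtain ⟨lo, hi, h1, h2, h3, h4⟩ := hB k
          refine ⟨lo, hi, h1, ?_⟩
          push_cast at h4
          by_cases hb : reads B k = .blank
          · have : ¬ (lo ≤ (B k).head ∧ (B k).head < hi) := fun h => (h1 _).2 h hb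
            rw [hb]
            simp only [advance, Move.shift]
            omega
          · have := (h1 _).1 hb
            rw [advance_of_ne_blank hb]
            simp only [Move.shift]
            omega
      refine ⟨B', h1, (OracleMachine.Reaches.trans (t := 1) ?_ h2).mono (by omega)⟩
      refine goes_of_core (by simp) (by simp) (f := keep (reads A))
        (g := fun k => (reads B k, advance (reads B k))) ?_ (fun k => act_keep _ k)
        (fun k => act_read _ _ _)
      simp only [core]
      rw [if_neg e]

/-- Throughout, the nonblank cells of a tape are those from `lo` up to the head. So a head that
reads a blank has nothing left to erase, and the machine may stop when all heads do so. -/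
theorem goes_eraseTapes (W : ℕ) : ∀ B : TapeName N.Work → Tape (Symbol M.Aux N.Aux),
    (∀ k, ∃ lo : ℤ, (∀ i, (B k).cells i ≠ .blank ↔ lo ≤ i ∧ i ≤ (B k).head) ∧
      (B k).head < lo + W) →
    ∃ B' : TapeName N.Work → Tape (Symbol M.Aux N.Aux), (∀ k i, (B' k).cells i = .blank) ∧
      Goes θ (W + 1) (conf (M := M) eraseTapes A B) (conf (main M.resume) A B') := by
  have hdone : ∀ B : TapeName N.Work → Tape (Symbol M.Aux N.Aux),
      (∀ k, ∃ lo : ℤ, (∀ i, (B k).cells i ≠ .blank ↔ lo ≤ i ∧ i ≤ (B k).head)) →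
      (∀ k, reads B k = .blank) → (∀ k i, (B k).cells i = .blank) ∧
      Goes θ 1 (conf (M := M) eraseTapes A B) (conf (main M.resume) A B) := by
    intro B hB e
    refine ⟨fun k i => ?_, goes_stay (by simp) (by simp) ?_⟩
    · obtain ⟨lo, h1⟩ := hB k
      by_contra h
      have h2 := (h1 i).1 h
      exact (h1 (B k).head).2 ⟨by omega, le_rfl⟩ (e k)
    · simp only [core]
      rw [if_pos e]
  induction W with
  | zero =>
    intro B hB
    have e : ∀ k, reads B k = .blank := by
      intro k
      obtain ⟨lo, h1, h2⟩ := hB k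
      by_contra h
      have := (h1 _).1 h
      simp only [Nat.cast_zero, add_zero] at h2
      omega
    exact ⟨B, hdone B (fun k => (hB k).imp fun _ h => h.1) e⟩
  | succ W ih =>
    intro B hB
    by_cases e : ∀ k, reads B k = .blank
    · obtain ⟨h1, h2⟩ := hdone B (fun k => (hB k).imp fun _ h => h.1) e
      exact ⟨B, h1, h2.mono (by omega)⟩
    · obtain ⟨B', h1, h2⟩ := ih (fun k => (B k).act .blank (retreat (reads B k))) fun k => by
        obtain ⟨lo, h1, h2⟩ := hB k
        refine ⟨lo, ?_⟩
        push_cast at h2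
        by_cases hb : reads B k = .blank
        · have hlo : ¬ (lo ≤ (B k).head ∧ (B k).head ≤ (B k).head) := fun h => (h1 _).2 h hb
          have e1 : (B k).act .blank (retreat (reads B k)) = B k := by
            rw [hb]
            have := Tape.act_read_stay (B k)
            rw [show (B k).read = .blank from hb] at this
            exact this
          rw [e1]
          exact ⟨h1, by omega⟩
        · have hlo := (h1 _).1 hb
          rw [retreat_of_ne_blank hb]
          simp only [Tape.act, Move.shift]
          refine ⟨fun i => ?_, by omega⟩
          by_cases hi : i = (B k).head
          · subst hi
            simp
          · rw [Function.update_of_ne hi]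
            refine (h1 i).trans ?_
            omega
      refine ⟨B', h1, (OracleMachine.Reaches.trans (t := 1) ?_ h2).mono (by omega)⟩
      refine goes_of_core (by simp) (by simp) (f := keep (reads A))
        (g := fun k => (.blank, retreat (reads B k))) ?_ (fun k => act_keep _ k) (fun k => rfl)
      simp only [core]
      rw [if_neg e]

end Substitution

end ParamSpace

/-! ### A complete simulated oracle call -/

namespace ParamSpace

open Translate

namespace Substitution

open State Tape

variable {X Y V W : Type} {M N : OracleMachine} {θ : Baire}
  {A : TapeName M.Work → Tape M.Aux}
  {B : TapeName N.Work → Tape (Symbol M.Aux N.Aux)} {q s : Str}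

theorem setQuery_self {A : TapeName V → Tape X} {T : Tape X} (h : A .query = T) :
    setQuery A T = A := by
  funext k
  cases k <;> first | rfl | exact h.symm

theorem setAnswer_self {A : TapeName V → Tape X} {T : Tape X} (h : A .answer = T) :
    setAnswer A T = A := by
  funext k
  cases k <;> first | rfl | exact h.symm

theorem setInput_self {A : TapeName V → Tape X} {T : Tape X} (h : A .input = T) :
    setInput A T = A := by
  funext k
  cases k <;> first | rfl | exact h.symm

theorem setOutput_self {A : TapeName V → Tape X} {T : Tape X} (h : A .output = T) :
    setOutput A T = A := by
  funext k
  cases k <;> first | rfl | exact h.symm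

theorem inputPart_eq_blank {q : Str} {d : ℤ} {j : ℕ} (h : q.length ≤ j) (i : ℤ) :
    (inputPart q d j : ℤ → Cell (Symbol X Y)) i = .blank := by
  rw [inputPart, if_neg (by omega)]

/-- Marking the origin visits cell `0` even if the query is empty, whence the right end `max 1
q.length`. A blank tape is the special case of the empty word, so the lemma serves for all tapes. -/
theorem represents_mark (q : Str) (d : ℤ) :
    Represents (⟨cellsOf q, 0⟩ : Tape Y)
      ((⟨inputPart q d 0, d⟩ : Tape (Symbol X Y)).act (visited (unvisit (inputPart
        (X := X) (Y := Y) q d 0 d)) true) .stay) d 0 (max 1 q.length) := by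
  refine ⟨fun i => ?_, fun i hi => ?_, ?_, le_rfl, by omega, by simp, by simp⟩
  · have e : unvisit (inputPart (X := X) (Y := Y) q d 0 d) = cellsOf q 0 := by
      rw [inputPart]
      split_ifs with h
      · rw [unvisit_visited, sub_self]
      · rw [List.eq_nil_of_length_eq_zero (by omega : q.length = 0)]
        rfl
    rw [e]
    simp only [Tape.act, Function.update_apply, inputPart, Nat.cast_zero, zero_add]
    by_cases hi : i = 0
    · subst hi
      have h1 : (0 : ℤ) + d = d := zero_add d
      have h2 : (0 : ℤ) ≤ 0 ∧ (0 : ℤ) < max 1 (q.length : ℤ) := by omega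
      rw [if_pos h1, if_pos h2]
      rfl
    · rw [if_neg (by omega), add_sub_cancel_right, decide_eq_false hi]
      congr 1
      apply propext
      omega
  · change cellsOf q i = .blank
    rcases i with i | i
    · change cellsOf q ((i : ℕ) : ℤ) = .blank
      have : q.length ≤ i := by
        by_contra h
        apply hi
        simp only [Int.ofNat_eq_natCast]
        omega
      rw [cellsOf_eq, cellsBy_natCast, List.getElem?_eq_none this]
      rfl
    · rfl
  · simp [Tape.act, Move.shift]

/-- The tape `T'` represents `T`, with at most `w` visited cells. -/
def Simulates (T : Tape Y) (T' : Tape (Symbol X Y)) (w : ℕ) : Prop :=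
  ∃ d lo hi, Represents T T' d lo hi ∧ hi - lo ≤ w

theorem Simulates.length_content_le {T : Tape Y} {T' : Tape (Symbol X Y)} {w : ℕ}
    (h : Simulates T T' w) : T.content.length ≤ w := by
  obtain ⟨d, lo, hi, h, hw⟩ := h
  have h1 := h.length_content_le
  have h2 := h.lo_le
  omega

/-- Earlier calls leave the heads at unrelated positions on blank tapes. Every tape therefore takes
the current position of its head as its origin. -/
theorem goes_mark (d : ℤ) (hB : ∀ k i, (B k).cells i = .blank) :
    ∃ B' : TapeName N.Work → Tape (Symbol M.Aux N.Aux),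
      (∀ k, Simulates ((N.init q).tapes k) (B' k) (q.length + 1)) ∧
      Goes θ 1 (conf mark A (setInput B ⟨inputPart q d 0, d⟩)) (conf (sim N.start) A B') := by
  refine ⟨fun k => (setInput B ⟨inputPart q d 0, d⟩ k).act
      (visited (unvisit (reads (setInput B ⟨inputPart q d 0, d⟩) k)) true) .stay, fun k => ?_,
    goes_of_core (by simp) (by simp) rfl (fun k => act_keep _ k) (fun k => rfl)⟩
  have hB' : ∀ k, B k = ⟨inputPart [] (B k).head 0, (B k).head⟩ := fun k => by
    have : (B k).cells = inputPart [] (B k).head 0 := funext fun i =>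
      (hB k i).trans (inputPart_eq_blank (by simp) i).symm
    rw [← this]
  have key : ∀ k, Simulates (⟨cellsOf [], 0⟩ : Tape N.Aux)
      ((B k).act (visited (unvisit (B k).read) true) .stay) (q.length + 1) := fun k => by
    have h := represents_mark (X := M.Aux) (Y := N.Aux) [] (B k).head
    refine ⟨(B k).head, 0, max 1 ([] : Str).length, ?_, by simp⟩
    have e := hB' k
    have e2 : (B k).read = inputPart [] (B k).head 0 (B k).head := by
      rw [Tape.read, hB, inputPart_eq_blank (by simp)]
    rw [e2]
    rw [← e] at h
    exact h
  cases k with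
  | input => exact ⟨d, 0, max 1 q.length, represents_mark q d, by push_cast; omega⟩
  | output => exact key .output
  | query => exact key .query
  | answer => exact key .answer
  | work v => exact key (.work v)

/-- One step is simulated by one step. A head lies in the visited block or next to it, so a step
enlarges the block by at most one cell. The machine must not halt early, because in the halting
state the composed machine turns to the output. -/
theorem goes_sim (hN : N.OracleFree) (t : ℕ) : ∀ (c : N.Cfg)
    (B : TapeName N.Work → Tape (Symbol M.Aux N.Aux)) (w : ℕ), c.state ≠ N.oracle →
    (∀ k, Simulates (c.tapes k) (B k) w) →
    (∀ u < t, ((N.step θ)^[u] c).state ≠ N.halt) →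
    ∃ B' : TapeName N.Work → Tape (Symbol M.Aux N.Aux),
      (∀ k, Simulates (((N.step θ)^[t] c).tapes k) (B' k) (w + t)) ∧
      Goes θ t (conf (sim c.state) A B) (conf (sim ((N.step θ)^[t] c).state) A B') := by
  induction t with
  | zero => exact fun c B w _ hB _ => ⟨B, hB, .refl _ _⟩
  | succ t ih =>
    intro c B w hc hB ht
    have h0 : c.state ≠ N.halt := ht 0 (by omega)
    have hs := OracleMachine.step_eq (φ := θ) h0 hc
    obtain ⟨B', h1, h2⟩ := ih (N.step θ c) (fun k => (B k).act
        (visited ((N.trans c.state fun k => unvisit (reads B k)).2 k).1 (isOrigin (reads B k)))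
        ((N.trans c.state fun k => unvisit (reads B k)).2 k).2) (w + 1)
      (by rw [hs]; exact hN.2 _ _) (fun k => by
        have e : (fun k => unvisit (reads B k)) = fun k => (c.tapes k).read := by
          funext k
          obtain ⟨d, lo, hi, h, _⟩ := hB k
          exact h.unvisit_read
        obtain ⟨d, lo, hi, h, hw⟩ := hB k
        rw [hs, e]
        refine ⟨d, _, _, h.act _ _, ?_⟩
        have h3 := h.le_head
        have h4 := h.head_le
        have h5 := h.lo_le
        have h6 := h.lt_hi
        push_cast
        omega)
      (fun u hu => by
        rw [← Function.iterate_succ_apply]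
        exact ht (u + 1) (by omega))
    refine ⟨B', fun k => ?_, (OracleMachine.Reaches.trans (t := 1) ?_ h2).mono (by omega)⟩
    · have := h1 k
      rw [add_assoc, add_comm 1 t] at this
      exact this
    · refine goes_of_core (by simp) (by simp) (f := keep (reads A)) (g := fun k =>
        (visited ((N.trans c.state fun k => unvisit (reads B k)).2 k).1 (isOrigin (reads B k)),
          ((N.trans c.state fun k => unvisit (reads B k)).2 k).2)) ?_ (fun k => act_keep _ k)
        (fun k => rfl)
      have e : (fun k => unvisit (reads B k)) = fun k => (c.tapes k).read := by
        funext k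
        obtain ⟨d, lo, hi, h, _⟩ := hB k
        exact h.unvisit_read
      simp only [core]
      rw [if_neg h0, hs]
      simp only [e]

/-- On a halting configuration, the composed machine copies the output of the second machine and
erases its tapes. -/
theorem goes_finish {c : N.Cfg} {w : ℕ} (hc : c.state = N.halt)
    (hB : ∀ k, Simulates (c.tapes k) (B k) w) (hA : A .answer = ⟨cellsOf [], 0⟩) :
    ∃ B' : TapeName N.Work → Tape (Symbol M.Aux N.Aux), (∀ k i, (B' k).cells i = .blank) ∧
      Goes θ (6 * w + 15) (conf (sim c.state) A B)
        (conf (main M.resume) (setAnswer A ⟨cellsOf (c.tapes .output).content, 0⟩) B') := by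
  set B1 : TapeName N.Work → Tape (Symbol M.Aux N.Aux) := fun k =>
    (B k).act (visited (unvisit (reads B k)) (isOrigin (reads B k))) .stay with hB1
  have hstep : Goes θ 1 (conf (sim c.state) A B) (conf seekOutputEnd A B1) := by
    refine goes_of_core (by simp) (by simp) (f := keep (reads A)) (g := fun k =>
      (visited (unvisit (reads B k)) (isOrigin (reads B k)), .stay)) ?_ (fun k => act_keep _ k)
      (fun k => rfl)
    simp only [core]
    rw [if_pos hc]
  -- The step that leaves the simulation visits the scanned cells once more, so every head now lies
  -- inside its visited block.
  have hR : ∀ k, ∃ d lo hi, Represents (c.tapes k) (B1 k) d lo hi ∧ hi - lo ≤ w + 1 ∧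
      lo ≤ (c.tapes k).head ∧ (c.tapes k).head < hi := fun k => by
    obtain ⟨d, lo, hi, h, hw⟩ := hB k
    have h' := h.act (unvisit (reads B k)) .stay
    have e : unvisit (reads B k) = (c.tapes k).read := h.unvisit_read
    have e2 : (c.tapes k).act (unvisit (reads B k)) .stay = c.tapes k := by
      rw [e, Tape.act_read_stay]
    rw [e2] at h'
    have h3 := h.le_head
    have h4 := h.head_le
    have h5 := h.lo_le
    have h6 := h.lt_hi
    exact ⟨d, _, _, h', by omega, by omega, by omega⟩
  have hlen := (hB .output).length_content_le
  obtain ⟨d, lo, hi, h, hw, hlo, hhi⟩ := hR .output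
  have hl := h.length_content_le
  have h5 := h.lo_le
  have h6 := h.lt_hi
  set v := (c.tapes .output).content with hv
  have hBs : setOutput B1 ⟨(B1 .output).cells, (c.tapes .output).head + d⟩ = B1 :=
    setOutput_self (by rw [← h.head])
  have g1 := goes_seekOutputEnd (θ := θ) (A := A) (B := B1) h.ne_blank_iff
    (hi - (c.tapes .output).head).toNat ((c.tapes .output).head + d) (by omega) (by omega)
  rw [hBs] at g1
  have g2 := goes_seekOrigin (θ := θ) (A := A) (B := B1) h.isOrigin_cells (hi - 1).toNat
  rw [show ((hi - 1).toNat : ℤ) + d = hi + d + -1 by omega] at g2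
  obtain ⟨hc1, hc2⟩ := content_spec (c.tapes .output) ⟨hi.toNat, by
    have h1 : ((hi.toNat : ℕ) : ℤ) = hi := Int.toNat_of_nonneg (by omega)
    rw [h1, h.outside hi (by omega)]
    rfl⟩
  rw [← hv] at hc1 hc2
  have g3 := goes_copyOutput (θ := θ) (A := A) (B := B1) (w := v)
    (fun n hn => by rw [h.unvisit_cells]; exact hc1 n hn)
    (by rw [h.unvisit_cells]; exact hc2) v.length 0 (by omega)
  rw [List.take_zero, Nat.cast_zero, setAnswer_self hA] at g3
  rw [Nat.cast_zero] at g2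
  set B2 := setOutput B1 ⟨(B1 .output).cells, (v.length : ℤ) + d⟩ with hB2
  have g4 := goes_rewindAnswer (θ := θ) (M := M) (A := A) (B := B2) (s := v) v.length le_rfl
  have hB2k : ∀ k, ∃ lo hi : ℤ, (∀ i, (B2 k).cells i ≠ .blank ↔ lo ≤ i ∧ i < hi) ∧
      lo ≤ (B2 k).head ∧ (B2 k).head ≤ hi ∧ hi - lo ≤ w + 1 ∧ lo < hi := fun k => by
    obtain ⟨d', lo', hi', h', hw', hlo', hhi'⟩ := hR k
    have hh := h'.head
    have other : B2 k = B1 k → ∃ lo hi : ℤ, (∀ i, (B2 k).cells i ≠ .blank ↔ lo ≤ i ∧ i < hi) ∧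
        lo ≤ (B2 k).head ∧ (B2 k).head ≤ hi ∧ hi - lo ≤ w + 1 ∧ lo < hi := fun e => by
      rw [e]
      exact ⟨lo' + d', hi' + d', h'.ne_blank_iff, by omega, by omega, by omega, by omega⟩
    cases k with
    | output =>
      exact ⟨lo + d, hi + d, h.ne_blank_iff, by change lo + d ≤ v.length + d; omega,
        by change v.length + d ≤ _; omega, by omega, by omega⟩
    | input => exact other rfl
    | query => exact other rfl
    | answer => exact other rfl
    | work v => exact other rfl
  obtain ⟨B3, h3, g5⟩ := goes_seekEnds (θ := θ) (M := M)
    (A := setAnswer A ⟨cellsOf v, 0⟩) (w + 1) B2 fun k => by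
      obtain ⟨lo, hi, h1, h2, h3, h4, _⟩ := hB2k k
      exact ⟨lo, hi, h1, h2, h3, by push_cast; omega⟩
  obtain ⟨B4, h4, g6⟩ := goes_eraseTapes (θ := θ) (M := M)
    (A := setAnswer A ⟨cellsOf v, 0⟩) (w + 1) B3 fun k => by
      obtain ⟨lo, hi, h1, _, _, h4, h7⟩ := hB2k k
      obtain ⟨e, lo', h1'⟩ := h3 k
      refine ⟨lo', fun i => by rw [e]; exact h1' i, ?_⟩
      have e1 := fun i => (h1 i).symm.trans (h1' i)
      have a1 := e1 lo
      have a2 := e1 (hi - 1)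
      have a3 := e1 lo'
      have a4 := e1 (B3 k).head
      push_cast
      omega
  exact ⟨B4, h4, (hstep.trans (g1.trans (g2.trans (g3.trans (g4.trans
    (g5.trans g6)))))).mono (by omega)⟩

/-- The least halting time is taken, so that the simulation meets no halting state before its end.
-/
theorem exists_halt {v : Str} {t : ℕ} (hv : v ∈ N.eval θ q) (ht : N.time θ q ≤ t) :
    ∃ u ≤ t, ((N.step θ)^[u] (N.init q)).state = N.halt ∧
      (∀ r < u, ((N.step θ)^[r] (N.init q)).state ≠ N.halt) ∧
      (((N.step θ)^[u] (N.init q)).tapes .output).content = v := by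
  obtain ⟨hne, hv⟩ := hv
  refine ⟨sInf (N.haltTimes θ q), ?_, Nat.sInf_mem hne, fun r hr => Nat.notMem_of_lt_sInf hr, hv⟩
  have h1 : ((sInf (N.haltTimes θ q) : ℕ) : ℕ∞) ≤ N.time θ q :=
    le_iInf₂ fun r hr => by exact_mod_cast Nat.sInf_le hr
  exact_mod_cast h1.trans ht

/-- The output lies in visited cells, and the simulation counts those. The first machine of the
composition plays no role, so `N` is used for it too. -/
theorem length_le_of_mem_eval (hN : N.OracleFree) {v : Str} {t : ℕ} (hv : v ∈ N.eval θ q)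
    (ht : N.time θ q ≤ t) : v.length ≤ q.length + 1 + t := by
  obtain ⟨u, hut, -, hbefore, e⟩ := exists_halt hv ht
  obtain ⟨B1, h1, -⟩ := goes_mark (θ := θ) (M := N) (N := N) (A := (N.init []).tapes) (q := q)
    (B := fun _ => ⟨fun _ => .blank, 0⟩) 0 fun _ _ => rfl
  obtain ⟨B2, h2, -⟩ := goes_sim (θ := θ) (M := N) (A := (N.init []).tapes) hN u (N.init q) B1
    (q.length + 1) hN.1 h1 hbefore
  have h3 := (h2 .output).length_content_le
  rw [e] at h3
  omega

/-- The composed machine replaces the oracle by the string function that the second machine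
computes. -/
theorem goes_call (hN : N.OracleFree) {t : ℕ} (hA : A .query = ⟨cellsOf q, q.length⟩)
    (hA' : A .answer = ⟨cellsOf s, 0⟩) (hB : ∀ k i, (B k).cells i = .blank) {v : Str}
    (hM : M.oracle ≠ M.halt) (hv : v ∈ N.eval θ q) (ht : N.time θ q ≤ t) :
    ∃ B' : TapeName N.Work → Tape (Symbol M.Aux N.Aux), (∀ k i, (B' k).cells i = .blank) ∧
      Goes θ (8 * q.length + 2 * s.length + 7 * t + 30) (conf (main M.oracle) A B)
        (conf (main M.resume) (setAnswer A ⟨cellsOf v, 0⟩) B') := by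
  obtain ⟨u, hut, hhalt, hbefore, e⟩ := exists_halt hv ht
  have g0 : Goes θ 1 (conf (main M.oracle) A B)
      (conf copyQuery (setQuery A ⟨cellsOf q, (q.length : ℤ) + -1⟩) B) := by
    refine goes_of_core (by simpa using hM) (by simp)
      (f := onQuery (reads A) (reads A .query, .left)) (g := keep (reads B))
      (by simp only [core, if_true]) (fun k => ?_) (fun k => act_keep _ k)
    have h1 := act_onQuery A (A .query) (A .query).read .left k
    rw [setQuery_self rfl] at h1
    refine h1.trans ?_
    rw [hA]
    exact congrArg (fun T => setQuery A T k) (act_read _ _ _)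
  -- The shift for which the current head position on the simulated input tape is that of the last
  -- letter of the query.
  set d : ℤ := (B .input).head - (q.length - 1) with hd
  have hBi : setInput B ⟨inputPart q d q.length, (q.length : ℤ) - 1 + d⟩ = B := by
    refine setInput_self ?_
    have e1 : (B .input).cells = inputPart q d q.length := funext fun i =>
      (hB _ i).trans (inputPart_eq_blank le_rfl i).symm
    have e2 : (q.length : ℤ) - 1 + d = (B .input).head := by omega
    rw [e2, ← e1]
  have g1 := goes_copyQuery (θ := θ) (A := A) (B := B) (q := q) d q.length le_rfl
  rw [hBi] at g1
  have g2 := goes_seekQueryEnd (θ := θ) (A := A) (B := setInput B ⟨inputPart q d 0, d⟩) (q := q)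
    q.length 0 (by omega)
  rw [setQuery_self hA] at g2
  have g3 := goes_seekAnswerEnd (θ := θ) (A := A) (B := setInput B ⟨inputPart q d 0, d⟩) (s := s)
    s.length 0 (by omega)
  rw [Nat.cast_zero, setAnswer_self hA'] at g3
  have g4 := goes_eraseAnswer (θ := θ) (A := A) (B := setInput B ⟨inputPart q d 0, d⟩) s
  obtain ⟨B1, h1, g5⟩ := goes_mark (θ := θ) (M := M) (A := setAnswer A ⟨cellsOf [], 0⟩) (q := q)
    d hB
  obtain ⟨B2, h2, g6⟩ := goes_sim (θ := θ) (A := setAnswer A ⟨cellsOf [], 0⟩) hN u (N.init q) B1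
    (q.length + 1) hN.1 h1 hbefore
  obtain ⟨B3, h3, g7⟩ := goes_finish (θ := θ) (A := setAnswer A ⟨cellsOf [], 0⟩) hhalt h2 rfl
  rw [e] at g7
  refine ⟨B3, h3, ?_⟩
  have e2 : setAnswer (setAnswer A ⟨cellsOf [], 0⟩) ⟨cellsOf v, 0⟩ =
      setAnswer A ⟨cellsOf v, 0⟩ := by
    funext k
    cases k <;> rfl
  rw [e2] at g7
  exact (g0.trans (g1.trans (g2.trans (g3.trans (g4.trans (g5.trans
    (g6.trans g7))))))).mono (by omega)

end Substitution

end ParamSpace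

/-! ### Eliminating the oracle from a whole run -/

namespace ParamSpace

open Translate

namespace Substitution

open State Tape

variable {X Y : Type} {M N : OracleMachine} {θ φ : Baire}

/-- Each step is charged with the cost of a full oracle call. The discipline supplies the data of
the call, and blank simulation tapes are the invariant that lets the next call start. -/
theorem goes_of_reaches (hN : N.OracleFree) {b T S : ℕ}
    (hφ : ∀ q : Str, q.length ≤ b → φ q ∈ N.eval θ q ∧ N.time θ q ≤ T) (hS : size φ b ≤ S)
    {t : ℕ} {c c' : M.Cfg} (h : M.Reaches φ (Disciplined φ b) t c c') :
    ∀ B : TapeName N.Work → Tape (Symbol M.Aux N.Aux), (∀ k i, (B k).cells i = .blank) →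
    ∃ B' : TapeName N.Work → Tape (Symbol M.Aux N.Aux),
      Goes θ (t * (8 * b + 2 * S + 7 * T + 30)) (conf (main c.state) c.tapes B)
        (conf (main c'.state) c'.tapes B') := by
  induction h with
  | refl t c => exact fun B _ => ⟨B, .refl _ _⟩
  | @head t c c' hD _ ih =>
    intro B hB
    suffices ∃ B' : TapeName N.Work → Tape (Symbol M.Aux N.Aux), (∀ k i, (B' k).cells i = .blank) ∧
        Goes θ (8 * b + 2 * S + 7 * T + 30) (conf (main c.state) c.tapes B)
          (conf (main (M.step φ c).state) (M.step φ c).tapes B') by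
      obtain ⟨B1, h1, g1⟩ := this
      obtain ⟨B2, g2⟩ := ih B1 h1
      exact ⟨B2, (g1.trans g2).mono (le_of_eq (by ring))⟩
    by_cases hh : c.state = M.halt
    · rw [OracleMachine.step_of_halt hh]
      exact ⟨B, hB, .refl _ _⟩
    by_cases ho : c.state = M.oracle
    · obtain ⟨q, s, hq, hqb, hs, hsb⟩ := hD ho
      obtain ⟨h1, h2⟩ := hφ q hqb
      obtain ⟨B1, h3, g⟩ := goes_call hN hq hs hB (ho ▸ hh) h1 h2
      refine ⟨B1, h3, ?_⟩
      have e1 : (M.step φ c).state = M.resume := by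
        rw [OracleMachine.step, if_neg hh, if_pos ho]
      have e2 : (M.step φ c).tapes = setAnswer c.tapes ⟨cellsOf (φ q), 0⟩ := by
        have hq' : (c.tapes .query).content = q := by rw [hq, content_cellsOf]
        funext k
        simp only [OracleMachine.step, if_neg hh, if_pos ho, hq', hs]
        cases k <;> rfl
      rw [e1, e2, ho]
      exact g.mono (by omega)
    · refine ⟨B, hB, OracleMachine.Reaches.mono (t := 1) ?_ (by omega)⟩
      rw [OracleMachine.step_eq hh ho]
      refine goes_of_core (f := (M.trans c.state (reads c.tapes)).2) (g := keep (reads B))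
        (by simpa using hh) (by simp) ?_ (fun k => rfl) (fun k => act_keep _ k)
      simp only [core]
      rw [if_neg ho]
      rfl

theorem letter?_lift (c : Cell X) : (lift c : Cell (Symbol X Y)).letter? = c.letter? := by
  cases c <;> rfl

theorem content_liftTape (T : Tape X) : (liftTape T : Tape (Symbol X Y)).content = T.content := by
  simp only [content, liftTape, letter?_lift]

theorem init_eq (a : Str) : (machine M N).init a =
    conf (main M.start) (M.init a).tapes fun _ => ⟨fun _ => .blank, 0⟩ := by
  have h : ∀ s : Str, (cellsOf s : ℤ → Cell (Symbol M.Aux N.Aux)) =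
      fun i => lift (cellsOf s i : Cell M.Aux) := fun s => by
    funext i
    rcases i with i | i
    · simp only [cellsOf]
      cases s[i]? <;> rfl
    · rfl
  refine congrArg (OracleMachine.Cfg.mk (M := machine M N) (main M.start)) (funext fun k => ?_)
  have h0 : (cellsOf [] : ℤ → Cell (Symbol M.Aux N.Aux)) = fun _ => .blank := by
    funext i
    rcases i with i | i <;> rfl
  rcases k with _ | _ | _ | _ | (w | k)
  · exact congrArg (fun c => (⟨c, 0⟩ : Tape (Symbol M.Aux N.Aux))) (h a)
  · exact congrArg (fun c => (⟨c, 0⟩ : Tape (Symbol M.Aux N.Aux))) (h [])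
  · exact congrArg (fun c => (⟨c, 0⟩ : Tape (Symbol M.Aux N.Aux))) (h [])
  · exact congrArg (fun c => (⟨c, 0⟩ : Tape (Symbol M.Aux N.Aux))) (h [])
  · exact congrArg (fun c => (⟨c, 0⟩ : Tape (Symbol M.Aux N.Aux))) (h [])
  · exact congrArg (fun c => (⟨c, 0⟩ : Tape (Symbol M.Aux N.Aux))) h0

end Substitution

/-! ## Polynomial bounds -/

theorem monotone_eval (p : Polynomial ℕ) : Monotone fun n => p.eval n := by
  intro m n h
  simp only [Polynomial.eval_eq_sum_range]
  gcongr

/-- The function is bounded by a polynomial. -/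
def PolynomiallyBounded (f : ℕ → ℕ) : Prop := ∃ p : Polynomial ℕ, ∀ n, f n ≤ p.eval n

namespace PolynomiallyBounded

variable {f g : ℕ → ℕ}

theorem const (k : ℕ) : PolynomiallyBounded fun _ => k := ⟨.C k, fun n => by simp⟩

theorem add (hf : PolynomiallyBounded f) (hg : PolynomiallyBounded g) :
    PolynomiallyBounded fun n => f n + g n := by
  obtain ⟨p, hp⟩ := hf
  obtain ⟨q, hq⟩ := hg
  exact ⟨p + q, fun n => by rw [Polynomial.eval_add]; exact Nat.add_le_add (hp n) (hq n)⟩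

theorem mul (hf : PolynomiallyBounded f) (hg : PolynomiallyBounded g) :
    PolynomiallyBounded fun n => f n * g n := by
  obtain ⟨p, hp⟩ := hf
  obtain ⟨q, hq⟩ := hg
  exact ⟨p * q, fun n => by rw [Polynomial.eval_mul]; exact Nat.mul_le_mul (hp n) (hq n)⟩

theorem comp (hf : PolynomiallyBounded f) (hg : PolynomiallyBounded g) :
    PolynomiallyBounded fun n => f (g n) := by
  obtain ⟨p, hp⟩ := hf
  obtain ⟨q, hq⟩ := hg
  exact ⟨p.comp q, fun n => by
    rw [Polynomial.eval_comp]
    exact (hp _).trans (monotone_eval p (hq n))⟩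

/-- Polynomials with natural coefficients are monotone, so polynomial bounds can be substituted into
each other; the claim follows by induction on the second-order polynomial. -/
theorem of_sop {P : (ℕ → ℕ) → ℕ → ℕ} (hP : SOP P) (hf : PolynomiallyBounded f) :
    PolynomiallyBounded (P f) := by
  induction hP with
  | poly p => exact ⟨p, fun n => le_rfl⟩
  | app _ ih => exact hf.comp ih
  | add _ _ ih ih' => exact ih.add ih'
  | mul _ _ ih ih' => exact ih.mul ih'

end PolynomiallyBounded

/-! ## Polytime computable points -/

/-- An oracle machine with a polytime computable oracle, running for polynomially many steps and
asking queries of polynomial length, computes a polytime computable function. -/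
theorem polytimeStringFunction_of_reaches {M : OracleMachine} {φ ψ : Baire} {b T : ℕ → ℕ}
    (hφ : PolytimeStringFunction φ) (hb : PolynomiallyBounded b) (hT : PolynomiallyBounded T)
    (h : ∀ a : Str, ∃ c, M.Reaches φ (Disciplined φ (b a.length)) (T a.length) (M.init a) c ∧
      c.state = M.halt ∧ (c.tapes .output).content = ψ a) : PolytimeStringFunction ψ := by
  obtain ⟨N, p, hN, hp⟩ := hφ
  have hpb : PolynomiallyBounded fun n => p.eval (b n) := .comp ⟨p, fun _ => le_rfl⟩ hb
  obtain ⟨r, hr⟩ : PolynomiallyBounded fun n => T n * (8 * b n + 2 * (b n + 1 + p.eval (b n)) +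
      7 * p.eval (b n) + 30) :=
    hT.mul (((((PolynomiallyBounded.const 8).mul hb).add ((PolynomiallyBounded.const 2).mul
      ((hb.add (.const 1)).add hpb))).add ((PolynomiallyBounded.const 7).mul hpb)).add (.const 30))
  refine ⟨Substitution.machine M N, r, Substitution.machine_oracleFree M N, fun θ a => ?_⟩
  have hq : ∀ q : Str, q.length ≤ b a.length → N.time θ q ≤ (p.eval (b a.length) : ℕ) :=
    fun q hq => (hp θ q).2.trans (by exact_mod_cast monotone_eval p hq)
  -- The ordinary machine for the oracle answers within its running time, so previous answers, which
  -- have to be erased, are short.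
  have hS : size φ (b a.length) ≤ b a.length + 1 + p.eval (b a.length) := by
    refine csSup_le ⟨(φ []).length, [], Nat.zero_le _, rfl⟩ ?_
    rintro k ⟨q, hqb, rfl⟩
    exact (Substitution.length_le_of_mem_eval hN (hp θ q).1 (hq q hqb)).trans (by omega)
  obtain ⟨c, hc, hhalt, e⟩ := h a
  obtain ⟨B', g⟩ := Substitution.goes_of_reaches (θ := θ) hN
    (fun q hqb => ⟨(hp θ q).1, hq q hqb⟩) hS hc (fun _ => ⟨fun _ => .blank, 0⟩) fun _ _ => rfl
  have g' : (Substitution.machine M N).Reaches θ (fun _ => True) _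
      ((Substitution.machine M N).init a) _ := (Substitution.init_eq (N := N) a).symm ▸ g
  obtain ⟨h1, h2⟩ := g'.halts (congrArg Substitution.State.main hhalt)
  refine ⟨?_, h1.trans (by exact_mod_cast hr a.length)⟩
  have e2 : ((Substitution.conf (N := N) (.main c.state) c.tapes B').tapes .output).content = ψ a :=
    (Substitution.content_liftTape _).trans e
  rw [← e2]
  exact h2

/-- The translated name inherits both properties: substitution makes it polytime computable, and its
parameter is bounded by a second-order polynomial in a polynomial. -/
theorem PolytimePoint.space {inI : Bool} (outI : Bool) {x : ℝ}
    (h : PolytimePoint (space inI) x) : PolytimePoint (space outI) x := by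
  obtain ⟨φ, hx, hφ, hl⟩ := h
  have hn := mem_space_rep.1 hx
  rw [space_param φ hn] at hl
  have hl : PolynomiallyBounded (rate inI φ x) := hl
  obtain ⟨ψ, h1, h2, h3⟩ := exists_translation inI outI hn
  have hx' := mem_space_rep.2 h1
  refine ⟨⟨ψ, hx'.1⟩, hx', polytimeStringFunction_of_reaches hφ (.of_sop sop_paramBound hl)
    (.of_sop sop_timeBound hl) h3, ?_⟩
  rw [space_param ⟨ψ, hx'.1⟩ h1]
  obtain ⟨p, hp⟩ := PolynomiallyBounded.of_sop sop_paramBound hl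
  exact ⟨p, fun n => (h2 n).trans (hp n)⟩

end ParamSpace

theorem mainTheorem2 :
    IsParametrisedSpace intervalReals ∧ IsParametrisedSpace cauchyReals ∧
      PolytimeIsomorphic intervalReals cauchyReals ∧
      PolytimeEquivalent intervalReals cauchyReals ∧
      ∀ x : ℝ, PolytimePoint intervalReals x ↔ PolytimePoint cauchyReals x :=
  ⟨polytimeComputable_id true true, polytimeComputable_id false false,
    ⟨id, id, polytimeComputable_id true false, polytimeComputable_id false true, rfl, rfl⟩,
    ⟨polytimeComputable_id true false, polytimeComputable_id false true⟩,
    fun _ => ⟨PolytimePoint.space (inI := true) false, PolytimePoint.space (inI := false) true⟩⟩
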